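/- Let $d\ge 1$ be an integer, and let $C_0([0,1]^d)$ be the space of continuous functions $f\colon[0,1]^d\to\mathbb R$ such that $f(x)=0$ whenever some $x_i=0$. **Strong charges.** $BV([0,1]^d)$ is the space of (classes of) integrable functions $u$ on $\mathbb R^d$ that vanish a.e. outside $[0,1]^d$ and whose variation $\|Du\|(\mathbb R^d)=\sup\{\int u\,\operatorname{div}v : v\in C^1_c(\mathbb R^d;\mathbb R^d),\ |v|\le 1\}$ is finite, with the norm $\|u\|_{BV}=\|u\|_1+\|Du\|(\mathbb R^d)$. For $g\in L^d([0,1]^d)$ let $T_g\in BV([0,1]^d)^*$ be the functional $T_g(u)=\int_{[0,1]^d}gu$, and let $SCH([0,1]^d)$ be the closure of $\{T_g: g\in L^d([0,1]^d)\}$ in $BV([0,1]^d)^*$. A $BV$-set is a measurable set $B\subset[0,1]^d$ of finite perimeter $\|B\|=\|D\mathbf 1_B\|(\mathbb R^d)$. A charge is a real function $\mu$ of $BV$-sets such that $\mu(B_1\cup B_2)=\mu(B_1)+\mu(B_2)$ whenever $|B_1\cap B_2|=0$, and $\mu(B_n)\to\mu(B)$ whenever $\sup_n\|B_n\|<\infty$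 and $|B_n\mathbin{\triangle}B|\to0$. A charge is strong if it has the form $B\mapsto\alpha(\mathbf 1_B)$ with $\alpha\in SCH([0,1]^d)$. **Strong chargeability.** For $f\in C_0([0,1]^d)$ and a rectangle $R=\prod_i[a_i,b_i]\subset[0,1]^d$ with $a_i<b_i$, let $\Delta_f(R)=\sum_{c\in\prod_i\{a_i,b_i\}}(-1)^{\#\{i:c_i=a_i\}}f(c)$. Extend $\Delta_f$ to the unique function of figures (finite unions of rectangles in $[0,1]^d$) that is additive on pairs of figures with negligible intersection. The function $f$ is strongly chargeable if $\Delta_f$ extends to a strong charge. **Haar functions and coefficients.** For every $n\ge0$ number the dyadic cubes of side $2^{-n}$ in $[0,1]^d$ as $K_{n,k}$, $0\le k<2^{nd}$, in such a way that $K_{n+1,2^dk+\ell}$, $0\le\ell<2^d$, are the $2^d$ subcubes of $K_{n,k}$ of side $2^{-(n+1)}$; any such numbering is allowed. Let $A_1=\begin{pmatrix}1&1\\1&-1\end{pmatrix}$ and $A_{m+1}=\begin{pmatrix}A_m&A_m\\A_m&-A_m\end{pmatrix}$, with rows and columns of $A_d$ numbered from $0$ to $2^d-1$. Put $g_{-1}=\mathbf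 1_{[0,1]^d}$, $\lambda_{-1}(f)=\Delta_f([0,1]^d)$ and, for $n\ge0$, $0\le k<2^{nd}$, $1\le r\le2^d-1$, $$g_{n,k,r}=2^{nd/2}\sum_{\ell=0}^{2^d-1}(A_d)_{r,\ell}\,\mathbf 1_{K_{n+1,2^dk+\ell}},\qquad \lambda_{n,k,r}(f)=2^{nd/2}\sum_{\ell=0}^{2^d-1}(A_d)_{r,\ell}\,\Delta_f(K_{n+1,2^dk+\ell}).$$ **Theorem.** A function $f\in C_0([0,1]^d)$ is strongly chargeable if and only if its Faber–Schauder series $$\lambda_{-1}(f)\,T_{g_{-1}}+\lambda_{0,0,1}(f)\,T_{g_{0,0,1}}+\lambda_{0,0,2}(f)\,T_{g_{0,0,2}}+\cdots,$$ in which the indices $(n,k,r)$ are ordered lexicographically, converges in $SCH([0,1]^d)$ (convergence in norm of the partial sums in this order). -/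

import Mathlib

open MeasureTheory Filter Topology
open scoped ENNReal

noncomputable section

namespace StrongCharge

/-- The ambient space `ℝ^d` with its Euclidean norm. -/
abbrev E (d : ℕ) : Type := EuclideanSpace ℝ (Fin d)

/-- The set `∏ i, [a i, b i]`. -/
def rect {d : ℕ} (a b : Fin d → ℝ) : Set (E d) := {x | ∀ i, a i ≤ x i ∧ x i ≤ b i}

/-- The unit cube `[0,1]^d`. -/
def cube (d : ℕ) : Set (E d) := rect (fun _ => 0) (fun _ => 1)

theorem measurableSet_rect {d : ℕ} (a b : Fin d → ℝ) : MeasurableSet (rect a b) := by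
  have : rect a b = ⋂ i, {x : E d | a i ≤ x i ∧ x i ≤ b i} := by
    ext x; simp [rect]
  rw [this]
  refine MeasurableSet.iInter fun i => ?_
  have h : Measurable fun x : E d => x i := by fun_prop
  exact (measurableSet_le measurable_const h).inter (measurableSet_le h measurable_const)

theorem isBounded_rect {d : ℕ} (a b : Fin d → ℝ) : Bornology.IsBounded (rect a b) := by
  have h : Bornology.IsBounded (Set.Icc a b) := Metric.isBounded_Icc a b
  have h2 := (PiLp.antilipschitzWith_ofLp 2 (fun _ : Fin d => ℝ)).isBounded_preimage h
  refine h2.subset fun x hx => ?_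
  exact ⟨fun i => (hx i).1, fun i => (hx i).2⟩

theorem volume_cube_lt_top (d : ℕ) : volume (cube d) < ∞ := (isBounded_rect _ _).measure_lt_top

/-! ### Functions of bounded variation -/

/-- The divergence `∑ i, ∂ v_i / ∂ x_i` of a vector field. -/
def divergence {d : ℕ} (v : E d → E d) (x : E d) : ℝ :=
  ∑ i, (fderiv ℝ v x (EuclideanSpace.single i 1)) i

/-- Compactly supported `C^1` vector fields on `ℝ^d` with `|v| ≤ 1`. -/
def IsTestField {d : ℕ} (v : E d → E d) : Prop :=
  ContDiff ℝ 1 v ∧ HasCompactSupport v ∧ ∀ x, ‖v x‖ ≤ 1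

/-- The variation `‖Du‖(ℝ^d)` of an integrable function `u`. -/
def variation {d : ℕ} (u : E d → ℝ) : ℝ≥0∞ :=
  ⨆ (v : E d → E d) (_ : IsTestField v), ENNReal.ofReal (∫ x, u x * divergence v x)

theorem continuous_divergence {d : ℕ} {v : E d → E d} (hv : IsTestField v) :
    Continuous (divergence v) := by
  have h := hv.1.continuous_fderiv (by norm_num)
  unfold divergence
  fun_prop

theorem integrable_mul_divergence {d : ℕ} {u : E d → ℝ} (hu : Integrable u) {v : E d → E d}
    (hv : IsTestField v) : Integrable (fun x => u x * divergence v x) := by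
  have hc := continuous_divergence hv
  have hs : HasCompactSupport (divergence v) := by
    refine (hv.2.1.fderiv (𝕜 := ℝ)).mono fun x hx => ?_
    contrapose! hx
    simp only [Function.mem_support, not_not] at hx ⊢
    simp [divergence, hx]
  obtain ⟨C, hC⟩ := hc.bounded_above_of_compact_support hs
  exact hu.mul_bdd hc.aestronglyMeasurable (Eventually.of_forall hC)

theorem variation_congr {d : ℕ} {u w : E d → ℝ} (h : u =ᵐ[volume] w) :
    variation u = variation w := by
  unfold variation
  refine iSup_congr fun v => iSup_congr fun _ => ?_
  congr 1
  refine integral_congr_ae ?_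
  filter_upwards [h] with x hx
  rw [hx]

theorem variation_zero {d : ℕ} : variation (fun _ : E d => (0 : ℝ)) = 0 := by
  simp [variation]

theorem variation_add_le {d : ℕ} {u w : E d → ℝ} (hu : Integrable u) (hw : Integrable w) :
    variation (fun x => u x + w x) ≤ variation u + variation w := by
  refine iSup₂_le fun v hv => ?_
  simp only [add_mul]
  rw [integral_add (integrable_mul_divergence hu hv) (integrable_mul_divergence hw hv)]
  refine ENNReal.ofReal_add_le.trans (add_le_add ?_ ?_)
  · exact le_iSup₂ (f := fun (v : E d → E d) (_ : IsTestField v) =>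
      ENNReal.ofReal (∫ x, u x * divergence v x)) v hv
  · exact le_iSup₂ (f := fun (v : E d → E d) (_ : IsTestField v) =>
      ENNReal.ofReal (∫ x, w x * divergence v x)) v hv

theorem IsTestField.neg {d : ℕ} {v : E d → E d} (hv : IsTestField v) :
    IsTestField (fun x => -v x) :=
  ⟨hv.1.neg, hv.2.1.neg, fun x => by simpa using hv.2.2 x⟩

theorem divergence_neg {d : ℕ} (v : E d → E d) (x : E d) :
    divergence (fun x => -v x) x = -divergence v x := by
  simp [divergence, fderiv_fun_neg]

theorem variation_smul_le {d : ℕ} (c : ℝ) (u : E d → ℝ) :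
    variation (fun x => c * u x) ≤ ENNReal.ofReal |c| * variation u := by
  refine iSup₂_le fun v hv => ?_
  simp only [mul_assoc]
  rw [integral_const_mul]
  rcases le_total 0 c with hc | hc
  · rw [ENNReal.ofReal_mul hc, abs_of_nonneg hc]
    gcongr
    exact le_iSup₂ (f := fun (v : E d → E d) (_ : IsTestField v) =>
      ENNReal.ofReal (∫ x, u x * divergence v x)) v hv
  · have h : c * ∫ x, u x * divergence v x
        = |c| * ∫ x, u x * divergence (fun x => -v x) x := by
      simp only [divergence_neg, mul_neg, integral_neg, abs_of_nonpos hc]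
      ring
    rw [h, ENNReal.ofReal_mul (abs_nonneg c)]
    gcongr
    exact le_iSup₂ (f := fun (v : E d → E d) (_ : IsTestField v) =>
      ENNReal.ofReal (∫ x, u x * divergence v x)) _ hv.neg

theorem variation_smul {d : ℕ} (c : ℝ) (u : E d → ℝ) :
    variation (fun x => c * u x) = ENNReal.ofReal |c| * variation u := by
  rcases eq_or_ne c 0 with rfl | hc
  · simp [variation_zero]
  · refine le_antisymm (variation_smul_le c u) ?_
    have h := variation_smul_le c⁻¹ (fun x => c * u x)
    simp only [inv_mul_cancel_left₀ hc] at h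
    calc ENNReal.ofReal |c| * variation u
        ≤ ENNReal.ofReal |c| * (ENNReal.ofReal |c⁻¹| * variation (fun x => c * u x)) := by gcongr
      _ = variation (fun x => c * u x) := by
        rw [← mul_assoc, ← ENNReal.ofReal_mul (abs_nonneg c), ← abs_mul, mul_inv_cancel₀ hc]
        simp

/-- The integrable functions on `ℝ^d` (up to a.e. equality) that vanish a.e. outside `[0,1]^d`
and have finite variation. -/
def bvSubmodule (d : ℕ) : Submodule ℝ (Lp ℝ 1 (volume : Measure (E d))) where
  carrier := {u | (∀ᵐ x, x ∉ cube d → u x = 0) ∧ variation u < ∞}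
  zero_mem' := by
    have h := Lp.coeFn_zero ℝ 1 (volume : Measure (E d))
    refine ⟨?_, ?_⟩
    · filter_upwards [h] with x hx _
      exact hx
    · rw [variation_congr (w := fun _ => 0) h, variation_zero]
      simp
  add_mem' := by
    rintro u w ⟨hu, hu'⟩ ⟨hw, hw'⟩
    have h := Lp.coeFn_add u w
    refine ⟨?_, ?_⟩
    · filter_upwards [h, hu, hw] with x hx h1 h2 hxc
      rw [hx, Pi.add_apply, h1 hxc, h2 hxc, add_zero]
    · rw [variation_congr (w := fun x => u x + w x) h]
      exact (variation_add_le (L1.integrable_coeFn u) (L1.integrable_coeFn w)).trans_lt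
        (ENNReal.add_lt_top.2 ⟨hu', hw'⟩)
  smul_mem' := by
    rintro c u ⟨hu, hu'⟩
    have h := Lp.coeFn_smul c u
    refine ⟨?_, ?_⟩
    · filter_upwards [h, hu] with x hx h1 hxc
      rw [hx, Pi.smul_apply, h1 hxc, smul_zero]
    · rw [variation_congr (w := fun x => c * u x) h, variation_smul]
      exact ENNReal.mul_lt_top (by simp) hu'

/-- The space `BV([0,1]^d)`. It is a type synonym of `bvSubmodule d`, because it carries the norm
`‖u‖₁ + ‖Du‖(ℝ^d)` instead of the `L¹` norm. -/
def BV (d : ℕ) : Type := bvSubmodule d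

namespace BV

variable {d : ℕ}

instance : AddCommGroup (BV d) := inferInstanceAs (AddCommGroup (bvSubmodule d))

instance : Module ℝ (BV d) := inferInstanceAs (Module ℝ (bvSubmodule d))

/-- The class in `L¹(ℝ^d)` of an element of `BV([0,1]^d)`. -/
def toL1 : BV d →ₗ[ℝ] Lp ℝ 1 (volume : Measure (E d)) := (bvSubmodule d).subtype

instance : CoeFun (BV d) (fun _ => E d → ℝ) := ⟨fun u => (toL1 u : E d → ℝ)⟩

theorem integrable (u : BV d) : Integrable (u : E d → ℝ) := L1.integrable_coeFn (toL1 u)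

theorem variation_lt_top (u : BV d) : variation (u : E d → ℝ) < ∞ :=
  (show toL1 u ∈ bvSubmodule d from Subtype.property (p := (· ∈ bvSubmodule d)) u).2

theorem coe_add (u w : BV d) : ((u + w : BV d) : E d → ℝ) =ᵐ[volume] fun x => u x + w x := by
  rw [map_add]; exact Lp.coeFn_add _ _

theorem coe_smul (c : ℝ) (u : BV d) : ((c • u : BV d) : E d → ℝ) =ᵐ[volume] fun x => c * u x := by
  rw [map_smul]; exact Lp.coeFn_smul _ _

instance : Norm (BV d) := ⟨fun u => ‖toL1 u‖ + (variation (u : E d → ℝ)).toReal⟩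

theorem norm_def (u : BV d) : ‖u‖ = ‖toL1 u‖ + (variation (u : E d → ℝ)).toReal := rfl

theorem normedSpaceCore : NormedSpace.Core ℝ (BV d) where
  norm_nonneg u := by rw [norm_def]; positivity
  norm_smul c u := by
    rw [norm_def, norm_def, variation_congr (coe_smul c u), variation_smul, map_smul, norm_smul,
      ENNReal.toReal_mul, ENNReal.toReal_ofReal (abs_nonneg c), Real.norm_eq_abs]
    ring
  norm_triangle u w := by
    have h1 : (variation ((u + w : BV d) : E d → ℝ)).toReal
        ≤ (variation (u : E d → ℝ)).toReal + (variation (w : E d → ℝ)).toReal := by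
      rw [variation_congr (coe_add u w),
        ← ENNReal.toReal_add u.variation_lt_top.ne w.variation_lt_top.ne]
      exact ENNReal.toReal_mono
        (ENNReal.add_lt_top.2 ⟨u.variation_lt_top, w.variation_lt_top⟩).ne
        (variation_add_le u.integrable w.integrable)
    have h2 := norm_add_le (toL1 u) (toL1 w)
    rw [norm_def, norm_def, norm_def, map_add]
    rw [map_add] at h1
    linarith
  norm_eq_zero_iff u := by
    constructor
    · intro h
      have h1 : ‖toL1 u‖ = 0 := by
        have := ENNReal.toReal_nonneg (a := variation (u : E d → ℝ))
        rw [norm_def] at h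
        have := norm_nonneg (toL1 u)
        linarith
      exact Subtype.ext (norm_eq_zero.1 h1)
    · rintro rfl
      have h : (((0 : BV d) : BV d) : E d → ℝ) =ᵐ[volume] fun _ => 0 := by
        rw [map_zero]; exact Lp.coeFn_zero _ _ _
      rw [norm_def, variation_congr h, variation_zero]
      simp

instance : NormedAddCommGroup (BV d) := NormedAddCommGroup.ofCore normedSpaceCore

instance : NormedSpace ℝ (BV d) := NormedSpace.ofCore normedSpaceCore

end BV

/-! ### Sets of bounded variation and charges -/

/-- The perimeter `‖B‖ = ‖D 1_B‖(ℝ^d)`. -/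
def perimeter {d : ℕ} (B : Set (E d)) : ℝ≥0∞ := variation (B.indicator fun _ => (1 : ℝ))

/-- The Lebesgue measurable subsets of `[0,1]^d` of finite perimeter. -/
def IsBVSet {d : ℕ} (B : Set (E d)) : Prop :=
  B ⊆ cube d ∧ NullMeasurableSet B ∧ perimeter B < ∞

theorem IsBVSet.integrable_indicator {d : ℕ} {B : Set (E d)} (hB : IsBVSet B) :
    Integrable (B.indicator fun _ => (1 : ℝ)) := by
  have h : IntegrableOn (fun _ => (1 : ℝ)) B :=
    integrableOn_const (((measure_mono hB.1).trans_lt (volume_cube_lt_top d)).ne)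
  exact h.integrable_indicator₀ hB.2.1

/-- The indicator function of a set of bounded variation, as an element of `BV([0,1]^d)`. -/
def IsBVSet.indicatorBV {d : ℕ} {B : Set (E d)} (hB : IsBVSet B) : BV d :=
  ⟨hB.integrable_indicator.toL1 _, by
    have h := hB.integrable_indicator.coeFn_toL1
    refine ⟨?_, ?_⟩
    · filter_upwards [h] with x hx hxc
      rw [hx, Set.indicator_of_notMem fun hxB => hxc (hB.1 hxB)]
    · rw [variation_congr h]
      exact hB.2.2⟩

/-- `BV`-convergence of a sequence of sets: bounded perimeters and convergence in measure. -/
def BVConverges {d : ℕ} (B : ℕ → Set (E d)) (B' : Set (E d)) : Prop :=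
  (⨆ n, perimeter (B n)) < ∞ ∧ Tendsto (fun n => volume (symmDiff (B n) B')) atTop (𝓝 0)

/-- `μ` is a charge on `[0,1]^d`. Only the values of `μ` on sets of bounded variation matter. -/
def IsCharge {d : ℕ} (μ : Set (E d) → ℝ) : Prop :=
  (∀ B₁ B₂, IsBVSet B₁ → IsBVSet B₂ → volume (B₁ ∩ B₂) = 0 → μ (B₁ ∪ B₂) = μ B₁ + μ B₂) ∧
  (∀ (B : ℕ → Set (E d)) (B' : Set (E d)), (∀ n, IsBVSet (B n)) → IsBVSet B' →
    BVConverges B B' → Tendsto (fun n => μ (B n)) atTop (𝓝 (μ B')))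

/-! ### Strong charge functionals -/

/-- `α = T_g`, that is, `α u = ∫_{[0,1]^d} g u` for all `u ∈ BV([0,1]^d)`. -/
def IsT {d : ℕ} (g : E d → ℝ) (α : BV d →L[ℝ] ℝ) : Prop :=
  ∀ u : BV d, Integrable (fun x => g x * u x) (volume.restrict (cube d)) ∧
    α u = ∫ x in cube d, g x * u x

/-- The functionals `T_g` with `g ∈ L^d([0,1]^d)`, as a subspace of `BV([0,1]^d)^*`. -/
def rangeT (d : ℕ) : Submodule ℝ (BV d →L[ℝ] ℝ) where
  carrier := {α | ∃ g : E d → ℝ, MemLp g d (volume.restrict (cube d)) ∧ IsT g α}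
  zero_mem' := ⟨fun _ => 0, MemLp.zero, fun u => by simp⟩
  add_mem' := by
    rintro α β ⟨g, hg, hα⟩ ⟨h, hh, hβ⟩
    refine ⟨fun x => g x + h x, hg.add hh, fun u => ?_⟩
    simp only [add_mul]
    refine ⟨(hα u).1.add (hβ u).1, ?_⟩
    rw [integral_add (hα u).1 (hβ u).1, ← (hα u).2, ← (hβ u).2]
    rfl
  smul_mem' := by
    rintro c α ⟨g, hg, hα⟩
    refine ⟨fun x => c * g x, hg.const_mul c, fun u => ?_⟩
    simp only [mul_assoc]
    refine ⟨(hα u).1.const_mul c, ?_⟩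
    rw [integral_const_mul, ← (hα u).2]
    rfl

/-- The space `SCH([0,1]^d)` of strong charge functionals: the closure of the range of `T` in
`BV([0,1]^d)^*`, with the operator norm. -/
def SCH (d : ℕ) : Submodule ℝ (BV d →L[ℝ] ℝ) := (rangeT d).topologicalClosure

/-- A strong charge: a charge of the form `B ↦ α(1_B)` for a strong charge functional `α`. -/
def IsStrongCharge {d : ℕ} (μ : Set (E d) → ℝ) : Prop :=
  IsCharge μ ∧ ∃ α ∈ SCH d, ∀ (B : Set (E d)) (hB : IsBVSet B), μ B = α hB.indicatorBV

/-! ### Strong chargeability -/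

/-- `f ∈ C_0([0,1]^d)`; only the values of `f` on `[0,1]^d` matter. -/
def MemC0 {d : ℕ} (f : E d → ℝ) : Prop :=
  ContinuousOn f (cube d) ∧ ∀ x ∈ cube d, (∃ i, x i = 0) → f x = 0

/-- The increment `Δ_f` on the rectangle `∏ i, [a i, b i]`. The sum runs over its vertices: `S` is
the set of the coordinates at which the lower bound is taken. -/
def rectIncrement {d : ℕ} (f : E d → ℝ) (a b : Fin d → ℝ) : ℝ :=
  ∑ S : Finset (Fin d), (-1) ^ S.card * f (WithLp.toLp 2 fun i => if i ∈ S then a i else b i)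

/-- `a` and `b` are the bounds of a rectangle of nonempty interior in `[0,1]^d`. -/
def IsRectBounds {d : ℕ} (a b : Fin d → ℝ) : Prop := ∀ i, 0 ≤ a i ∧ a i < b i ∧ b i ≤ 1

/-- Figures: finite unions of rectangles in `[0,1]^d`. -/
def IsFigure {d : ℕ} (F : Set (E d)) : Prop :=
  ∃ R : Finset ((Fin d → ℝ) × (Fin d → ℝ)),
    (∀ p ∈ R, IsRectBounds p.1 p.2) ∧ F = ⋃ p ∈ R, rect p.1 p.2

/-- The restriction of `Δ` to figures is the increment `Δ_f`, i.e. the (unique) finitely additive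
function of figures given on rectangles by `rectIncrement f`. -/
def IsFigureIncrement {d : ℕ} (f : E d → ℝ) (Δ : Set (E d) → ℝ) : Prop :=
  (∀ a b : Fin d → ℝ, IsRectBounds a b → Δ (rect a b) = rectIncrement f a b) ∧
  (∀ F₁ F₂ : Set (E d), IsFigure F₁ → IsFigure F₂ → volume (F₁ ∩ F₂) = 0 →
    Δ (F₁ ∪ F₂) = Δ F₁ + Δ F₂)

/-- `f` is strongly chargeable: `Δ_f` extends from figures to a strong charge. -/
def StronglyChargeable {d : ℕ} (f : E d → ℝ) : Prop :=
  ∃ μ : Set (E d) → ℝ, IsStrongCharge μ ∧ IsFigureIncrement f μ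

/-! ### Dyadic cubes and the Haar and Faber-Schauder systems -/

/-- Lower bounds of the dyadic cube `∏ i, [2^(-n) m_i, 2^(-n) (m_i + 1)]`. -/
def dyadicLo {d : ℕ} (n : ℕ) (m : Fin d → ℕ) : Fin d → ℝ := fun i => (m i : ℝ) / 2 ^ n

/-- Upper bounds of the dyadic cube `∏ i, [2^(-n) m_i, 2^(-n) (m_i + 1)]`. -/
def dyadicHi {d : ℕ} (n : ℕ) (m : Fin d → ℕ) : Fin d → ℝ := fun i => ((m i : ℝ) + 1) / 2 ^ n

/-- A numbering `K_{n,k}`, `0 ≤ k < 2^(nd)`, of the dyadic cubes of each generation `n`, such that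
the `2^d` subcubes of generation `n+1` of `K_{n,k}` are the cubes `K_{n+1, 2^d k + ℓ}`,
`0 ≤ ℓ < 2^d`. The cube `K_{n,k}` is given by the integer vector `2^n • (its lower corner)`. -/
structure DyadicNumbering (d : ℕ) where
  corner : ℕ → ℕ → Fin d → ℕ
  bijOn : ∀ n, Set.BijOn (corner n) {k | k < 2 ^ (n * d)} {m | ∀ i, m i < 2 ^ n}
  subcube : ∀ n k l, k < 2 ^ (n * d) → l < 2 ^ d →
    ∀ i, corner (n + 1) (2 ^ d * k + l) i / 2 = corner n k i

/-- Such numberings exist: the subcubes of each cube can be numbered by the binary digits of `ℓ`. -/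
theorem DyadicNumbering.nonempty (d : ℕ) : Nonempty (DyadicNumbering d) := by
  let e : Fin (2 ^ d) ≃ (Fin d → Fin 2) := finFunctionFinEquiv.symm
  have hpos : 0 < 2 ^ d := by positivity
  let c : ℕ → ℕ → Fin d → ℕ := fun n => Nat.rec (fun _ _ => 0)
    (fun _ F k i => 2 * F (k / 2 ^ d) i + (e ⟨k % 2 ^ d, Nat.mod_lt _ hpos⟩ i : ℕ)) n
  have hc : ∀ n k i, c (n + 1) k i
      = 2 * c n (k / 2 ^ d) i + (e ⟨k % 2 ^ d, Nat.mod_lt _ hpos⟩ i : ℕ) := fun _ _ _ => rfl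
  have hdiv : ∀ n k i, c (n + 1) k i / 2 = c n (k / 2 ^ d) i := fun n k i => by
    have := (e ⟨k % 2 ^ d, Nat.mod_lt _ hpos⟩ i).isLt
    rw [hc]; omega
  have hP : ∀ n, 2 ^ ((n + 1) * d) = 2 ^ d * 2 ^ (n * d) := fun n => by ring
  refine ⟨⟨c, fun n => ?_, fun n k l _ hl i => ?_⟩⟩
  · induction n with
    | zero =>
      refine ⟨fun k _ i => ?_, fun k hk k' hk' _ => ?_, fun m hm => ⟨0, ?_, ?_⟩⟩
      · show 0 < 2 ^ 0
        norm_num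
      · simp only [zero_mul, pow_zero, Set.mem_ofPred_eq] at hk hk'
        omega
      · simp
      · funext i
        have := hm i
        show 0 = m i
        simp only [pow_zero] at this
        omega
    | succ n ih =>
      refine ⟨fun k hk i => ?_, fun k hk k' hk' h => ?_, fun m hm => ?_⟩
      · have h1 := ih.mapsTo (show k / 2 ^ d < 2 ^ (n * d) by
          rw [Nat.div_lt_iff_lt_mul hpos, mul_comm, ← hP]; exact hk) i
        have := (e ⟨k % 2 ^ d, Nat.mod_lt _ hpos⟩ i).isLt
        rw [hc, pow_succ]; omega
      · have h1 : k / 2 ^ d = k' / 2 ^ d := by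
          refine ih.injOn ?_ ?_ ?_
          · show k / 2 ^ d < 2 ^ (n * d)
            rw [Nat.div_lt_iff_lt_mul hpos, mul_comm, ← hP]; exact hk
          · show k' / 2 ^ d < 2 ^ (n * d)
            rw [Nat.div_lt_iff_lt_mul hpos, mul_comm, ← hP]; exact hk'
          · funext i
            rw [← hdiv, ← hdiv, h]
        have h2 : (⟨k % 2 ^ d, Nat.mod_lt _ hpos⟩ : Fin (2 ^ d))
            = ⟨k' % 2 ^ d, Nat.mod_lt _ hpos⟩ := by
          refine e.injective (funext fun i => Fin.ext ?_)
          have := congrFun h i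
          rw [hc, hc, h1] at this
          omega
        rw [← Nat.div_add_mod k (2 ^ d), ← Nat.div_add_mod k' (2 ^ d), h1, Fin.mk.inj h2]
      · let m' : Fin d → ℕ := fun i => m i / 2
        have hm' : ∀ i, m' i < 2 ^ n := fun i => by
          have := hm i
          rw [pow_succ] at this
          show m i / 2 < 2 ^ n
          omega
        obtain ⟨q, hq, hqm⟩ := ih.surjOn (a := m') hm'
        obtain ⟨l, hl⟩ := e.surjective fun i => ⟨m i % 2, Nat.mod_lt _ (by norm_num)⟩
        have e1 : (2 ^ d * q + l) / 2 ^ d = q := by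
          rw [Nat.mul_add_div hpos, Nat.div_eq_of_lt l.isLt, add_zero]
        have e2 : (⟨(2 ^ d * q + l) % 2 ^ d, Nat.mod_lt _ hpos⟩ : Fin (2 ^ d)) = l := by
          refine Fin.ext ?_
          show (2 ^ d * q + l) % 2 ^ d = l
          rw [Nat.mul_add_mod, Nat.mod_eq_of_lt l.isLt]
        refine ⟨2 ^ d * q + l, ?_, ?_⟩
        · show 2 ^ d * q + l < 2 ^ ((n + 1) * d)
          have hl' := l.isLt
          have : 2 ^ d * (q + 1) ≤ 2 ^ d * 2 ^ (n * d) := Nat.mul_le_mul_left _ hq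
          rw [hP]
          rw [mul_add] at this
          omega
        · funext i
          rw [hc, e1, e2, hl, hqm]
          show 2 * (m i / 2) + m i % 2 = m i
          omega
  · rw [hdiv, Nat.mul_add_div hpos, Nat.div_eq_of_lt hl, add_zero]

namespace DyadicNumbering

variable {d : ℕ} (K : DyadicNumbering d)

/-- The cube `K_{n,k}`. -/
def set (n k : ℕ) : Set (E d) := rect (dyadicLo n (K.corner n k)) (dyadicHi n (K.corner n k))

/-- The increment `Δ_f(K_{n,k})`. -/
def increment (f : E d → ℝ) (n k : ℕ) : ℝ :=
  rectIncrement f (dyadicLo n (K.corner n k)) (dyadicHi n (K.corner n k))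

end DyadicNumbering

/-- The entry `(A_d)_{r,l}`, `0 ≤ r, l < 2^d`, of the matrix with `A_0 = (1)` and
`A_{d+1} = [[A_d, A_d], [A_d, -A_d]]`. -/
def hadamard : ℕ → ℕ → ℕ → ℝ
  | 0, _, _ => 1
  | d + 1, r, l =>
    (if 2 ^ d ≤ r ∧ 2 ^ d ≤ l then -1 else 1) * hadamard d (r % 2 ^ d) (l % 2 ^ d)

/-- The Haar function `g_{n,k,r}`. -/
def haar {d : ℕ} (K : DyadicNumbering d) (n k r : ℕ) (x : E d) : ℝ :=
  (2 : ℝ) ^ ((n * d : ℝ) / 2) * ∑ l ∈ Finset.range (2 ^ d),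
    hadamard d r l * (K.set (n + 1) (2 ^ d * k + l)).indicator (fun _ => (1 : ℝ)) x

/-- The coefficient `λ_{n,k,r}(f)`. -/
def lam {d : ℕ} (K : DyadicNumbering d) (f : E d → ℝ) (n k r : ℕ) : ℝ :=
  (2 : ℝ) ^ ((n * d : ℝ) / 2) * ∑ l ∈ Finset.range (2 ^ d),
    hadamard d r l * K.increment f (n + 1) (2 ^ d * k + l)

/- The lexicographic enumeration of the index set `-1, (n,k,r)`, where `n ≥ 0`, `0 ≤ k < 2^(nd)` and
`1 ≤ r ≤ 2^d - 1`. Rank `0` is the index `-1`. The indices of generation `n` have the ranks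
`2^(nd), …, 2^((n+1)d) - 1`, and the rank of `(n,k,r)` is `2^(nd) + (2^d - 1) k + (r - 1)`. -/

/-- The generation number of the index of rank `j ≥ 1`. -/
def genNo (d j : ℕ) : ℕ := Nat.log (2 ^ d) j

/-- The cube number of the index of rank `j ≥ 1`. -/
def cubeNo (d j : ℕ) : ℕ := (j - 2 ^ (genNo d j * d)) / (2 ^ d - 1)

/-- The type number of the index of rank `j ≥ 1`. -/
def typeNo (d j : ℕ) : ℕ := (j - 2 ^ (genNo d j * d)) % (2 ^ d - 1) + 1

theorem index_of_rank (d n k r : ℕ) (hd : 1 ≤ d) (hk : k < 2 ^ (n * d)) (hr : 1 ≤ r)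
    (hr' : r ≤ 2 ^ d - 1) :
    genNo d (2 ^ (n * d) + (2 ^ d - 1) * k + (r - 1)) = n ∧
    cubeNo d (2 ^ (n * d) + (2 ^ d - 1) * k + (r - 1)) = k ∧
    typeNo d (2 ^ (n * d) + (2 ^ d - 1) * k + (r - 1)) = r := by
  have h2 : 2 ≤ 2 ^ d := by
    calc 2 = 2 ^ 1 := rfl
      _ ≤ 2 ^ d := Nat.pow_le_pow_right (by norm_num) hd
  have hgen : genNo d (2 ^ (n * d) + (2 ^ d - 1) * k + (r - 1)) = n := by
    unfold genNo
    have hP : (2 ^ d) ^ n = 2 ^ (n * d) := by rw [← pow_mul, mul_comm]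
    refine Nat.log_eq_of_pow_le_of_lt_pow ?_ ?_
    · rw [hP]; omega
    · rw [pow_succ, hP]
      generalize 2 ^ (n * d) = P at *
      obtain ⟨m, hm⟩ : ∃ m, 2 ^ d = m + 1 := ⟨2 ^ d - 1, by omega⟩
      rw [hm] at hr' ⊢
      simp only [Nat.add_sub_cancel] at hr' ⊢
      have : m * (k + 1) ≤ m * P := Nat.mul_le_mul_left m hk
      have e1 : m * (k + 1) = m * k + m := by ring
      have e2 : P * (m + 1) = m * P + P := by ring
      omega
  have hsub : 2 ^ (n * d) + (2 ^ d - 1) * k + (r - 1) - 2 ^ (n * d)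
      = (r - 1) + (2 ^ d - 1) * k := by omega
  refine ⟨hgen, ?_, ?_⟩
  · unfold cubeNo
    rw [hgen, hsub, Nat.add_mul_div_left _ _ (by omega), Nat.div_eq_of_lt (by omega), zero_add]
  · unfold typeNo
    rw [hgen, hsub, Nat.add_mul_mod_self_left, Nat.mod_eq_of_lt (by omega)]
    omega

/-- The Haar basis `g_{-1}, g_{0,0,1}, …` as a sequence. -/
def haarSeq {d : ℕ} (K : DyadicNumbering d) : ℕ → E d → ℝ
  | 0 => (cube d).indicator fun _ => 1
  | j + 1 => haar K (genNo d (j + 1)) (cubeNo d (j + 1)) (typeNo d (j + 1))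

/-- The coefficients `λ_{-1}(f) = Δ_f([0,1]^d), λ_{0,0,1}(f), …` as a sequence. -/
def lamSeq {d : ℕ} (K : DyadicNumbering d) (f : E d → ℝ) : ℕ → ℝ
  | 0 => rectIncrement f (fun _ => 0) (fun _ => 1)
  | j + 1 => lam K f (genNo d (j + 1)) (cubeNo d (j + 1)) (typeNo d (j + 1))

/-- The functional `T_g` for a bounded measurable function `g`. -/
def T {d : ℕ} (g : E d → ℝ) (hg : Measurable g) (hb : ∃ C, ∀ x, ‖g x‖ ≤ C) : BV d →L[ℝ] ℝ :=
  LinearMap.mkContinuousOfExistsBound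
    { toFun := fun u => ∫ x in cube d, g x * u x
      map_add' := fun u w => by
        obtain ⟨C, hC⟩ := hb
        have hi : ∀ u : BV d, Integrable (fun x => g x * u x) (volume.restrict (cube d)) :=
          fun u => (u.integrable.restrict).bdd_mul hg.aestronglyMeasurable
            (Eventually.of_forall hC)
        rw [← integral_add (hi u) (hi w)]
        refine integral_congr_ae (ae_restrict_of_ae ?_)
        filter_upwards [BV.coe_add u w] with x hx
        rw [hx, mul_add]
      map_smul' := fun c u => by
        rw [RingHom.id_apply, smul_eq_mul, ← integral_const_mul]
        refine integral_congr_ae (ae_restrict_of_ae ?_)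
        filter_upwards [BV.coe_smul c u] with x hx
        rw [hx, mul_left_comm] }
    (by
      obtain ⟨C, hC⟩ := hb
      refine ⟨C, fun u => ?_⟩
      have h0 : 0 ≤ C := (norm_nonneg _).trans (hC 0)
      calc ‖∫ x in cube d, g x * u x‖ ≤ ∫ x in cube d, C * ‖u x‖ := by
            refine norm_integral_le_of_norm_le (u.integrable.restrict.norm.const_mul C)
              (Eventually.of_forall fun x => ?_)
            rw [norm_mul]
            exact mul_le_mul_of_nonneg_right (hC x) (norm_nonneg _)
        _ ≤ ∫ x, C * ‖u x‖ := setIntegral_le_integral (u.integrable.norm.const_mul C)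
            (Eventually.of_forall fun x => by positivity)
        _ = C * ‖BV.toL1 u‖ := by rw [integral_const_mul, L1.norm_eq_integral_norm]
        _ ≤ C * ‖u‖ := by
            refine mul_le_mul_of_nonneg_left ?_ h0
            rw [BV.norm_def]
            exact le_add_of_nonneg_right ENNReal.toReal_nonneg)

theorem T_mem_SCH {d : ℕ} (g : E d → ℝ) (hg : Measurable g) (hb : ∃ C, ∀ x, ‖g x‖ ≤ C) :
    T g hg hb ∈ SCH d := by
  have : IsFiniteMeasure ((volume : Measure (E d)).restrict (cube d)) :=
    isFiniteMeasure_restrict.2 (volume_cube_lt_top d).ne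
  refine (rangeT d).le_topologicalClosure ⟨g, ?_, fun u => ⟨?_, rfl⟩⟩
  · obtain ⟨C, hC⟩ := hb
    exact MemLp.of_bound hg.aestronglyMeasurable C (Eventually.of_forall hC)
  · obtain ⟨C, hC⟩ := hb
    exact (u.integrable.restrict).bdd_mul hg.aestronglyMeasurable (Eventually.of_forall hC)

theorem measurable_haarSeq {d : ℕ} (K : DyadicNumbering d) (j : ℕ) :
    Measurable (haarSeq K j) := by
  cases j with
  | zero => exact measurable_const.indicator (measurableSet_rect _ _)
  | succ j =>
    refine Measurable.const_mul ?_ _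
    refine Finset.measurable_fun_sum _ fun l _ => ?_
    exact (measurable_const.indicator (measurableSet_rect _ _)).const_mul _

theorem bounded_haarSeq {d : ℕ} (K : DyadicNumbering d) (j : ℕ) :
    ∃ C, ∀ x, ‖haarSeq K j x‖ ≤ C := by
  have hind : ∀ (s : Set (E d)) (x : E d), ‖s.indicator (fun _ => (1 : ℝ)) x‖ ≤ 1 := fun s x =>
    (norm_indicator_le_norm_self _ _).trans (by simp)
  cases j with
  | zero => exact ⟨1, hind _⟩
  | succ j =>
    refine ⟨‖(2 : ℝ) ^ ((genNo d (j + 1) * d : ℝ) / 2)‖ * ∑ l ∈ Finset.range (2 ^ d),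
      ‖hadamard d (typeNo d (j + 1)) l‖, fun x => ?_⟩
    simp only [haarSeq, haar, norm_mul]
    refine mul_le_mul_of_nonneg_left ((norm_sum_le _ _).trans (Finset.sum_le_sum fun l _ => ?_))
      (norm_nonneg _)
    rw [norm_mul]
    exact mul_le_of_le_one_right (norm_nonneg _) (hind _ _)

/-- The Faber-Schauder system `T_{g_{-1}}, T_{g_{0,0,1}}, …` in `SCH([0,1]^d)`, as a sequence. -/
def faberSchauder {d : ℕ} (K : DyadicNumbering d) (j : ℕ) : SCH d :=
  ⟨T (haarSeq K j) (measurable_haarSeq K j) (bounded_haarSeq K j), T_mem_SCH _ _ _⟩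

/-- The series with terms `a 0, a 1, a 2, …` converges in `SCH([0,1]^d)`. -/
def SeriesConverges {d : ℕ} (a : ℕ → SCH d) : Prop :=
  ∃ α : SCH d, Tendsto (fun N => ∑ j ∈ Finset.range N, a j) atTop (𝓝 α)

end StrongCharge

end

/-!
The partial sums of the Faber–Schauder series of `α ∈ SCH` are obtained by composing `α` with the
partial sums of the Haar series on `BV`. The latter are bounded on `BV` uniformly in their order:
at the orders `2^(nd)` they are the averages over the dyadic cells of generation `n`, whose
variation is controlled by the translation moduli `∫ |u(x + z) - u(x)| dx ≤ |z| ‖Du‖` along the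
coordinate axes; in between, they differ from such an average by a function which is constant on the
cells of generation `n + 1` and whose `L¹` norm is `O(2⁻ⁿ ‖u‖)`, so that its variation is `O(‖u‖)`.
Hence the partial sum operators are equicontinuous on the dual of `BV`, and convergence has to be
checked only on a dense set of functionals. The functionals `T_h` with `h` continuous are dense in
`SCH`, by the embedding of `BV` into `L^(d/(d-1))`, and for them it follows from the uniform
continuity of `h`.

Conversely, the partial sum of order `2^(nd)` takes the value `Δ_f(R)` on each rectangle `R` with
vertices in the dyadic grid of generation `n`. The same density shows that a functional in `SCH` is
continuous along `BV`-bounded sequences which converge in `L¹`; approximating an arbitrary rectangle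
by dyadic ones shows that the sum of the series takes the value `Δ_f(R)` on all rectangles.
-/

namespace StrongCharge

open scoped CompactlySupported Convolution

noncomputable section

variable {d : ℕ}

section TranslationModulus

variable {G F : Type*} [AddGroup G] [MeasurableSpace G] [NormedAddCommGroup F] {μ : Measure G}
  {u w : G → F}

/-- The `L¹` modulus of translation `∫ ‖u (x + z) - u x‖`. The variation of a function is estimated
from both sides by its moduli along the coordinate axes. -/
def translationModulus (u : G → F) (z : G) (μ : Measure G := by volume_tac) : ℝ :=
  ∫ x, ‖u (x + z) - u x‖ ∂μ

lemma translationModulus_nonneg (u : G → F) (z : G) : 0 ≤ translationModulus u z μ :=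
  integral_nonneg fun _ => norm_nonneg _

lemma translationModulus_zero_right (u : G → F) : translationModulus u 0 μ = 0 := by
  simp [translationModulus]

variable [MeasurableAdd G] [μ.IsAddRightInvariant]

lemma translationModulus_congr (h : u =ᵐ[μ] w) (z : G) :
    translationModulus u z μ = translationModulus w z μ := by
  have hz : (fun x => u (x + z)) =ᵐ[μ] fun x => w (x + z) :=
    (measurePreserving_add_right μ z).quasiMeasurePreserving.ae_eq_comp h
  refine integral_congr_ae ?_
  filter_upwards [h, hz] with x hx hxz
  rw [hx, hxz]

lemma integrable_comp_add_right_sub (hu : Integrable u μ) (z : G) :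
    Integrable (fun x => u (x + z) - u x) μ := (hu.comp_add_right z).sub hu

lemma translationModulus_le_two_mul (hu : Integrable u μ) (z : G) :
    translationModulus u z μ ≤ 2 * ∫ x, ‖u x‖ ∂μ :=
  calc translationModulus u z μ ≤ ∫ x, (‖u (x + z)‖ + ‖u x‖) ∂μ :=
        integral_mono (integrable_comp_add_right_sub hu z).norm
          ((hu.comp_add_right z).norm.add hu.norm) fun x => norm_sub_le _ _
    _ = 2 * ∫ x, ‖u x‖ ∂μ := by
        rw [integral_add (hu.comp_add_right z).norm hu.norm,
          integral_add_right_eq_self (fun x => ‖u x‖) z, two_mul]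

lemma translationModulus_add_right_le (hu : Integrable u μ) (z z' : G) :
    translationModulus u (z + z') μ ≤ translationModulus u z μ + translationModulus u z' μ := by
  have hz := (integrable_comp_add_right_sub hu z).norm
  have hz' := (integrable_comp_add_right_sub hu z').norm.comp_add_right z
  calc translationModulus u (z + z') μ
      ≤ ∫ x, (‖u (x + z) - u x‖ + ‖u (x + z + z') - u (x + z)‖) ∂μ := by
        refine integral_mono (integrable_comp_add_right_sub hu _).norm (hz.add hz') fun x => ?_
        simp only [← add_assoc, add_comm ‖u (x + z) - u x‖]
        exact norm_sub_le_norm_sub_add_norm_sub _ _ _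
    _ = translationModulus u z μ + translationModulus u z' μ := by
        rw [integral_add hz hz',
          integral_add_right_eq_self (fun x => ‖u (x + z') - u x‖) z]
        rfl

lemma mul_translationModulus_eq (hu : Integrable u μ) (z : G) (N : ℕ) :
    N * translationModulus u z μ
      = ∫ x, ∑ j ∈ Finset.range N, ‖u (x + (j + 1) • z) - u (x + j • z)‖ ∂μ := by
  refine Eq.trans ?_ (integral_finsetSum _ fun j _ =>
    ((hu.comp_add_right ((j + 1) • z)).sub (hu.comp_add_right (j • z))).norm).symm
  simp only [Pi.sub_apply, succ_nsmul, ← add_assoc]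
  rw [Finset.sum_congr rfl fun j _ =>
    integral_add_right_eq_self (fun x => ‖u (x + z) - u x‖) (j • z)]
  simp [translationModulus]

end TranslationModulus

lemma translationModulus_sum_le {G F ι : Type*} [AddCommGroup G] [MeasurableSpace G]
    [NormedAddCommGroup F] [MeasurableAdd G] {μ : Measure G} [μ.IsAddRightInvariant] {u : G → F}
    (hu : Integrable u μ) (s : Finset ι) (z : ι → G) :
    translationModulus u (∑ i ∈ s, z i) μ ≤ ∑ i ∈ s, translationModulus u (z i) μ :=
  Finset.le_sum_of_subadditive (fun z => translationModulus u z μ)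
    (translationModulus_zero_right u).le (translationModulus_add_right_le hu) s z

section BoundedPairing

variable {G : Type*} [TopologicalSpace G] [AddGroup G] [IsTopologicalAddGroup G]
  [MeasurableSpace G] [BorelSpace G] {μ : Measure G} [μ.IsAddRightInvariant] {w φ : G → ℝ}

lemma integral_comp_sub_right_sub_mul (hw : Integrable w μ)
    (hφ : Continuous φ) (hφ1 : ∀ x, |φ x| ≤ 1) (z : G) :
    ∫ x, (φ (x - z) - φ x) * w x ∂μ = ∫ x, φ x * (w (x + z) - w x) ∂μ := by
  have hint : Integrable (fun x => φ x * w x) μ :=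
    hw.bdd_mul hφ.aestronglyMeasurable (Eventually.of_forall hφ1)
  have hint_sub : Integrable (fun x => φ (x - z) * w x) μ :=
    hw.bdd_mul (hφ.comp (continuous_sub_right z)).aestronglyMeasurable
      (Eventually.of_forall fun x => hφ1 (x - z))
  have hint_add : Integrable (fun x => φ x * w (x + z)) μ :=
    (hw.comp_add_right z).bdd_mul hφ.aestronglyMeasurable (Eventually.of_forall hφ1)
  simp only [sub_mul, mul_sub]
  rw [integral_sub hint_sub hint, integral_sub hint_add hint,
    ← integral_add_right_eq_self (fun x => φ (x - z) * w x) z]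
  simp only [add_sub_cancel_right]

lemma abs_integral_comp_sub_right_sub_mul_le (hw : Integrable w μ)
    (hφ : Continuous φ) (hφ1 : ∀ x, |φ x| ≤ 1) (z : G) :
    |∫ x, (φ (x - z) - φ x) * w x ∂μ| ≤ translationModulus w z μ := by
  rw [integral_comp_sub_right_sub_mul hw hφ hφ1, ← Real.norm_eq_abs]
  refine norm_integral_le_of_norm_le (integrable_comp_add_right_sub hw z).norm
    (Eventually.of_forall fun x => ?_)
  rw [norm_mul]
  exact mul_le_of_le_one_left (norm_nonneg _) (hφ1 x)

end BoundedPairing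

lemma abs_integral_lineDeriv_mul_le {V : Type*} [NormedAddCommGroup V] [NormedSpace ℝ V]
    [FiniteDimensional ℝ V] [MeasurableSpace V] [BorelSpace V] {μ : Measure V}
    [μ.IsAddHaarMeasure] {w φ : V → ℝ} {L : NNReal} (hw : Integrable w μ) (hφ : LipschitzWith L φ)
    (hφ1 : ∀ x, |φ x| ≤ 1) (e : V) {C : ℝ}
    (hC : ∃ᶠ t in 𝓝[>] (0 : ℝ), translationModulus w (t • e) μ ≤ C * t) :
    |∫ x, lineDeriv ℝ φ x e * w x ∂μ| ≤ C := by
  have hlim := (hφ.integral_inv_smul_sub_mul_tendsto_integral_lineDeriv_mul hw (-e)).abs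
  simp only [lineDeriv_neg, neg_mul, integral_neg, abs_neg, smul_neg,
    ← sub_eq_add_neg, smul_eq_mul, mul_assoc, integral_const_mul, abs_mul] at hlim
  refine le_of_tendsto_of_frequently hlim
    ((hC.and_eventually self_mem_nhdsWithin).mono fun t ⟨ht, ht0⟩ => ?_)
  rw [abs_inv, abs_of_pos ht0, inv_mul_le_iff₀ ht0, mul_comm t]
  exact (abs_integral_comp_sub_right_sub_mul_le hw hφ.continuous hφ1 _).trans ht

/-- The `i`-th vector of the standard basis of `ℝ^d`. -/
abbrev unitVec (i : Fin d) : E d := EuclideanSpace.single i 1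

lemma lineDeriv_coord {v : E d → E d} {x : E d} (hv : DifferentiableAt ℝ v x) (i : Fin d)
    (e : E d) : lineDeriv ℝ (fun y => v y i) x e = (fderiv ℝ v x e) i :=
  (((EuclideanSpace.proj (𝕜 := ℝ) i).hasFDerivAt.comp x hv.hasFDerivAt).hasLineDerivAt e).lineDeriv

namespace IsTestField

variable {v : E d → E d}

lemma differentiable (hv : IsTestField v) : Differentiable ℝ v := hv.1.differentiable one_ne_zero

lemma abs_coord_le_one (hv : IsTestField v) (i : Fin d) (x : E d) : |v x i| ≤ 1 :=
  (PiLp.norm_apply_le (v x) i).trans (hv.2.2 x)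

lemma exists_lipschitzWith_coord (hv : IsTestField v) (i : Fin d) :
    ∃ L, LipschitzWith L fun x => v x i :=
  ((contDiff_euclidean.1 hv.1) i).lipschitzWith_of_hasCompactSupport
    (hv.2.1.comp_left (g := fun y : E d => y i) rfl) one_ne_zero

lemma divergence_eq_sum_lineDeriv (hv : IsTestField v) (x : E d) :
    divergence v x = ∑ i, lineDeriv ℝ (fun y => v y i) x (unitVec i) :=
  Finset.sum_congr rfl fun i _ => (lineDeriv_coord (hv.differentiable x) i _).symm

end IsTestField

lemma variation_le_of_translationModulus_le {w : E d → ℝ} (hw : Integrable w) {C : Fin d → ℝ}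
    (hC : ∀ i, ∃ᶠ t in 𝓝[>] (0 : ℝ), translationModulus w (t • unitVec i) ≤ C i * t) :
    variation w ≤ ENNReal.ofReal (∑ i, C i) := by
  refine iSup₂_le fun v hv => ENNReal.ofReal_le_ofReal ?_
  choose L hL using hv.exists_lipschitzWith_coord
  have hint : ∀ i, Integrable fun x => lineDeriv ℝ (fun y => v y i) x (unitVec i) * w x := fun i =>
    hw.bdd_mul (aestronglyMeasurable_lineDeriv (hL i).continuous _)
      (Eventually.of_forall fun x => norm_lineDeriv_le_of_lipschitz ℝ (hL i))
  simp only [mul_comm (w _), hv.divergence_eq_sum_lineDeriv, Finset.sum_mul]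
  rw [integral_finsetSum _ fun i _ => hint i]
  exact Finset.sum_le_sum fun i _ => (le_abs_self _).trans
    (abs_integral_lineDeriv_mul_le hw (hL i) (hv.abs_coord_le_one i) _ (hC i))

lemma fderiv_neg_apply_of_even {V : Type*} [NormedAddCommGroup V] [NormedSpace ℝ V] {ρ : V → ℝ}
    (hρ : Differentiable ℝ ρ) (heven : ∀ x, ρ (-x) = ρ x) (x e : V) :
    fderiv ℝ ρ (-x) e = -fderiv ℝ ρ x e := by
  have hderiv := (hρ (-x)).hasFDerivAt.comp x (hasFDerivAt_id x).neg
  rw [show ρ ∘ Neg.neg = ρ from funext heven] at hderiv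
  simp [hderiv.fderiv]

section Mollification

open ContinuousLinearMap (lsmul lsmul_apply)

variable {V : Type*} [NormedAddCommGroup V] [MeasurableSpace V] [BorelSpace V] {μ : Measure V}

lemma exists_integrable_mul_eq_neg_abs [IsFiniteMeasureOnCompacts μ] {D : V → ℝ}
    (hD : Continuous D) (hDc : HasCompactSupport D) :
    ∃ s : V → ℝ, Integrable s μ ∧ HasCompactSupport s ∧ (∀ x, |s x| ≤ 1) ∧
      ∀ x, s x * D x = -|D x| := by
  have hs1 : ∀ x, |-(D x / |D x|)| ≤ 1 := fun x => by
    rw [abs_neg, abs_div, abs_abs]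
    exact div_self_le_one _
  have hsc : HasCompactSupport fun x => -(D x / |D x|) :=
    hDc.comp_left (g := fun y : ℝ => -(y / |y|)) (by simp)
  have hsm : Measurable fun x => -(D x / |D x|) :=
    (hD.measurable.div hD.abs.measurable).neg
  refine ⟨fun x => -(D x / |D x|), ?_, hsc, hs1, fun x => ?_⟩
  · exact (integrableOn_iff_integrable_of_support_subset (subset_tsupport _)).1
      (IntegrableOn.of_bound hsc.isCompact.measure_lt_top hsm.aestronglyMeasurable 1
        (Eventually.of_forall hs1))
  · rw [neg_mul, div_mul_eq_mul_div, ← abs_mul_abs_self (D x), mul_self_div_self]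

variable [NormedSpace ℝ V] [FiniteDimensional ℝ V] [μ.IsAddHaarMeasure]

lemma abs_convolution_le_one {s ρ : V → ℝ} (hs : ∀ x, |s x| ≤ 1)
    (hρ : Integrable ρ μ) (hρ0 : ∀ x, 0 ≤ ρ x) (hρ1 : ∫ x, ρ x ∂μ = 1) (y : V) :
    |(s ⋆[lsmul ℝ ℝ, μ] ρ) y| ≤ 1 := by
  rw [convolution_def, ← Real.norm_eq_abs, ← hρ1, ← integral_sub_left_eq_self ρ μ y]
  refine norm_integral_le_of_norm_le (hρ.comp_sub_left y) (Eventually.of_forall fun x => ?_)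
  rw [lsmul_apply, norm_smul, Real.norm_of_nonneg (hρ0 _)]
  exact mul_le_of_le_one_left (hρ0 _) (hs x)

lemma fderiv_convolution_lsmul_apply {f ρ : V → ℝ} (hf : LocallyIntegrable f μ)
    (hρ : ContDiff ℝ 1 ρ) (hρc : HasCompactSupport ρ) (x e : V) :
    fderiv ℝ (f ⋆[lsmul ℝ ℝ, μ] ρ) x e = ∫ y, f y * fderiv ℝ ρ (x - y) e ∂μ := by
  have hderiv := hρc.hasFDerivAt_convolution_right (lsmul ℝ ℝ) hf hρ x
  rw [hderiv.fderiv, convolution_precompR_apply (lsmul ℝ ℝ) hf (hρc.fderiv (𝕜 := ℝ))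
    (hρ.continuous_fderiv one_ne_zero)]
  rfl

lemma integral_mul_fderiv_convolution {u s ρ : V → ℝ} (hu : Integrable u μ) (hs : Integrable s μ)
    (hρ : ContDiff ℝ 1 ρ) (hρc : HasCompactSupport ρ) (heven : ∀ x, ρ (-x) = ρ x) (e : V) :
    ∫ x, s x * fderiv ℝ (u ⋆[lsmul ℝ ℝ, μ] ρ) x e ∂μ =
      -∫ y, u y * fderiv ℝ (s ⋆[lsmul ℝ ℝ, μ] ρ) y e ∂μ := by
  have hρd : Continuous fun x => fderiv ℝ ρ x e :=
    (hρ.continuous_fderiv one_ne_zero).clm_apply continuous_const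
  obtain ⟨B, hB⟩ := hρd.bounded_above_of_compact_support (hρc.fderiv_apply ℝ e)
  have hint : Integrable (fun p : V × V => s p.1 * u p.2 * fderiv ℝ ρ (p.1 - p.2) e)
      (μ.prod μ) :=
    (hs.mul_prod hu).mul_bdd (c := B)
      (hρd.comp (continuous_fst.sub continuous_snd)).aestronglyMeasurable
      (Eventually.of_forall fun p => hB _)
  calc ∫ x, s x * fderiv ℝ (u ⋆[lsmul ℝ ℝ, μ] ρ) x e ∂μ
      = ∫ x, ∫ y, s x * u y * fderiv ℝ ρ (x - y) e ∂μ ∂μ := by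
        simp only [mul_assoc, integral_const_mul,
          fderiv_convolution_lsmul_apply hu.locallyIntegrable hρ hρc]
    _ = ∫ y, ∫ x, s x * u y * fderiv ℝ ρ (x - y) e ∂μ ∂μ := integral_integral_swap hint
    _ = ∫ y, -(u y * ∫ x, s x * fderiv ℝ ρ (y - x) e ∂μ) ∂μ := by
        congr! 2 with y
        rw [← integral_const_mul, ← integral_neg]
        refine integral_congr_ae (Eventually.of_forall fun x => ?_)
        simp only
        rw [← neg_sub y x, fderiv_neg_apply_of_even (hρ.differentiable one_ne_zero) heven]
        ring
    _ = -∫ y, u y * fderiv ℝ (s ⋆[lsmul ℝ ℝ, μ] ρ) y e ∂μ := by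
        simp only [integral_neg, fderiv_convolution_lsmul_apply hs.locallyIntegrable hρ hρc]

lemma integral_mul_fderiv_le_variation {u g : E d → ℝ} (hu : variation u < ∞)
    (hg : ContDiff ℝ 1 g) (hgc : HasCompactSupport g) (hg1 : ∀ x, |g x| ≤ 1) (i : Fin d) :
    ∫ x, u x * fderiv ℝ g x (unitVec i) ≤ (variation u).toReal := by
  let v : E d → E d := fun x => g x • unitVec i
  have hv : IsTestField v := by
    refine ⟨hg.smul contDiff_const, hgc.smul_right, fun x => ?_⟩
    simpa [v, norm_smul] using hg1 x
  have hdiv : ∀ x, divergence v x = fderiv ℝ g x (unitVec i) := fun x => by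
    have hderiv : HasFDerivAt v ((fderiv ℝ g x).smulRight (unitVec i)) x :=
      (hg.differentiable one_ne_zero x).hasFDerivAt.smul_const _
    simp [divergence, hderiv.fderiv]
  have hle := le_iSup₂ (f := fun (v : E d → E d) (_ : IsTestField v) =>
    ENNReal.ofReal (∫ x, u x * divergence v x)) v hv
  simp only [hdiv] at hle
  exact (ENNReal.ofReal_le_iff_le_toReal hu.ne).1 hle

lemma eLpNorm_fderiv_convolution_le_variation {u ρ : E d → ℝ} (hu : Integrable u)
    (huc : HasCompactSupport u) (hρ : ContDiff ℝ 1 ρ) (hρc : HasCompactSupport ρ)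
    (hρ0 : ∀ x, 0 ≤ ρ x) (heven : ∀ x, ρ (-x) = ρ x) (hρ1 : ∫ x, ρ x = 1) (i : Fin d) :
    eLpNorm (fun x => fderiv ℝ (u ⋆[lsmul ℝ ℝ, volume] ρ) x (unitVec i)) 1 ≤ variation u := by
  rcases eq_top_or_lt_top (variation u) with hv | hv
  · simp [hv]
  have hsmooth : ContDiff ℝ 1 (u ⋆[lsmul ℝ ℝ, volume] ρ) :=
    hρc.contDiff_convolution_right _ hu.locallyIntegrable hρ
  have hDcont := (hsmooth.continuous_fderiv one_ne_zero).clm_apply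
    (continuous_const (y := unitVec i))
  have hDc := (huc.convolution (lsmul ℝ ℝ) hρc (μ := volume)).fderiv_apply ℝ (unitVec i)
  obtain ⟨s, hsi, hsc, hs1, hsD⟩ := exists_integrable_mul_eq_neg_abs (μ := volume) hDcont hDc
  have habs := integral_mul_fderiv_convolution hu hsi hρ hρc heven (unitVec i)
  simp only [hsD, integral_neg, neg_inj] at habs
  rw [eLpNorm_one_eq_lintegral_enorm,
    ← ofReal_integral_norm_eq_lintegral_enorm (hDcont.integrable_of_hasCompactSupport hDc)]
  simp only [Real.norm_eq_abs, habs]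
  rw [ENNReal.ofReal_le_iff_le_toReal hv.ne]
  exact integral_mul_fderiv_le_variation hv
    (hρc.contDiff_convolution_right _ hsi.locallyIntegrable hρ) (hsc.convolution _ hρc)
    (abs_convolution_le_one hs1 (hρ.continuous.integrable_of_hasCompactSupport hρc) hρ0 hρ1) i

lemma exists_contDiff_ae_tendsto_eLpNorm_fderiv_le {u : E d → ℝ} (hu : Integrable u)
    (huc : HasCompactSupport u) :
    ∃ U : ℕ → E d → ℝ, (∀ n, ContDiff ℝ 1 (U n)) ∧ (∀ n, HasCompactSupport (U n)) ∧
      (∀ n i, eLpNorm (fun x => fderiv ℝ (U n) x (unitVec i)) 1 ≤ variation u) ∧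
      ∀ᵐ x, Tendsto (fun n => U n x) atTop (𝓝 (u x)) := by
  have hpos : ∀ n : ℕ, 0 < 1 / ((n : ℝ) + 1) := fun n => by positivity
  let φ : ℕ → ContDiffBump (0 : E d) := fun n =>
    ⟨1 / ((n : ℝ) + 1), 2 * (1 / ((n : ℝ) + 1)), hpos n, lt_two_mul_self (hpos n)⟩
  have hφout : Tendsto (fun n => (φ n).rOut) atTop (𝓝 0) := by
    simpa [φ] using (tendsto_one_div_add_atTop_nhds_zero_nat (𝕜 := ℝ)).const_mul 2
  have hφ : ∀ n, ContDiff ℝ 1 ((φ n).normed volume) := fun n => (φ n).contDiff_normed (n := 1)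
  have hφc : ∀ n, HasCompactSupport ((φ n).normed volume) := fun n =>
    (φ n).hasCompactSupport_normed
  refine ⟨fun n => u ⋆[lsmul ℝ ℝ, volume] (φ n).normed volume,
    fun n => (hφc n).contDiff_convolution_right _ hu.locallyIntegrable (hφ n),
    fun n => huc.convolution _ (hφc n),
    fun n => eLpNorm_fderiv_convolution_le_variation hu huc (hφ n) (hφc n) (φ n).nonneg_normed
      (φ n).normed_neg (φ n).integral_normed, ?_⟩
  filter_upwards [ContDiffBump.ae_convolution_tendsto_right_of_locallyIntegrable (K := 2) hφout
    (Eventually.of_forall fun _ => le_rfl) hu.locallyIntegrable] with x hx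
  refine hx.congr fun n => ?_
  rw [convolution_eq_swap]
  simp only [convolution_def, lsmul_apply, smul_eq_mul, mul_comm]

end Mollification

lemma ofReal_translationModulus {G F : Type*} [AddGroup G] [MeasurableSpace G] [MeasurableAdd G]
    [NormedAddCommGroup F] {μ : Measure G} [μ.IsAddRightInvariant] {u : G → F}
    (hu : Integrable u μ) (z : G) :
    ENNReal.ofReal (translationModulus u z μ) = eLpNorm (fun x => u (x + z) - u x) 1 μ := by
  rw [eLpNorm_one_eq_lintegral_enorm, translationModulus,
    ofReal_integral_norm_eq_lintegral_enorm (integrable_comp_add_right_sub hu z)]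

lemma enorm_sub_le_lintegral_fderiv {V F : Type*} [NormedAddCommGroup V] [NormedSpace ℝ V]
    [NormedAddCommGroup F] [NormedSpace ℝ F] [CompleteSpace F] {U : V → F} (hU : ContDiff ℝ 1 U)
    (x z : V) : ‖U (x + z) - U x‖ₑ ≤ ∫⁻ s in Set.Ioc (0 : ℝ) 1, ‖fderiv ℝ U (x + s • z) z‖ₑ := by
  have hderiv : ∀ s : ℝ, HasDerivAt (fun s : ℝ => U (x + s • z)) (fderiv ℝ U (x + s • z) z) s :=
    fun s => (hU.differentiable one_ne_zero _).hasFDerivAt.comp_hasDerivAt s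
      (by simpa using ((hasDerivAt_id s).smul_const z).const_add x)
  have hcont : Continuous fun s : ℝ => fderiv ℝ U (x + s • z) z :=
    ((hU.continuous_fderiv one_ne_zero).comp (by fun_prop)).clm_apply continuous_const
  have hftc := intervalIntegral.integral_eq_sub_of_hasDerivAt (a := 0) (b := 1)
    (fun s _ => hderiv s) (hcont.intervalIntegrable _ _)
  simp only [one_smul, zero_smul, add_zero] at hftc
  rw [← hftc, intervalIntegral.integral_of_le zero_le_one]
  exact enorm_integral_le_lintegral_enorm _

lemma eLpNorm_translate_sub_le {V F : Type*} [NormedAddCommGroup V] [NormedSpace ℝ V]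
    [FiniteDimensional ℝ V] [MeasurableSpace V] [BorelSpace V] [NormedAddCommGroup F]
    [NormedSpace ℝ F] [CompleteSpace F] {μ : Measure V} [μ.IsAddHaarMeasure] {U : V → F}
    (hU : ContDiff ℝ 1 U) (z : V) :
    eLpNorm (fun x => U (x + z) - U x) 1 μ ≤ eLpNorm (fun x => fderiv ℝ U x z) 1 μ := by
  have := hU.continuous_fderiv one_ne_zero
  simp only [eLpNorm_one_eq_lintegral_enorm]
  calc ∫⁻ x, ‖U (x + z) - U x‖ₑ ∂μ
      ≤ ∫⁻ x, (∫⁻ s in Set.Ioc (0 : ℝ) 1, ‖fderiv ℝ U (x + s • z) z‖ₑ) ∂μ :=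
        lintegral_mono fun x => enorm_sub_le_lintegral_fderiv hU x z
    _ = ∫⁻ s in Set.Ioc (0 : ℝ) 1, ∫⁻ x, ‖fderiv ℝ U (x + s • z) z‖ₑ ∂μ := by
        refine lintegral_lintegral_swap (Continuous.aemeasurable ?_)
        simp only [Function.uncurry_def]
        fun_prop
    _ = ∫⁻ _ in Set.Ioc (0 : ℝ) 1, ∫⁻ x, ‖fderiv ℝ U x z‖ₑ ∂μ :=
        lintegral_congr fun s => lintegral_add_right_eq_self (fun x => ‖fderiv ℝ U x z‖ₑ) _
    _ = ∫⁻ x, ‖fderiv ℝ U x z‖ₑ ∂μ := by simp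

lemma translationModulus_smul_unitVec_le {u : E d → ℝ} (hu : Integrable u)
    (huc : HasCompactSupport u) (hv : variation u < ∞) (i : Fin d) (t : ℝ) :
    translationModulus u (t • unitVec i) ≤ |t| * (variation u).toReal := by
  obtain ⟨U, hU, -, hUvar, hlim⟩ := exists_contDiff_ae_tendsto_eLpNorm_fderiv_le hu huc
  have htranslate : ∀ n, eLpNorm (fun x => U n (x + t • unitVec i) - U n x) 1 volume ≤
      ‖t‖ₑ * variation u := fun n => by
    refine (eLpNorm_translate_sub_le (hU n) _).trans ?_
    simp only [map_smul]
    refine (eLpNorm_const_smul_le (c := t) (f := fun x => fderiv ℝ (U n) x (unitVec i))).trans ?_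
    gcongr
    exact hUvar n i
  have hlim_sub : ∀ᵐ x, Tendsto (fun n => U n (x + t • unitVec i) - U n x) atTop
      (𝓝 (u (x + t • unitVec i) - u x)) := by
    filter_upwards [hlim, (measurePreserving_add_right volume
      (t • unitVec i : E d)).quasiMeasurePreserving.ae hlim] with x hx hxt using hxt.sub hx
  have hmeas : ∀ n, AEStronglyMeasurable (fun x => U n (x + t • unitVec i) - U n x) volume :=
    fun n => (((hU n).continuous.comp (continuous_add_const _)).sub
      (hU n).continuous).aestronglyMeasurable
  rw [← ENNReal.ofReal_le_ofReal_iff (by positivity), ofReal_translationModulus hu,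
    ENNReal.ofReal_mul (abs_nonneg t), ENNReal.ofReal_toReal hv.ne, ← Real.enorm_eq_ofReal_abs]
  exact (Lp.eLpNorm_lim_le_liminf_eLpNorm hmeas _ hlim_sub).trans
    (liminf_le_of_frequently_le' (Eventually.of_forall htranslate).frequently)

lemma norm_le_sum_norm_unitVec {F : Type*} [NormedAddCommGroup F] [NormedSpace ℝ F]
    (L : E d →L[ℝ] F) : ‖L‖ ≤ ∑ i, ‖L (unitVec i)‖ := by
  refine L.opNorm_le_bound (by positivity) fun v => ?_
  have hv : v = ∑ i, v i • unitVec i := by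
    ext j
    simp [Pi.single_apply]
  calc ‖L v‖ = ‖∑ i, v i • L (unitVec i)‖ := by rw [hv, map_sum]; simp only [map_smul, ← hv]
    _ ≤ ∑ i, ‖v i‖ * ‖L (unitVec i)‖ := norm_sum_le_of_le _ fun i _ => (norm_smul _ _).le
    _ ≤ ∑ i, ‖v‖ * ‖L (unitVec i)‖ := by gcongr with i; exact PiLp.norm_apply_le v i
    _ = (∑ i, ‖L (unitVec i)‖) * ‖v‖ := by rw [← Finset.mul_sum, mul_comm]

lemma measurePreserving_line (x : E 1) :
    MeasurePreserving (fun s : ℝ => x + s • unitVec 0) volume volume := by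
  have hfun := (volume_preserving_funUnique (Fin 1) ℝ).symm
  have htoLp := PiLp.volume_preserving_toLp (Fin 1)
  convert (measurePreserving_add_left volume x).comp (htoLp.comp hfun) using 1
  funext s
  ext j
  fin_cases j
  simp [MeasurableEquiv.funUnique]

lemma eLpNorm_top_le_of_dim_one {U : E 1 → ℝ} (hU : ContDiff ℝ 1 U) (hUc : HasCompactSupport U) :
    eLpNorm U ∞ volume ≤ eLpNorm (fderiv ℝ U) 1 volume := by
  rw [eLpNorm_exponent_top]
  refine eLpNormEssSup_le_of_ae_enorm_bound (Eventually.of_forall fun x => ?_)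
  have hline : ∀ s : ℝ, HasDerivAt (fun s : ℝ => x + s • (unitVec 0 : E 1)) (unitVec 0) s :=
    fun s => by simpa using ((hasDerivAt_id s).smul_const (unitVec 0 : E 1)).const_add x
  have hisometry : Isometry fun s : ℝ => x + s • (unitVec 0 : E 1) :=
    Isometry.of_dist_eq fun s t => by
      rw [dist_add_left, dist_eq_norm, ← sub_smul, norm_smul]
      simp [dist_eq_norm]
  have hderiv : ∀ s, ‖deriv (fun s : ℝ => U (x + s • unitVec 0)) s‖ₑ ≤
      ‖fderiv ℝ U (x + s • unitVec 0)‖ₑ := fun s => by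
    have hcomp : HasDerivAt (fun s : ℝ => U (x + s • unitVec 0))
        (fderiv ℝ U (x + s • unitVec 0) (unitVec 0)) s :=
      (hU.differentiable one_ne_zero _).hasFDerivAt.comp_hasDerivAt s (hline s)
    rw [hcomp.deriv, enorm_le_iff_norm_le]
    exact (ContinuousLinearMap.le_opNorm _ _).trans (by simp)
  calc ‖U x‖ₑ = ‖U (x + (0 : ℝ) • unitVec 0)‖ₑ := by simp
    _ ≤ ∫⁻ s in Set.Iic 0, ‖deriv (fun s : ℝ => U (x + s • unitVec 0)) s‖ₑ :=
        (hUc.comp_isClosedEmbedding hisometry.isClosedEmbedding).enorm_le_lintegral_Ici_deriv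
          (hU.comp (by fun_prop)) 0
    _ ≤ ∫⁻ s, ‖fderiv ℝ U (x + s • unitVec 0)‖ₑ :=
        (setLIntegral_le_lintegral _ _).trans (lintegral_mono hderiv)
    _ = eLpNorm (fderiv ℝ U) 1 volume := by
        rw [eLpNorm_one_eq_lintegral_enorm]
        exact (measurePreserving_line x).lintegral_comp (f := fun y => ‖fderiv ℝ U y‖ₑ)
          (hU.continuous_fderiv one_ne_zero).enorm.measurable

/- `ℝ^d` has Sobolev exponent `d / (d - 1)`; Mathlib's inequality needs `1 < d`, and the limiting
exponent `∞` in dimension one comes from the fundamental theorem of calculus. -/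
lemma exists_eLpNorm_le_eLpNorm_fderiv (hd : 1 ≤ d) :
    ∃ (p : ℝ≥0∞) (C : NNReal), ENNReal.HolderTriple d p 1 ∧ ∀ U : E d → ℝ, ContDiff ℝ 1 U →
      HasCompactSupport U → eLpNorm U p volume ≤ C * eLpNorm (fderiv ℝ U) 1 volume := by
  rcases hd.eq_or_lt with rfl | hd
  · refine ⟨∞, 1, ?_, fun U hU hUc => by simpa using eLpNorm_top_le_of_dim_one hU hUc⟩
    rw [Nat.cast_one]
    infer_instance
  · have hconj := NNReal.HolderConjugate.conjExponent (p := (d : NNReal)) (by exact_mod_cast hd)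
    refine ⟨(NNReal.conjExponent d : NNReal), _, ?_, fun U hU hUc =>
      eLpNorm_le_eLpNorm_fderiv_one volume hU hUc (by simpa using hconj)⟩
    simpa using hconj.coe_ennreal

lemma eLpNorm_fderiv_le_sum {U : E d → ℝ} (hU : ContDiff ℝ 1 U) :
    eLpNorm (fderiv ℝ U) 1 volume ≤
      ∑ i, eLpNorm (fun x => fderiv ℝ U x (unitVec i)) 1 volume := by
  have hcont := hU.continuous_fderiv one_ne_zero
  calc eLpNorm (fderiv ℝ U) 1 volume
      ≤ eLpNorm (fun x => ∑ i, ‖fderiv ℝ U x (unitVec i)‖) 1 volume :=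
        eLpNorm_mono_real fun x => norm_le_sum_norm_unitVec _
    _ = eLpNorm (∑ i, fun x => ‖fderiv ℝ U x (unitVec i)‖) 1 volume := by
        simp only [Finset.sum_fn]
    _ ≤ ∑ i, eLpNorm (fun x => ‖fderiv ℝ U x (unitVec i)‖) 1 volume :=
        eLpNorm_sum_le (fun i _ =>
          (hcont.clm_apply continuous_const).norm.aestronglyMeasurable) le_rfl
    _ = ∑ i, eLpNorm (fun x => fderiv ℝ U x (unitVec i)) 1 volume := by simp only [eLpNorm_norm]

lemma exists_eLpNorm_le_variation (hd : 1 ≤ d) :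
    ∃ (p : ℝ≥0∞) (C : NNReal), ENNReal.HolderTriple d p 1 ∧ ∀ u : E d → ℝ, Integrable u →
      HasCompactSupport u → eLpNorm u p volume ≤ C * variation u := by
  obtain ⟨p, C, hp, hsobolev⟩ := exists_eLpNorm_le_eLpNorm_fderiv hd
  refine ⟨p, C * d, hp, fun u hu huc => ?_⟩
  obtain ⟨U, hU, hUc, hUvar, hlim⟩ := exists_contDiff_ae_tendsto_eLpNorm_fderiv_le hu huc
  refine (Lp.eLpNorm_lim_le_liminf_eLpNorm (f := U)
    (fun n => (hU n).continuous.aestronglyMeasurable) _ hlim).trans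
    (liminf_le_of_frequently_le' (Eventually.of_forall fun n => ?_).frequently)
  calc eLpNorm (U n) p volume
      ≤ C * eLpNorm (fderiv ℝ (U n)) 1 volume := hsobolev _ (hU n) (hUc n)
    _ ≤ C * ∑ _i : Fin d, variation u := by
        gcongr
        exact (eLpNorm_fderiv_le_sum (hU n)).trans (Finset.sum_le_sum fun i _ => hUvar n i)
    _ = (C * d : NNReal) * variation u := by simp [mul_assoc]

/-! ### Haar coefficients -/

lemma hadamard_succ_of_lt {r : ℕ} (hr : r < 2 ^ d) (l : ℕ) :
    hadamard (d + 1) r l = hadamard d r (l % 2 ^ d) := by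
  rw [hadamard, if_neg (by omega), Nat.mod_eq_of_lt hr, one_mul]

lemma hadamard_succ_two_pow_add {r : ℕ} (hr : r < 2 ^ d) (l : ℕ) :
    hadamard (d + 1) (2 ^ d + r) l = (if 2 ^ d ≤ l then -1 else 1) * hadamard d r (l % 2 ^ d) := by
  simp [hadamard, Nat.mod_eq_of_lt hr]

lemma hadamard_comm (d r l : ℕ) : hadamard d r l = hadamard d l r := by
  induction d generalizing r l with
  | zero => rfl
  | succ d ih => rw [hadamard, hadamard, ih]; simp only [and_comm]

lemma hadamard_zero_left (d l : ℕ) : hadamard d 0 l = 1 := by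
  induction d generalizing l with
  | zero => rfl
  | succ d ih => rw [hadamard_succ_of_lt (by positivity), ih]

lemma abs_hadamard (d r l : ℕ) : |hadamard d r l| = 1 := by
  induction d generalizing r l with
  | zero => simp [hadamard]
  | succ d ih =>
    rw [hadamard, abs_mul, ih, mul_one]
    split_ifs <;> simp

lemma sum_hadamard_succ_mul (d l l' : ℕ) :
    ∑ r ∈ Finset.range (2 ^ (d + 1)), hadamard (d + 1) r l * hadamard (d + 1) r l'
      = (1 + (if 2 ^ d ≤ l then -1 else 1) * (if 2 ^ d ≤ l' then -1 else 1)) *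
        ∑ r ∈ Finset.range (2 ^ d), hadamard d r (l % 2 ^ d) * hadamard d r (l' % 2 ^ d) := by
  rw [pow_succ, mul_two, Finset.sum_range_add, add_mul, one_mul, Finset.mul_sum]
  congr 1 <;> refine Finset.sum_congr rfl fun r hr => ?_
  · rw [hadamard_succ_of_lt (Finset.mem_range.1 hr), hadamard_succ_of_lt (Finset.mem_range.1 hr)]
  · rw [hadamard_succ_two_pow_add (Finset.mem_range.1 hr),
      hadamard_succ_two_pow_add (Finset.mem_range.1 hr)]
    ring

theorem sum_hadamard_mul (d : ℕ) {l l' : ℕ} (hl : l < 2 ^ d) (hl' : l' < 2 ^ d) :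
    ∑ r ∈ Finset.range (2 ^ d), hadamard d r l * hadamard d r l'
      = if l = l' then (2 : ℝ) ^ d else 0 := by
  induction d generalizing l l' with
  | zero =>
    obtain rfl : l = 0 := by simpa using hl
    obtain rfl : l' = 0 := by simpa using hl'
    simp [hadamard]
  | succ d ih =>
    have mod_eq : ∀ m < 2 ^ (d + 1), m % 2 ^ d = if 2 ^ d ≤ m then m - 2 ^ d else m := by
      intro m hm
      split_ifs with h
      · rw [Nat.mod_eq_sub_mod h, Nat.mod_eq_of_lt (by omega)]
      · exact Nat.mod_eq_of_lt (by omega)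
    have eq_iff : l = l' ↔ (2 ^ d ≤ l ↔ 2 ^ d ≤ l') ∧ l % 2 ^ d = l' % 2 ^ d := by
      rw [mod_eq l hl, mod_eq l' hl']
      split_ifs <;> omega
    rw [sum_hadamard_succ_mul, ih (Nat.mod_lt l (by positivity)) (Nat.mod_lt l' (by positivity))]
    by_cases h : 2 ^ d ≤ l <;> by_cases h' : 2 ^ d ≤ l' <;>
      simp only [eq_iff, h, h', if_true, if_false, iff_true, iff_false, true_and, false_and,
        not_true, pow_succ] <;> split_ifs <;> ring

lemma sum_hadamard_eq_zero {r : ℕ} (hr : r < 2 ^ d) (hr0 : r ≠ 0) :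
    ∑ l ∈ Finset.range (2 ^ d), hadamard d r l = 0 := by
  have orthogonal := sum_hadamard_mul d hr (l' := 0) (by positivity)
  simpa only [hadamard_comm d _ r, hadamard_comm d _ 0, hadamard_zero_left, mul_one, if_neg hr0]
    using orthogonal

lemma two_pow_genNo_mul_le {j : ℕ} (hj : j ≠ 0) : 2 ^ (genNo d j * d) ≤ j := by
  rw [mul_comm, pow_mul]
  exact Nat.pow_log_le_self _ hj

lemma lt_two_pow_genNo_succ_mul (hd : 1 ≤ d) (j : ℕ) : j < 2 ^ ((genNo d j + 1) * d) := by
  rw [mul_comm, pow_mul]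
  exact Nat.lt_pow_succ_log_self (Nat.one_lt_two_pow (by omega)) j

lemma genNo_eq {n j : ℕ} (hnj : 2 ^ (n * d) ≤ j) (hjn : j < 2 ^ ((n + 1) * d)) :
    genNo d j = n := by
  rw [mul_comm, pow_mul] at hnj hjn
  exact Nat.log_eq_of_pow_le_of_lt_pow hnj hjn

lemma two_pow_succ_mul (d n : ℕ) :
    2 ^ ((n + 1) * d) = 2 ^ (n * d) + (2 ^ d - 1) * 2 ^ (n * d) := by
  rw [Nat.sub_mul, one_mul, Nat.add_sub_cancel' (Nat.le_mul_of_pos_left _ (by positivity)),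
    ← pow_add, add_one_mul, add_comm]

lemma cubeNo_lt (hd : 1 ≤ d) {j : ℕ} (hj : j ≠ 0) : cubeNo d j < 2 ^ (genNo d j * d) := by
  have := lt_two_pow_genNo_succ_mul hd j
  rw [two_pow_succ_mul] at this
  exact Nat.div_lt_of_lt_mul (by have := two_pow_genNo_mul_le (d := d) hj; omega)

lemma child_lt {n k l : ℕ} (hk : k < 2 ^ (n * d)) (hl : l < 2 ^ d) :
    2 ^ d * k + l < 2 ^ ((n + 1) * d) := by
  calc 2 ^ d * k + l < 2 ^ d * (k + 1) := by rw [mul_add_one]; omega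
    _ ≤ 2 ^ d * 2 ^ (n * d) := Nat.mul_le_mul_left _ hk
    _ = 2 ^ ((n + 1) * d) := by ring

section HaarCoef

variable {M M' : Type*} [AddCommGroup M] [Module ℝ M] [AddCommGroup M'] [Module ℝ M']

lemma sum_hadamard_smul_sum_hadamard_smul (d : ℕ) (a : ℕ → ℝ) (b : ℕ → M) :
    ∑ r ∈ Finset.range (2 ^ d), (∑ l ∈ Finset.range (2 ^ d), hadamard d r l * a l) •
        ∑ l ∈ Finset.range (2 ^ d), hadamard d r l • b l
      = ∑ l ∈ Finset.range (2 ^ d), (2 ^ d * a l) • b l := by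
  calc
    _ = ∑ l ∈ Finset.range (2 ^ d), ∑ l' ∈ Finset.range (2 ^ d),
        (∑ r ∈ Finset.range (2 ^ d), hadamard d r l * hadamard d r l') • a l • b l' := by
      simp only [Finset.sum_smul, Finset.smul_sum]
      rw [Finset.sum_comm_cycle]
      refine Finset.sum_congr rfl fun l _ => ?_
      rw [Finset.sum_comm]
      refine Finset.sum_congr rfl fun l' _ => Finset.sum_congr rfl fun r _ => ?_
      simp only [smul_smul]
      congr 1
      ring
    _ = ∑ l ∈ Finset.range (2 ^ d), (2 ^ d * a l) • b l := by
      refine Finset.sum_congr rfl fun l hl => ?_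
      rw [Finset.sum_congr rfl fun l' hl' => by
        rw [sum_hadamard_mul d (Finset.mem_range.1 hl) (Finset.mem_range.1 hl'), ite_smul,
          zero_smul], Finset.sum_ite_eq, if_pos hl, smul_smul]

/-- The Haar coefficients of a function `a` of dyadic cubes, `a n k` being its value at the `k`-th
cube of generation `n`. Both `g_{n,k,r}` and `λ_{n,k,r}(f)` have this form. -/
def haarCoef (d : ℕ) (a : ℕ → ℕ → M) (n k r : ℕ) : M :=
  (2 : ℝ) ^ ((n * d : ℝ) / 2) • ∑ l ∈ Finset.range (2 ^ d),
    hadamard d r l • a (n + 1) (2 ^ d * k + l)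

/-- The Haar coefficients of a function of dyadic cubes, in the lexicographic order. -/
def haarCoefSeq (d : ℕ) (a : ℕ → ℕ → M) : ℕ → M
  | 0 => a 0 0
  | j + 1 => haarCoef d a (genNo d (j + 1)) (cubeNo d (j + 1)) (typeNo d (j + 1))

/-- A function of dyadic cubes is additive if its value at each cube is the sum of its values at
the `2 ^ d` subcubes of the next generation. -/
def DyadicAdditive (d : ℕ) {N : Type*} [AddCommMonoid N] (a : ℕ → ℕ → N) : Prop :=
  ∀ n k, k < 2 ^ (n * d) → ∑ l ∈ Finset.range (2 ^ d), a (n + 1) (2 ^ d * k + l) = a n k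

lemma map_haarCoefSeq (φ : M →ₗ[ℝ] M') (a : ℕ → ℕ → M) (j : ℕ) :
    φ (haarCoefSeq d a j) = haarCoefSeq d (fun n k => φ (a n k)) j := by
  cases j with
  | zero => rfl
  | succ j => simp [haarCoefSeq, haarCoef, map_sum]

lemma haarCoef_mem {S : Submodule ℝ M} {a : ℕ → ℕ → M} {n k : ℕ} (hk : k < 2 ^ (n * d))
    (ha : ∀ k < 2 ^ ((n + 1) * d), a (n + 1) k ∈ S) (r : ℕ) : haarCoef d a n k r ∈ S :=
  S.smul_mem _ <| S.sum_mem fun _ hl => S.smul_mem _ <| ha _ (child_lt hk (Finset.mem_range.1 hl))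

lemma haarCoefSeq_congr (hd : 1 ≤ d) {a b : ℕ → ℕ → M} (h : ∀ n k, k < 2 ^ (n * d) → a n k = b n k)
    (j : ℕ) : haarCoefSeq d a j = haarCoefSeq d b j := by
  cases j with
  | zero => exact h 0 0 (by simp)
  | succ j =>
    simp only [haarCoefSeq, haarCoef]
    congr 1
    refine Finset.sum_congr rfl fun l hl => ?_
    rw [h _ _ (child_lt (cubeNo_lt hd j.succ_ne_zero) (Finset.mem_range.1 hl))]

lemma haarCoefSeq_eq_haarCoef (a : ℕ → ℕ → M) {n k r : ℕ} (hk : k < 2 ^ (n * d))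
    (hr : r < 2 ^ d - 1) :
    haarCoefSeq d a (2 ^ (n * d) + (2 ^ d - 1) * k + r) = haarCoef d a n k (r + 1) := by
  have hd : 1 ≤ d := by
    rw [Nat.one_le_iff_ne_zero]
    rintro rfl
    simp at hr
  obtain ⟨hgen, hcube, htype⟩ := index_of_rank d n k (r + 1) hd hk (by omega) (by omega)
  simp only [Nat.add_sub_cancel] at hgen hcube htype
  obtain ⟨j, hj⟩ : ∃ j, 2 ^ (n * d) + (2 ^ d - 1) * k + r = j + 1 :=
    Nat.exists_eq_succ_of_ne_zero (by positivity)
  rw [hj] at hgen hcube htype ⊢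
  rw [haarCoefSeq, hgen, hcube, htype]

lemma sum_range_add_mul {N : Type*} [AddCommMonoid N] (F : ℕ → N) (p m q : ℕ) :
    ∑ j ∈ Finset.range (p + m * q), F j = ∑ j ∈ Finset.range p, F j
      + ∑ k ∈ Finset.range q, ∑ r ∈ Finset.range m, F (p + m * k + r) := by
  induction q with
  | zero => simp
  | succ q ih =>
    rw [mul_add, mul_one, ← add_assoc, Finset.sum_range_add, ih, Finset.sum_range_succ, add_assoc]

lemma sum_range_two_pow_succ_mul {N : Type*} [AddCommMonoid N] (F : ℕ → N) (d n : ℕ) :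
    ∑ k ∈ Finset.range (2 ^ ((n + 1) * d)), F k
      = ∑ k ∈ Finset.range (2 ^ (n * d)), ∑ l ∈ Finset.range (2 ^ d), F (2 ^ d * k + l) := by
  simpa only [zero_add, Finset.sum_range_zero, ← pow_add, add_one_mul, add_comm d]
    using sum_range_add_mul F 0 (2 ^ d) (2 ^ (n * d))

lemma DyadicAdditive.sum_eq {N : Type*} [AddCommMonoid N] {a : ℕ → ℕ → N}
    (ha : DyadicAdditive d a) (n : ℕ) : ∑ k ∈ Finset.range (2 ^ (n * d)), a n k = a 0 0 := by
  induction n with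
  | zero => simp
  | succ n ih =>
    rw [sum_range_two_pow_succ_mul, ← ih]
    exact Finset.sum_congr rfl fun k hk => ha n k (Finset.mem_range.1 hk)

lemma two_rpow_half_mul_self (n d : ℕ) :
    (2 : ℝ) ^ ((n * d : ℝ) / 2) * (2 : ℝ) ^ ((n * d : ℝ) / 2) = 2 ^ (n * d) := by
  rw [← Real.rpow_add (by norm_num), add_halves, ← Nat.cast_mul, Real.rpow_natCast]

lemma haarCoef_smul_haarCoef (d : ℕ) (a : ℕ → ℕ → ℝ) (b : ℕ → ℕ → M) (n k r : ℕ) :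
    haarCoef d a n k r • haarCoef d b n k r
      = (2 : ℝ) ^ (n * d) •
        (∑ l ∈ Finset.range (2 ^ d), hadamard d r l * a (n + 1) (2 ^ d * k + l)) •
          ∑ l ∈ Finset.range (2 ^ d), hadamard d r l • b (n + 1) (2 ^ d * k + l) := by
  rw [haarCoef, haarCoef, smul_smul_smul_comm, smul_eq_mul, two_rpow_half_mul_self]
  rfl

lemma sum_haarCoef_smul_haarCoef (d : ℕ) (a : ℕ → ℕ → ℝ) (b : ℕ → ℕ → M) (n k : ℕ) :
    ∑ r ∈ Finset.range (2 ^ d), haarCoef d a n k r • haarCoef d b n k r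
      = ∑ l ∈ Finset.range (2 ^ d),
        (2 ^ ((n + 1) * d) * a (n + 1) (2 ^ d * k + l)) • b (n + 1) (2 ^ d * k + l) := by
  simp only [haarCoef_smul_haarCoef, ← Finset.smul_sum]
  rw [sum_hadamard_smul_sum_hadamard_smul]
  simp only [Finset.smul_sum, smul_smul, ← mul_assoc, ← pow_add, add_one_mul]

lemma haarCoef_zero_smul_haarCoef_zero {a : ℕ → ℕ → ℝ} {b : ℕ → ℕ → M} (ha : DyadicAdditive d a)
    (hb : DyadicAdditive d b) {n k : ℕ} (hk : k < 2 ^ (n * d)) :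
    haarCoef d a n k 0 • haarCoef d b n k 0 = (2 ^ (n * d) * a n k) • b n k := by
  simp only [haarCoef_smul_haarCoef, hadamard_zero_left, one_mul, one_smul, ha n k hk, hb n k hk,
    smul_smul]

/-- The partial sums up to the end of a generation telescope, since passing from `n` to `n + 1`
replaces `r = 0` by all rows of the Hadamard matrix, which are orthogonal. -/
theorem sum_haarCoefSeq_smul_haarCoefSeq {a : ℕ → ℕ → ℝ} {b : ℕ → ℕ → M} (ha : DyadicAdditive d a)
    (hb : DyadicAdditive d b) (n : ℕ) :
    ∑ j ∈ Finset.range (2 ^ (n * d)), haarCoefSeq d a j • haarCoefSeq d b j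
      = ∑ k ∈ Finset.range (2 ^ (n * d)), (2 ^ (n * d) * a n k) • b n k := by
  induction n with
  | zero => simp [haarCoefSeq]
  | succ n ih =>
    rw [two_pow_succ_mul, sum_range_add_mul, ← two_pow_succ_mul, ih, add_comm,
      ← Finset.sum_add_distrib, sum_range_two_pow_succ_mul]
    refine Finset.sum_congr rfl fun k hk => ?_
    replace hk := Finset.mem_range.1 hk
    rw [← sum_haarCoef_smul_haarCoef, ← Nat.sub_add_cancel (Nat.one_le_two_pow (n := d)),
      Finset.sum_range_succ', haarCoef_zero_smul_haarCoef_zero ha hb hk, Nat.add_sub_cancel]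
    congr 1
    refine Finset.sum_congr rfl fun r hr => ?_
    rw [haarCoefSeq_eq_haarCoef a hk (Finset.mem_range.1 hr),
      haarCoefSeq_eq_haarCoef b hk (Finset.mem_range.1 hr)]

end HaarCoef

lemma norm_haarCoef_le {M : Type*} [SeminormedAddCommGroup M] [NormedSpace ℝ M] {a : ℕ → ℕ → M}
    {n k : ℕ} {c : ℝ} (ha : ∀ l < 2 ^ d, ‖a (n + 1) (2 ^ d * k + l)‖ ≤ c) (r : ℕ) :
    ‖haarCoef d a n k r‖ ≤ (2 : ℝ) ^ ((n * d : ℝ) / 2) * (2 ^ d * c) := by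
  rw [haarCoef, norm_smul, Real.norm_of_nonneg (by positivity)]
  gcongr
  calc ‖∑ l ∈ Finset.range (2 ^ d), hadamard d r l • a (n + 1) (2 ^ d * k + l)‖
      ≤ ∑ l ∈ Finset.range (2 ^ d), ‖hadamard d r l • a (n + 1) (2 ^ d * k + l)‖ :=
        norm_sum_le _ _
    _ ≤ ∑ _l ∈ Finset.range (2 ^ d), c := by
        gcongr with l hl
        rw [norm_smul, Real.norm_eq_abs, abs_hadamard, one_mul]
        exact ha l (Finset.mem_range.1 hl)
    _ = 2 ^ d * c := by simp

lemma norm_haarCoef_le_of_norm_sub_le {M : Type*} [SeminormedAddCommGroup M] [NormedSpace ℝ M]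
    {a : ℕ → ℕ → M} {n k r : ℕ} {c : ℝ}
    (ha : ∀ l < 2 ^ d, ‖a (n + 1) (2 ^ d * k + l) - a (n + 1) (2 ^ d * k)‖ ≤ c)
    (hr : r < 2 ^ d) (hr0 : r ≠ 0) :
    ‖haarCoef d a n k r‖ ≤ (2 : ℝ) ^ ((n * d : ℝ) / 2) * (2 ^ d * c) := by
  have haarCoef_eq : haarCoef d a n k r
      = haarCoef d (fun m k' => a m k' - a (n + 1) (2 ^ d * k)) n k r := by
    simp only [haarCoef, smul_sub, Finset.sum_sub_distrib, ← Finset.sum_smul,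
      sum_hadamard_eq_zero hr hr0, zero_smul, sub_zero]
  rw [haarCoef_eq]
  exact norm_haarCoef_le ha r

/-! ### Increments over dyadic cubes -/

namespace DyadicNumbering

variable (K : DyadicNumbering d)

lemma corner_lt {n k : ℕ} (hk : k < 2 ^ (n * d)) (i : Fin d) : K.corner n k i < 2 ^ n :=
  (K.bijOn n).mapsTo hk i

lemma corner_zero : K.corner 0 0 = fun _ => 0 :=
  funext fun i => by simpa using K.corner_lt (n := 0) (k := 0) (by simp) i

lemma sum_corner {M : Type*} [AddCommMonoid M] (F : (Fin d → ℕ) → M) (n : ℕ) :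
    ∑ k ∈ Finset.range (2 ^ (n * d)), F (K.corner n k)
      = ∑ m ∈ Fintype.piFinset fun _ => Finset.range (2 ^ n), F m := by
  refine Finset.sum_bij (fun k _ => K.corner n k) (fun k hk => ?_) (fun k hk k' hk' h => ?_)
    (fun m hm => ?_) (fun _ _ => rfl)
  · simpa only [Fintype.mem_piFinset, Finset.mem_range] using K.corner_lt (Finset.mem_range.1 hk)
  · exact (K.bijOn n).injOn (by simpa using hk) (by simpa using hk') h
  · simp only [Fintype.mem_piFinset, Finset.mem_range] at hm
    obtain ⟨k, hk, h⟩ := (K.bijOn n).surjOn hm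
    exact ⟨k, Finset.mem_range.2 hk, h⟩

lemma sum_child {M : Type*} [AddCommMonoid M] (F : (Fin d → ℕ) → M) {n k : ℕ}
    (hk : k < 2 ^ (n * d)) :
    ∑ l ∈ Finset.range (2 ^ d), F (K.corner (n + 1) (2 ^ d * k + l))
      = ∑ m ∈ Fintype.piFinset fun i =>
        Finset.Ico (2 * K.corner n k i) (2 * (K.corner n k i + 1)), F m := by
  have injOn_child : Set.InjOn (fun l => K.corner (n + 1) (2 ^ d * k + l))
      (Finset.range (2 ^ d)) := by
    intro l hl l' hl' h
    have := (K.bijOn (n + 1)).injOn (child_lt hk (by simpa using hl))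
      (child_lt hk (by simpa using hl')) h
    omega
  have image_child : (Finset.range (2 ^ d)).image (fun l => K.corner (n + 1) (2 ^ d * k + l))
      = Fintype.piFinset fun i =>
        Finset.Ico (2 * K.corner n k i) (2 * (K.corner n k i + 1)) := by
    refine Finset.eq_of_subset_of_card_le (fun m hm => ?_) ?_
    · obtain ⟨l, hl, rfl⟩ := Finset.mem_image.1 hm
      simp only [Fintype.mem_piFinset, Finset.mem_Ico]
      intro i
      have := K.subcube n k l hk (Finset.mem_range.1 hl) i
      omega
    · simp [Finset.card_image_of_injOn injOn_child, mul_add_one]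
  rw [← image_child, Finset.sum_image injOn_child]

end DyadicNumbering

lemma prod_boole_eq {ι α R : Type*} [Fintype ι] [DecidableEq α] [CommSemiring R] (v z : ι → α) :
    ∏ i, (if v i = z i then (1 : R) else 0) = if v = z then 1 else 0 := by
  simp [Finset.prod_ite_zero, funext_iff]

section GridIncrement

variable {ι R : Type*} [Fintype ι] [DecidableEq ι] [CommRing R]

/-- The increment of a function of integer points over the box with opposite vertices `p` and `q`.
It is the discrete counterpart of `rectIncrement`. -/
def gridIncrement (φ : (ι → ℕ) → R) (p q : ι → ℕ) : R :=
  ∑ S : Finset ι, (-1) ^ S.card * φ fun i => if i ∈ S then p i else q i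

lemma gridIncrement_prod (ψ : ι → ℕ → R) (p q : ι → ℕ) :
    gridIncrement (fun m => ∏ i, ψ i (m i)) p q = ∏ i, (ψ i (q i) - ψ i (p i)) := by
  rw [Finset.prod_sub, Finset.powerset_univ, gridIncrement]
  refine Finset.sum_congr rfl fun S _ => ?_
  rw [mul_assoc, mul_comm (∏ i ∈ _, _), ← Finset.prod_mul_prod_compl S,
    Finset.compl_eq_univ_sdiff]
  congr 2
  · exact Finset.prod_congr rfl fun i hi => by simp only [if_pos hi]
  · exact Finset.prod_congr rfl fun i hi => by simp only [if_neg (Finset.mem_sdiff.1 hi).2]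

lemma sum_gridIncrement_prod (ψ : ι → ℕ → R) {p q : ι → ℕ} (hpq : ∀ i, p i ≤ q i) :
    ∑ m ∈ Fintype.piFinset fun i => Finset.Ico (p i) (q i),
      gridIncrement (fun m => ∏ i, ψ i (m i)) m (fun i => m i + 1)
      = gridIncrement (fun m => ∏ i, ψ i (m i)) p q := by
  simp only [gridIncrement_prod]
  rw [← Finset.prod_univ_sum _ fun i k => ψ i (k + 1) - ψ i k]
  exact Finset.prod_congr rfl fun i _ => Finset.sum_Ico_sub (ψ i) (hpq i)

lemma gridIncrement_eq_sum_mul (φ : (ι → ℕ) → R) {p q N : ι → ℕ} (hp : ∀ i, p i < N i)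
    (hq : ∀ i, q i < N i) :
    gridIncrement φ p q = ∑ z ∈ Fintype.piFinset fun i => Finset.range (N i),
      φ z * gridIncrement (fun m => ∏ i, if m i = z i then 1 else 0) p q := by
  simp only [gridIncrement, Finset.mul_sum, mul_left_comm (φ _)]
  rw [Finset.sum_comm]
  refine Finset.sum_congr rfl fun S _ => ?_
  rw [← Finset.mul_sum]
  congr 1
  simp only [prod_boole_eq, mul_ite, mul_one, mul_zero]
  rw [Finset.sum_ite_eq, if_pos]
  refine Fintype.mem_piFinset.2 fun i => Finset.mem_range.2 ?_
  split_ifs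
  exacts [hp i, hq i]

/-- By linearity it suffices to consider products of functions of one variable. -/
theorem sum_gridIncrement (φ : (ι → ℕ) → R) {p q : ι → ℕ} (hpq : ∀ i, p i ≤ q i) :
    ∑ m ∈ Fintype.piFinset fun i => Finset.Ico (p i) (q i),
      gridIncrement φ m (fun i => m i + 1) = gridIncrement φ p q := by
  have expand {m : ι → ℕ} (hm : m ∈ Fintype.piFinset fun i => Finset.Ico (p i) (q i)) :=
    have lt_add_one (i) : m i < q i := (Finset.mem_Ico.1 (Fintype.mem_piFinset.1 hm i)).2
    gridIncrement_eq_sum_mul φ (p := m) (q := fun i => m i + 1) (N := fun i => q i + 1)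
      (fun i => (lt_add_one i).trans (Nat.lt_succ_self _))
      (fun i => Nat.succ_lt_succ (lt_add_one i))
  rw [Finset.sum_congr rfl fun m hm => expand hm, Finset.sum_comm,
    gridIncrement_eq_sum_mul φ (N := fun i => q i + 1) (fun i => Nat.lt_succ_of_le (hpq i))
      (fun i => Nat.lt_succ_self _)]
  refine Finset.sum_congr rfl fun z _ => ?_
  rw [← Finset.mul_sum, sum_gridIncrement_prod (fun i k => if k = z i then 1 else 0) hpq]

end GridIncrement

lemma rectIncrement_dyadicLo_dyadicLo (f : E d → ℝ) (n : ℕ) (p q : Fin d → ℕ) :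
    rectIncrement f (dyadicLo n p) (dyadicLo n q)
      = gridIncrement (fun m => f (WithLp.toLp 2 (dyadicLo n m))) p q := by
  refine Finset.sum_congr rfl fun S _ => ?_
  congr 3
  funext i
  simp only [dyadicLo]
  split_ifs <;> rfl

lemma dyadicHi_eq_dyadicLo (n : ℕ) (m : Fin d → ℕ) :
    dyadicHi n m = dyadicLo n fun i => m i + 1 := by
  funext i
  simp [dyadicHi, dyadicLo]

lemma dyadicLo_succ_two_mul (n : ℕ) (m : Fin d → ℕ) :
    dyadicLo (n + 1) (fun i => 2 * m i) = dyadicLo n m := by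
  funext i
  simp only [dyadicLo, pow_succ]
  push_cast
  field_simp

lemma sum_rectIncrement_dyadic (f : E d → ℝ) (n : ℕ) {p q : Fin d → ℕ} (hpq : ∀ i, p i ≤ q i) :
    ∑ m ∈ Fintype.piFinset fun i => Finset.Ico (p i) (q i),
      rectIncrement f (dyadicLo n m) (dyadicHi n m)
      = rectIncrement f (dyadicLo n p) (dyadicLo n q) := by
  simp only [dyadicHi_eq_dyadicLo, rectIncrement_dyadicLo_dyadicLo]
  exact sum_gridIncrement _ hpq

lemma DyadicNumbering.dyadicAdditive_increment (K : DyadicNumbering d) (f : E d → ℝ) :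
    DyadicAdditive d (K.increment f) := fun n k hk => by
  unfold DyadicNumbering.increment
  rw [K.sum_child (fun m => rectIncrement f (dyadicLo (n + 1) m) (dyadicHi (n + 1) m)) hk,
    sum_rectIncrement_dyadic f (n + 1) fun i => by omega, dyadicLo_succ_two_mul,
    dyadicLo_succ_two_mul n (fun i => K.corner n k i + 1), dyadicHi_eq_dyadicLo]

lemma DyadicNumbering.increment_zero (K : DyadicNumbering d) (f : E d → ℝ) :
    K.increment f 0 0 = rectIncrement f (fun _ => 0) (fun _ => 1) := by
  rw [DyadicNumbering.increment, K.corner_zero]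
  congr 1 <;> funext i <;> simp [dyadicLo, dyadicHi]

lemma lamSeq_eq_haarCoefSeq (K : DyadicNumbering d) (f : E d → ℝ) (j : ℕ) :
    lamSeq K f j = haarCoefSeq d (K.increment f) j := by
  cases j with
  | zero => exact (K.increment_zero f).symm
  | succ j => rfl

/-! ### Half-open dyadic cells -/

lemma volume_rect (a b : Fin d → ℝ) : volume (rect a b) = ∏ i, ENNReal.ofReal (b i - a i) := by
  rw [← Real.volume_Icc_pi, ← (PiLp.volume_preserving_ofLp (Fin d)).measure_preimage
    measurableSet_Icc.nullMeasurableSet]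
  congr 1
  ext x
  simp [rect, Pi.le_def, forall_and]

lemma volume_rect_dyadic (n : ℕ) (m : Fin d → ℕ) :
    volume (rect (dyadicLo n m) (dyadicHi n m)) = ENNReal.ofReal (2 ^ (n * d))⁻¹ := by
  have side (i) : dyadicHi n m i - dyadicLo n m i = (2 ^ n)⁻¹ := by
    simp only [dyadicHi, dyadicLo]
    ring
  simp only [volume_rect, side, Finset.prod_const, Finset.card_univ, Fintype.card_fin]
  rw [← ENNReal.ofReal_pow (by positivity), inv_pow, pow_mul]

lemma ae_coord_ne (i : Fin d) (c : ℝ) : ∀ᵐ x : E d, x i ≠ c := by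
  have : ∀ᵐ y : Fin d → ℝ, y i ≠ c := by
    rw [ae_iff]
    simpa [← volume_pi] using Measure.pi_hyperplane (fun _ : Fin d => (volume : Measure ℝ)) i c
  exact (PiLp.volume_preserving_ofLp (Fin d)).quasiMeasurePreserving.ae this

/-- The index of the half-open dyadic cell of generation `n` containing `x`. Unlike the closed
dyadic cubes, these cells form a partition. -/
def cellIndex (n : ℕ) (x : E d) : Fin d → ℤ := fun i => ⌊2 ^ n * x i⌋

/-- The half-open dyadic cell of generation `n` with index `m`. -/
def cell (n : ℕ) (m : Fin d → ℤ) : Set (E d) := {x | cellIndex n x = m}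

lemma mem_cell {n : ℕ} {m : Fin d → ℤ} {x : E d} : x ∈ cell n m ↔ cellIndex n x = m := Iff.rfl

lemma measurable_cellIndex (n : ℕ) : Measurable (cellIndex n : E d → Fin d → ℤ) :=
  measurable_pi_lambda _ fun i =>
    Int.measurable_floor.comp (Measurable.const_mul (by fun_prop) _)

lemma measurableSet_cell (n : ℕ) (m : Fin d → ℤ) : MeasurableSet (cell n m) :=
  measurable_cellIndex n (measurableSet_singleton m)

lemma iUnion_cell (n : ℕ) : ⋃ m : Fin d → ℤ, cell n m = (Set.univ : Set (E d)) :=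
  Set.iUnion_eq_univ_iff.2 fun x => ⟨cellIndex n x, rfl⟩

lemma pairwise_disjoint_cell (n : ℕ) :
    Pairwise (Function.onFun Disjoint (cell n : (Fin d → ℤ) → Set (E d))) := fun _ _ h =>
  Set.disjoint_left.2 fun _ hx hx' => h (hx.symm.trans hx')

lemma rect_ae_eq_cell (n : ℕ) (m : Fin d → ℕ) :
    rect (dyadicLo n m) (dyadicHi n m) =ᵐ[volume] cell n fun i => (m i : ℤ) := by
  have ne_dyadicHi : ∀ᵐ x : E d, ∀ i, x i ≠ dyadicHi n m i := ae_all_iff.2 fun i => ae_coord_ne i _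
  filter_upwards [ne_dyadicHi] with x hx
  refine propext ?_
  have two_pow_pos : (0 : ℝ) < 2 ^ n := by positivity
  change (∀ i, dyadicLo n m i ≤ x i ∧ x i ≤ dyadicHi n m i) ↔ cellIndex n x = _
  rw [funext_iff]
  refine forall_congr' fun i => ?_
  rw [(hx i).le_iff_lt]
  simp only [cellIndex, dyadicLo, dyadicHi, Int.floor_eq_iff, Int.cast_natCast]
  rw [div_le_iff₀' two_pow_pos, lt_div_iff₀' two_pow_pos]

/-- The vector of the lattice `2 ^ (-n) ℤ^d` with integer coordinates `v`. The cells of generation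
`n` are permuted by translations along this lattice. -/
def latVec (n : ℕ) (v : Fin d → ℤ) : E d := WithLp.toLp 2 fun i => (v i : ℝ) / 2 ^ n

lemma latVec_single (n : ℕ) (i : Fin d) (c : ℤ) :
    latVec n (Pi.single i c) = ((c : ℝ) / 2 ^ n) • (unitVec i : E d) := by
  ext j
  rcases eq_or_ne j i with rfl | h
  · simp [latVec]
  · simp [latVec, h]

lemma cellIndex_add_latVec (n : ℕ) (x : E d) (v : Fin d → ℤ) :
    cellIndex n (x + latVec n v) = cellIndex n x + v := by
  funext i
  simp only [cellIndex, latVec, PiLp.add_apply, Pi.add_apply, mul_add,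
    mul_div_cancel₀ _ (by positivity : (2 : ℝ) ^ n ≠ 0), Int.floor_add_intCast]

lemma preimage_add_latVec_cell (n : ℕ) (m v : Fin d → ℤ) :
    (fun x : E d => x + latVec n v) ⁻¹' cell n (m + v) = cell n m := by
  ext x
  simp only [Set.mem_preimage, mem_cell, cellIndex_add_latVec, add_left_inj]

lemma setIntegral_cell_add {F : Type*} [NormedAddCommGroup F] [NormedSpace ℝ F] (u : E d → F)
    (n : ℕ) (m v : Fin d → ℤ) :
    ∫ x in cell n (m + v), u x = ∫ x in cell n m, u (x + latVec n v) := by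
  rw [← (measurePreserving_add_right volume (latVec n v)).setIntegral_preimage_emb
    (measurableEmbedding_addRight _) u, preimage_add_latVec_cell]

lemma volume_cell (n : ℕ) (m : Fin d → ℤ) :
    volume (cell n m) = ENNReal.ofReal (2 ^ (n * d))⁻¹ := by
  calc volume (cell n m) = volume (cell n (0 : Fin d → ℤ)) := by
        rw [← preimage_add_latVec_cell n 0 m, zero_add, measure_preimage_add_right]
    _ = volume (rect (dyadicLo n (0 : Fin d → ℕ)) (dyadicHi n 0)) :=
        (measure_congr (rect_ae_eq_cell n 0)).symm
    _ = ENNReal.ofReal (2 ^ (n * d))⁻¹ := volume_rect_dyadic n 0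

lemma cellIndex_succ_div (n : ℕ) (x : E d) (i : Fin d) :
    cellIndex (n + 1) x i / 2 = cellIndex n x i := by
  simp only [cellIndex]
  rw [← Nat.cast_ofNat (R := ℤ), ← Int.floor_div_natCast, pow_succ, mul_right_comm, Nat.cast_ofNat,
    mul_div_cancel_right₀ _ two_ne_zero]

/-! ### Step functions -/

lemma sum_norm_sub_of_monotone {F : Type*} [NormedAddCommGroup F] {s : ℕ → F} {g : ℕ → ℤ}
    (hg : Monotone g) (hs : s.FactorsThrough g) {N : ℕ} (hN : g N ≤ g 0 + 1) :
    ∑ j ∈ Finset.range N, ‖s (j + 1) - s j‖ = ‖s N - s 0‖ := by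
  induction N with
  | zero => simp
  | succ N ih =>
    have hg_succ : g N ≤ g (N + 1) := hg N.le_succ
    have hg_zero : g 0 ≤ g N := hg N.zero_le
    rw [Finset.sum_range_succ, ih (by omega)]
    rcases eq_or_ne (g N) (g 0) with h | h
    · simp [hs h]
    · simp [hs (show g (N + 1) = g N by omega)]

lemma cellIndex_add_smul_unitVec_self (n : ℕ) (x : E d) (i : Fin d) (t : ℝ) :
    cellIndex n (x + t • unitVec i) i = ⌊2 ^ n * (x i + t)⌋ := by
  simp [cellIndex]

lemma cellIndex_add_smul_unitVec_of_ne (n : ℕ) (x : E d) {i l : Fin d} (h : l ≠ i) (t : ℝ) :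
    cellIndex n (x + t • unitVec i) l = cellIndex n x l := by
  simp [cellIndex, h]

section StepFunction

variable {F : Type*} [NormedAddCommGroup F] {n : ℕ} {w : E d → F}

/-- A segment whose length is the side of a cell crosses at most one wall of the grid. -/
lemma sum_norm_sub_of_factorsThrough_cellIndex (hw : w.FactorsThrough (cellIndex n)) (x : E d)
    (i : Fin d) {N : ℕ} (hN : N ≠ 0) :
    ∑ j ∈ Finset.range N, ‖w (x + (j + 1) • ((2 ^ n)⁻¹ / N : ℝ) • unitVec i)
        - w (x + j • ((2 ^ n)⁻¹ / N : ℝ) • unitVec i)‖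
      = ‖w (x + ((2 : ℝ) ^ n)⁻¹ • unitVec i) - w x‖ := by
  have nsmul_eq (j : ℕ) : j • ((2 ^ n)⁻¹ / N : ℝ) • (unitVec i : E d)
      = ((2 ^ n)⁻¹ * (j / N) : ℝ) • unitVec i := by
    rw [← Nat.cast_smul_eq_nsmul ℝ, smul_smul]
    congr 1
    ring
  have hN' : (N : ℝ) / N = 1 := div_self (Nat.cast_ne_zero.2 hN)
  have index_eq (j : ℕ) : cellIndex n (x + ((2 ^ n)⁻¹ * (j / N) : ℝ) • unitVec i) i
      = ⌊2 ^ n * x i + j / N⌋ := by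
    rw [cellIndex_add_smul_unitVec_self, mul_add, mul_inv_cancel_left₀ (by positivity)]
  simp only [nsmul_eq]
  rw [sum_norm_sub_of_monotone (g := fun j : ℕ => ⌊2 ^ n * x i + j / N⌋)
    (s := fun j : ℕ => w (x + ((2 ^ n)⁻¹ * (j / N) : ℝ) • unitVec i))]
  · simp [hN']
  · exact fun j j' h => Int.floor_mono (by gcongr)
  · refine fun j j' h => hw (funext fun l => ?_)
    rcases eq_or_ne l i with rfl | hl
    · exact (index_eq j).trans (h.trans (index_eq j').symm)
    · rw [cellIndex_add_smul_unitVec_of_ne n x hl, cellIndex_add_smul_unitVec_of_ne n x hl]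
  · simp [hN']

lemma mul_translationModulus_of_factorsThrough_cellIndex (hw : w.FactorsThrough (cellIndex n))
    (hint : Integrable w) (i : Fin d) {N : ℕ} (hN : N ≠ 0) :
    N * translationModulus w (((2 ^ n)⁻¹ / N : ℝ) • unitVec i)
      = translationModulus w (((2 : ℝ) ^ n)⁻¹ • unitVec i) := by
  rw [mul_translationModulus_eq hint]
  simp only [sum_norm_sub_of_factorsThrough_cellIndex hw _ i hN, translationModulus]

end StepFunction

theorem variation_le_of_factorsThrough_cellIndex {n : ℕ} {w : E d → ℝ}
    (hw : w.FactorsThrough (cellIndex n)) (hint : Integrable w) :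
    variation w ≤ ENNReal.ofReal
      (∑ i : Fin d, 2 ^ n * translationModulus w (((2 : ℝ) ^ n)⁻¹ • unitVec i)) := by
  have tendsto_step : Tendsto (fun N : ℕ => ((2 ^ n)⁻¹ / N : ℝ)) atTop (𝓝[>] 0) :=
    tendsto_nhdsWithin_iff.2 ⟨tendsto_const_div_atTop_nhds_zero_nat _,
      (eventually_gt_atTop 0).mono fun N hN => by
        have : (0 : ℝ) < N := by exact_mod_cast hN
        simp only [Set.mem_Ioi]
        positivity⟩
  refine variation_le_of_translationModulus_le hint fun i => tendsto_step.frequently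
    ((eventually_ne_atTop 0).mono fun N hN => le_of_eq ?_).frequently
  have : (N : ℝ) ≠ 0 := Nat.cast_ne_zero.2 hN
  rw [← mul_translationModulus_of_factorsThrough_cellIndex hw hint i hN]
  field_simp

/-! ### Averages over dyadic cells -/

section CellAverage

variable {F : Type*} [NormedAddCommGroup F] [NormedSpace ℝ F] {u : E d → F}

/-- The function equal on each cell of generation `n` to the mean value of `u` over that cell. -/
def cellAverage (n : ℕ) (u : E d → F) (x : E d) : F :=
  (2 : ℝ) ^ (n * d) • ∫ y in cell n (cellIndex n x), u y

lemma factorsThrough_cellAverage (n : ℕ) (u : E d → F) :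
    (cellAverage n u).FactorsThrough (cellIndex n) := fun _ _ h => by
  rw [cellAverage, h, cellAverage]

lemma stronglyMeasurable_cellAverage (n : ℕ) (u : E d → F) :
    StronglyMeasurable (cellAverage n u) :=
  (StronglyMeasurable.of_discrete
    (f := fun m => (2 : ℝ) ^ (n * d) • ∫ y in cell n m, u y)).comp_measurable
    (measurable_cellIndex n)

lemma lintegral_enorm_cellAverage_le (n : ℕ) (u : E d → F) :
    ∫⁻ x, ‖cellAverage n u x‖ₑ ≤ ∫⁻ x, ‖u x‖ₑ := by
  rw [← setLIntegral_univ, ← setLIntegral_univ (f := fun x => ‖u x‖ₑ), ← iUnion_cell n,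
    lintegral_iUnion (measurableSet_cell n) (pairwise_disjoint_cell n),
    lintegral_iUnion (measurableSet_cell n) (pairwise_disjoint_cell n)]
  refine ENNReal.tsum_le_tsum fun m => ?_
  calc ∫⁻ x in cell n m, ‖cellAverage n u x‖ₑ
      = ∫⁻ _ in cell n m, ‖(2 : ℝ) ^ (n * d) • ∫ y in cell n m, u y‖ₑ :=
        setLIntegral_congr_fun (measurableSet_cell n m) fun _ hx => by
          rw [cellAverage, mem_cell.1 hx]
    _ = ‖(2 : ℝ) ^ (n * d)‖ₑ * ENNReal.ofReal (2 ^ (n * d))⁻¹ * ‖∫ y in cell n m, u y‖ₑ := by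
        rw [lintegral_const, Measure.restrict_apply_univ, volume_cell, enorm_smul, mul_right_comm]
    _ = ‖∫ y in cell n m, u y‖ₑ := by
        rw [Real.enorm_eq_ofReal (by positivity), ← ENNReal.ofReal_mul (by positivity),
          mul_inv_cancel₀ (by positivity), ENNReal.ofReal_one, one_mul]
    _ ≤ ∫⁻ x in cell n m, ‖u x‖ₑ := enorm_integral_le_lintegral_enorm _

lemma integrable_cellAverage (n : ℕ) (hu : Integrable u) : Integrable (cellAverage n u) :=
  ⟨(stronglyMeasurable_cellAverage n u).aestronglyMeasurable,
    (lintegral_enorm_cellAverage_le n u).trans_lt hu.2⟩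

lemma integral_norm_cellAverage_le (n : ℕ) (hu : Integrable u) :
    ∫ x, ‖cellAverage n u x‖ ≤ ∫ x, ‖u x‖ := by
  rw [integral_norm_eq_lintegral_enorm (integrable_cellAverage n hu).aestronglyMeasurable,
    integral_norm_eq_lintegral_enorm hu.aestronglyMeasurable]
  exact ENNReal.toReal_mono hu.2.ne (lintegral_enorm_cellAverage_le n u)

lemma cellAverage_comp_add_latVec_sub (n : ℕ) (hu : Integrable u) (v : Fin d → ℤ) (x : E d) :
    cellAverage n u (x + latVec n v) - cellAverage n u x
      = cellAverage n (fun y => u (y + latVec n v) - u y) x := by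
  simp only [cellAverage]
  rw [cellIndex_add_latVec, setIntegral_cell_add, ← smul_sub,
    integral_sub (hu.comp_add_right _).integrableOn hu.integrableOn]

lemma translationModulus_cellAverage_le (n : ℕ) (hu : Integrable u) (v : Fin d → ℤ) :
    translationModulus (cellAverage n u) (latVec n v) ≤ translationModulus u (latVec n v) := by
  simp only [translationModulus, cellAverage_comp_add_latVec_sub n hu]
  exact integral_norm_cellAverage_le n (integrable_comp_add_right_sub hu _)

end CellAverage

/-! ### Perimeter of boxes -/

lemma mem_rect_update {a b : Fin d → ℝ} {i : Fin d} {l r : ℝ} {x : E d} :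
    x ∈ rect (Function.update a i l) (Function.update b i r)
      ↔ (l ≤ x i ∧ x i ≤ r) ∧ ∀ j ≠ i, a j ≤ x j ∧ x j ≤ b j := by
  refine ⟨fun hx => ⟨by simpa using hx i, fun j hj => by simpa [hj] using hx j⟩,
    fun ⟨hxi, hx⟩ j => ?_⟩
  obtain rfl | hj := eq_or_ne j i
  · simpa using hxi
  · simpa [hj] using hx j hj

lemma mem_rect_iff_of_coord {a b : Fin d → ℝ} (i : Fin d) {x : E d} :
    x ∈ rect a b ↔ (a i ≤ x i ∧ x i ≤ b i) ∧ ∀ j ≠ i, a j ≤ x j ∧ x j ≤ b j := by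
  simpa using mem_rect_update (a := a) (b := b) (i := i) (l := a i) (r := b i) (x := x)

lemma norm_indicator_rect_add_sub_le (a b : Fin d → ℝ) (i : Fin d) {t : ℝ} (ht : 0 ≤ t) (x : E d) :
    ‖(rect a b).indicator (fun _ => (1 : ℝ)) (x + t • unitVec i)
        - (rect a b).indicator (fun _ => 1) x‖
      ≤ (rect (Function.update a i (a i - t)) (Function.update b i (a i))).indicator (fun _ => 1) x
        + (rect (Function.update a i (b i - t)) (Function.update b i (b i))).indicator
          (fun _ => 1) x := by
  have mem_add_iff : x + t • unitVec i ∈ rect a b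
      ↔ (a i - t ≤ x i ∧ x i ≤ b i - t) ∧ ∀ j ≠ i, a j ≤ x j ∧ x j ≤ b j := by
    rw [mem_rect_iff_of_coord i]
    refine and_congr (by simp [le_sub_iff_add_le]) (forall₂_congr fun j hj => by simp [hj])
  classical
  simp only [Set.indicator_apply, mem_add_iff, mem_rect_update,
    mem_rect_iff_of_coord (a := a) (b := b) i (x := x)]
  by_cases hQ : ∀ j ≠ i, a j ≤ x j ∧ x j ≤ b j
  · simp only [eq_true hQ, and_true]
    split_ifs <;> norm_num <;> grind
  · simp [hQ]

lemma integrable_indicator_rect (a b : Fin d → ℝ) :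
    Integrable ((rect a b).indicator fun _ => (1 : ℝ)) :=
  (integrable_indicator_iff (measurableSet_rect a b)).2
    (integrableOn_const (isBounded_rect _ _).measure_lt_top.ne)

lemma volume_real_rect_update_le {a b : Fin d → ℝ} (hab : ∀ i, b i - a i ≤ 1) (i : Fin d)
    {t : ℝ} (ht : 0 ≤ t) (c : ℝ) :
    volume.real (rect (Function.update a i (c - t)) (Function.update b i c)) ≤ t := by
  refine ENNReal.toReal_le_of_le_ofReal ht ?_
  rw [volume_rect, ← Finset.mul_prod_erase _ _ (Finset.mem_univ i)]
  refine (mul_le_of_le_one_right' (Finset.prod_le_one' fun j hj => ?_)).trans (by simp)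
  simpa [Finset.ne_of_mem_erase hj] using hab j

lemma translationModulus_indicator_rect_le {a b : Fin d → ℝ} (hab : ∀ i, b i - a i ≤ 1)
    (i : Fin d) {t : ℝ} (ht : 0 ≤ t) :
    translationModulus ((rect a b).indicator fun _ => (1 : ℝ)) (t • unitVec i) ≤ 2 * t := by
  have integral_eq (a b : Fin d → ℝ) :
      ∫ x, (rect a b).indicator (fun _ => (1 : ℝ)) x = volume.real (rect a b) := by
    simp [integral_indicator_const _ (measurableSet_rect a b)]
  refine (integral_mono_of_nonneg (ae_of_all _ fun _ => norm_nonneg _)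
    ((integrable_indicator_rect _ _).add (integrable_indicator_rect _ _))
    (ae_of_all _ (norm_indicator_rect_add_sub_le a b i ht))).trans ?_
  simp only [Pi.add_apply]
  rw [integral_add (integrable_indicator_rect _ _) (integrable_indicator_rect _ _),
    integral_eq, integral_eq, two_mul]
  exact add_le_add (volume_real_rect_update_le hab i ht _) (volume_real_rect_update_le hab i ht _)

lemma perimeter_rect_le {a b : Fin d → ℝ} (hab : ∀ i, b i - a i ≤ 1) :
    perimeter (rect a b) ≤ ENNReal.ofReal (d * 2) := by
  refine (variation_le_of_translationModulus_le (integrable_indicator_rect a b) (C := fun _ => 2)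
    fun i => Eventually.frequently ?_).trans_eq (by simp)
  filter_upwards [self_mem_nhdsWithin] with t ht
  exact translationModulus_indicator_rect_le hab i (Set.mem_Ioi.1 ht).le

lemma rect_subset_cube {a b : Fin d → ℝ} (ha : ∀ i, 0 ≤ a i) (hb : ∀ i, b i ≤ 1) :
    rect a b ⊆ cube d := fun _ hx i => ⟨(ha i).trans (hx i).1, (hx i).2.trans (hb i)⟩

lemma isBVSet_rect {a b : Fin d → ℝ} (ha : ∀ i, 0 ≤ a i) (hb : ∀ i, b i ≤ 1) :
    IsBVSet (rect a b) :=
  ⟨rect_subset_cube ha hb, (measurableSet_rect a b).nullMeasurableSet,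
    (perimeter_rect_le fun i => by linarith [ha i, hb i]).trans_lt ENNReal.ofReal_lt_top⟩

/-! ### Elements of `BV` -/

namespace BV

lemma ae_eq_zero (u : BV d) : ∀ᵐ x, x ∉ cube d → u x = 0 :=
  (show toL1 u ∈ bvSubmodule d from Subtype.property (p := (· ∈ bvSubmodule d)) u).1

lemma norm_toL1 (u : BV d) : ‖toL1 u‖ = ∫ x, |u x| := L1.norm_eq_integral_norm _

lemma norm_toL1_le (u : BV d) : ‖toL1 u‖ ≤ ‖u‖ := by
  rw [norm_def]
  exact le_add_of_nonneg_right ENNReal.toReal_nonneg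

lemma variation_le_norm (u : BV d) : (variation (u : E d → ℝ)).toReal ≤ ‖u‖ := by
  rw [norm_def]
  exact le_add_of_nonneg_left (norm_nonneg _)

lemma ext_ae {u w : BV d} (h : (u : E d → ℝ) =ᵐ[volume] w) : u = w :=
  Subtype.ext (Lp.ext h)

lemma coe_zero : ((0 : BV d) : E d → ℝ) =ᵐ[volume] fun _ => 0 := by
  rw [map_zero]
  exact Lp.coeFn_zero _ _ _

lemma coe_sum {ι : Type*} (s : Finset ι) (u : ι → BV d) :
    ((∑ i ∈ s, u i : BV d) : E d → ℝ) =ᵐ[volume] fun x => ∑ i ∈ s, u i x := by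
  classical
  induction s using Finset.induction_on with
  | empty => simpa using coe_zero
  | insert i s hi ih =>
    rw [Finset.sum_insert hi]
    filter_upwards [coe_add (u i) (∑ i ∈ s, u i), ih] with x hadd hsum
    rw [hadd, hsum, Finset.sum_insert hi]

lemma indicator_cube_ae_eq (u : BV d) :
    (cube d).indicator (u : E d → ℝ) =ᵐ[volume] (u : E d → ℝ) := by
  filter_upwards [u.ae_eq_zero] with x hx
  rw [Set.indicator_apply_eq_self]
  exact hx

lemma hasCompactSupport_indicator_cube (u : BV d) :
    HasCompactSupport ((cube d).indicator (u : E d → ℝ)) :=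
  .intro' (isBounded_rect _ _).isCompact_closure isClosed_closure fun _ hx =>
    Set.indicator_of_notMem (fun h => hx (subset_closure h)) _

lemma translationModulus_smul_unitVec_le (u : BV d) (i : Fin d) (t : ℝ) :
    translationModulus u (t • unitVec i) ≤ |t| * (variation (u : E d → ℝ)).toReal := by
  have hu := u.indicator_cube_ae_eq
  rw [← translationModulus_congr hu, ← variation_congr hu]
  exact StrongCharge.translationModulus_smul_unitVec_le (u.integrable.congr hu.symm)
    u.hasCompactSupport_indicator_cube ((variation_congr hu).trans_lt u.variation_lt_top) i t

lemma translationModulus_latVec_le (u : BV d) (n : ℕ) {v : Fin d → ℤ} (hv : ∀ i, |v i| ≤ 1) :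
    translationModulus u (latVec n v) ≤ d * ((2 ^ n)⁻¹ * (variation (u : E d → ℝ)).toReal) := by
  have latVec_eq_sum : latVec n v = ∑ i, ((v i : ℝ) / 2 ^ n) • unitVec i := by
    ext j
    simp [latVec, Finset.sum_apply, Pi.single_apply]
  rw [latVec_eq_sum]
  calc translationModulus u (∑ i, ((v i : ℝ) / 2 ^ n) • unitVec i)
      ≤ ∑ i, translationModulus u (((v i : ℝ) / 2 ^ n) • unitVec i) :=
        translationModulus_sum_le u.integrable _ _
    _ ≤ ∑ _i : Fin d, (2 ^ n)⁻¹ * (variation (u : E d → ℝ)).toReal := by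
        refine Finset.sum_le_sum fun i _ => (u.translationModulus_smul_unitVec_le i _).trans ?_
        gcongr
        rw [abs_div, abs_of_pos (by positivity : (0 : ℝ) < 2 ^ n), div_eq_mul_inv]
        exact mul_le_of_le_one_left (by positivity) (by exact_mod_cast hv i)
    _ = d * ((2 ^ n)⁻¹ * (variation (u : E d → ℝ)).toReal) := by simp

end BV

open Classical in
/-- The indicator function of `B` as an element of `BV`, with the junk value `0` when `B` is not a
`BV`-set. -/
def indBV (B : Set (E d)) : BV d := if h : IsBVSet B then h.indicatorBV else 0

lemma indBV_eq {B : Set (E d)} (hB : IsBVSet B) : indBV B = hB.indicatorBV := dif_pos hB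

lemma coe_indBV {B : Set (E d)} (hB : IsBVSet B) :
    (indBV B : E d → ℝ) =ᵐ[volume] B.indicator fun _ => (1 : ℝ) := by
  rw [indBV_eq hB]
  exact hB.integrable_indicator.coeFn_toL1

lemma norm_toL1_indBV {B : Set (E d)} (hB : IsBVSet B) :
    ‖BV.toL1 (indBV B)‖ = volume.real B := by
  rw [BV.norm_toL1, integral_congr_ae (g := B.indicator fun _ => (1 : ℝ))]
  · rw [integral_indicator₀ hB.2.1]
    simp
  · filter_upwards [coe_indBV hB] with x hx
    rw [hx]
    exact abs_of_nonneg (Set.indicator_nonneg (fun _ _ => zero_le_one) x)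

/-! ### Indicator functions of dyadic cubes -/

lemma T_apply (g : E d → ℝ) (hg : Measurable g) (hb : ∃ C, ∀ x, ‖g x‖ ≤ C) (u : BV d) :
    T g hg hb u = ∫ x, g x * u x := by
  change ∫ x in cube d, g x * u x = _
  refine setIntegral_eq_integral_of_ae_compl_eq_zero ?_
  filter_upwards [u.ae_eq_zero] with x hx h
  rw [hx h, mul_zero]

lemma abs_T_le {g : E d → ℝ} (hg : Measurable g) {C : ℝ} (hC : ∀ x, ‖g x‖ ≤ C) (u : BV d) :
    |T g hg ⟨C, hC⟩ u| ≤ C * ‖BV.toL1 u‖ := by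
  rw [T_apply, BV.norm_toL1, ← integral_const_mul, ← Real.norm_eq_abs]
  refine norm_integral_le_of_norm_le (u.integrable.abs.const_mul C) (ae_of_all _ fun x => ?_)
  rw [norm_mul]
  exact mul_le_mul_of_nonneg_right (hC x) (norm_nonneg _)

lemma norm_indicator_one_le (B : Set (E d)) (x : E d) :
    ‖B.indicator (fun _ => (1 : ℝ)) x‖ ≤ 1 :=
  (norm_indicator_le_norm_self _ _).trans (by simp)

lemma dyadicLo_nonneg (n : ℕ) (m : Fin d → ℕ) (i : Fin d) : 0 ≤ dyadicLo n m i := by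
  unfold dyadicLo
  positivity

lemma dyadicHi_le_one {n : ℕ} {m : Fin d → ℕ} (hm : ∀ i, m i < 2 ^ n) (i : Fin d) :
    dyadicHi n m i ≤ 1 := by
  unfold dyadicHi
  rw [div_le_one (by positivity)]
  exact_mod_cast hm i

/-- At most one term of the sum is nonzero: the one indexed by the cell of `x`. -/
lemma sum_indicator_cell {M : Type*} [AddCommMonoid M] (n : ℕ) (p q : Fin d → ℕ)
    (F : (Fin d → ℤ) → M) (x : E d) :
    ∑ m ∈ Fintype.piFinset fun i => Finset.Ico (p i) (q i),
        (cell n fun i => (m i : ℤ)).indicator (fun _ => F fun i => m i) x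
      = {y | ∀ i, cellIndex n y i ∈ Finset.Ico (p i : ℤ) (q i)}.indicator
        (fun y => F (cellIndex n y)) x := by
  by_cases hx : ∀ i, cellIndex n x i ∈ Finset.Ico (p i : ℤ) (q i)
  · have cast_toNat : (fun i => ((cellIndex n x i).toNat : ℤ)) = cellIndex n x :=
      funext fun i => Int.toNat_of_nonneg (by have := Finset.mem_Ico.1 (hx i); omega)
    rw [Set.indicator_of_mem (by exact hx), Finset.sum_eq_single fun i => (cellIndex n x i).toNat]
    · rw [cast_toNat, Set.indicator_of_mem (mem_cell.2 rfl)]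
    · refine fun m _ hm => Set.indicator_of_notMem (fun hxm => hm (funext fun i => ?_)) _
      simp [mem_cell.1 hxm]
    · refine fun hm => absurd (Fintype.mem_piFinset.2 fun i => ?_) hm
      have := Finset.mem_Ico.1 (hx i)
      rw [Finset.mem_Ico]
      omega
  · rw [Set.indicator_of_notMem (by exact hx)]
    refine Finset.sum_eq_zero fun m hm => Set.indicator_of_notMem (fun hxm => hx fun i => ?_) _
    have := Finset.mem_Ico.1 (Fintype.mem_piFinset.1 hm i)
    simp only [mem_cell.1 hxm, Finset.mem_Ico]
    omega

namespace DyadicNumbering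

variable (K : DyadicNumbering d)

lemma measurableSet_set (n k : ℕ) : MeasurableSet (K.set n k) := measurableSet_rect _ _

lemma isBVSet_set {n k : ℕ} (hk : k < 2 ^ (n * d)) : IsBVSet (K.set n k) :=
  isBVSet_rect (dyadicLo_nonneg n _) (dyadicHi_le_one (K.corner_lt hk))

lemma set_ae_eq_cell (n k : ℕ) :
    K.set n k =ᵐ[volume] cell n fun i => (K.corner n k i : ℤ) := rect_ae_eq_cell n _

lemma volume_set (n k : ℕ) : volume (K.set n k) = ENNReal.ofReal (2 ^ (n * d))⁻¹ :=
  volume_rect_dyadic n _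

lemma volume_real_set (n k : ℕ) : volume.real (K.set n k) = (2 ^ (n * d))⁻¹ := by
  rw [Measure.real, volume_set, ENNReal.toReal_ofReal (by positivity)]

lemma set_zero : K.set 0 0 = cube d := by
  rw [DyadicNumbering.set, K.corner_zero, cube]
  congr 1 <;> funext i <;> simp [dyadicLo, dyadicHi]

lemma sum_indicator_child {n k : ℕ} (hk : k < 2 ^ (n * d)) :
    (fun x => ∑ l ∈ Finset.range (2 ^ d),
      (K.set (n + 1) (2 ^ d * k + l)).indicator (fun _ => (1 : ℝ)) x)
      =ᵐ[volume] (K.set n k).indicator fun _ => (1 : ℝ) := by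
  have child_eq : ∀ᵐ x, ∀ l, (K.set (n + 1) (2 ^ d * k + l)).indicator (fun _ => (1 : ℝ)) x
      = (cell (n + 1) fun i => (K.corner (n + 1) (2 ^ d * k + l) i : ℤ)).indicator
        (fun _ => (1 : ℝ)) x :=
    ae_all_iff.2 fun l => indicator_ae_eq_of_ae_eq_set (K.set_ae_eq_cell _ _)
  have children_eq_parent : {y : E d | ∀ i, cellIndex (n + 1) y i
      ∈ Finset.Ico ((2 * K.corner n k i : ℕ) : ℤ) ((2 * (K.corner n k i + 1) : ℕ) : ℤ)}
      = cell n fun i => (K.corner n k i : ℤ) := by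
    ext y
    rw [mem_cell, funext_iff]
    refine forall_congr' fun i => ?_
    rw [Finset.mem_Ico, ← cellIndex_succ_div n y i]
    omega
  filter_upwards [child_eq,
    indicator_ae_eq_of_ae_eq_set (f := fun _ => (1 : ℝ)) (K.set_ae_eq_cell n k)] with x hchild hset
  rw [hset, Finset.sum_congr rfl fun l _ => hchild l,
    K.sum_child (fun m => (cell (n + 1) fun i => (m i : ℤ)).indicator (fun _ => (1 : ℝ)) x) hk,
    sum_indicator_cell (n + 1) _ _ (fun _ => (1 : ℝ)) x, children_eq_parent]

lemma dyadicAdditive_setIntegral {φ : E d → ℝ} (hφ : Integrable φ) :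
    DyadicAdditive d fun n k => ∫ x in K.set n k, φ x := fun n k hk => by
  simp only [← integral_indicator (K.measurableSet_set _ _)]
  rw [← integral_finsetSum _ fun l _ => hφ.indicator (K.measurableSet_set _ _)]
  refine integral_congr_ae ?_
  filter_upwards [K.sum_indicator_child hk] with x hx
  have indicator_eq (B : Set (E d)) : B.indicator φ x = B.indicator (fun _ => 1) x * φ x := by
    by_cases h : x ∈ B <;> simp [h]
  simp only [indicator_eq, ← hx, Finset.sum_mul]

/-- The functional `T_g` for the indicator function `g` of the cube `K_{n,k}`. -/
def cubeT (n k : ℕ) : BV d →L[ℝ] ℝ :=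
  T ((K.set n k).indicator fun _ => (1 : ℝ))
    (measurable_const.indicator (K.measurableSet_set n k)) ⟨1, norm_indicator_one_le _⟩

lemma cubeT_apply (n k : ℕ) (u : BV d) : K.cubeT n k u = ∫ x in K.set n k, u x := by
  rw [cubeT, T_apply, ← integral_indicator (K.measurableSet_set n k)]
  congr 1 with x
  by_cases h : x ∈ K.set n k <;> simp [h]

lemma dyadicAdditive_cubeT_apply (u : BV d) : DyadicAdditive d fun n k => K.cubeT n k u := by
  simp only [cubeT_apply]
  exact K.dyadicAdditive_setIntegral u.integrable

/-- The indicator function of the cube `K_{n,k}` as an element of `BV`. -/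
def cubeBV (n k : ℕ) : BV d := indBV (K.set n k)

lemma dyadicAdditive_cubeBV : DyadicAdditive d K.cubeBV := fun n k hk => by
  refine BV.ext_ae ?_
  have coe_child : ∀ᵐ x, ∀ l, l < 2 ^ d → K.cubeBV (n + 1) (2 ^ d * k + l) x
      = (K.set (n + 1) (2 ^ d * k + l)).indicator (fun _ => (1 : ℝ)) x :=
    ae_all_iff.2 fun l => eventually_imp_distrib_left.2 fun hl =>
      coe_indBV (K.isBVSet_set (child_lt hk hl))
  filter_upwards [BV.coe_sum (Finset.range (2 ^ d)) fun l => K.cubeBV (n + 1) (2 ^ d * k + l),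
    coe_child, K.sum_indicator_child hk, coe_indBV (K.isBVSet_set hk)]
    with x hsum hchild hindicator hparent
  rw [hsum, cubeBV, hparent, ← hindicator]
  exact Finset.sum_congr rfl fun l hl => hchild l (Finset.mem_range.1 hl)

lemma faberSchauder_apply (j : ℕ) (u : BV d) :
    (faberSchauder K j : BV d →L[ℝ] ℝ) u = haarCoefSeq d (fun n k => K.cubeT n k u) j := by
  change T (haarSeq K j) (measurable_haarSeq K j) (bounded_haarSeq K j) u = _
  rw [T_apply]
  cases j with
  | zero =>
    change _ = K.cubeT 0 0 u
    rw [cubeT, T_apply, K.set_zero]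
    rfl
  | succ j =>
    have integrable_indicator_mul (B : Set (E d)) (hB : MeasurableSet B) :
        Integrable fun x => B.indicator (fun _ => (1 : ℝ)) x * u x :=
      u.integrable.bdd_mul (measurable_const.indicator hB).aestronglyMeasurable
        (ae_of_all _ (norm_indicator_one_le B))
    simp only [haarCoefSeq, haarCoef, cubeT, T_apply, haarSeq, haar,
      smul_eq_mul, mul_assoc, Finset.sum_mul, ← integral_const_mul]
    rw [← integral_finsetSum _ fun l _ =>
      (integrable_indicator_mul _ (K.measurableSet_set _ _)).const_mul _, ← integral_const_mul]

end DyadicNumbering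

/-! ### Averaging operators on `BV` -/

/-- The elements of `BV` that are a.e. constant on each cell of generation `n`. -/
def gridBV (d n : ℕ) : Submodule ℝ (BV d) where
  carrier := {u | ∃ w : E d → ℝ, w.FactorsThrough (cellIndex n) ∧ (u : E d → ℝ) =ᵐ[volume] w}
  zero_mem' := ⟨fun _ => 0, fun _ _ _ => rfl, BV.coe_zero⟩
  add_mem' := by
    rintro u v ⟨w, hw, hu⟩ ⟨w', hw', hv⟩
    refine ⟨fun x => w x + w' x, fun x y hxy => by simp only [hw hxy, hw' hxy], ?_⟩
    filter_upwards [BV.coe_add u v, hu, hv] with x hadd hux hvx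
    rw [hadd, hux, hvx]
  smul_mem' := by
    rintro c u ⟨w, hw, hu⟩
    refine ⟨fun x => c * w x, fun x y hxy => by simp only [hw hxy], ?_⟩
    filter_upwards [BV.coe_smul c u, hu] with x hsmul hux
    rw [hsmul, hux]

lemma variation_le_of_mem_gridBV {n : ℕ} {u : BV d} (hu : u ∈ gridBV d n) :
    (variation (u : E d → ℝ)).toReal
      ≤ ∑ i : Fin d, 2 ^ n * translationModulus u (((2 : ℝ) ^ n)⁻¹ • unitVec i) := by
  obtain ⟨w, hw, huw⟩ := hu
  rw [variation_congr huw]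
  simp only [translationModulus_congr huw]
  exact ENNReal.toReal_le_of_le_ofReal (Finset.sum_nonneg fun i _ =>
    mul_nonneg (by positivity) (translationModulus_nonneg _ _))
    (variation_le_of_factorsThrough_cellIndex hw (u.integrable.congr huw))

lemma variation_le_norm_toL1 {n : ℕ} {u : BV d} (hu : u ∈ gridBV d n) :
    (variation (u : E d → ℝ)).toReal ≤ d * (2 ^ n * (2 * ‖BV.toL1 u‖)) := by
  calc (variation (u : E d → ℝ)).toReal
      ≤ ∑ i : Fin d, 2 ^ n * translationModulus u (((2 : ℝ) ^ n)⁻¹ • unitVec i) :=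
        variation_le_of_mem_gridBV hu
    _ ≤ ∑ _i : Fin d, 2 ^ n * (2 * ‖BV.toL1 u‖) := by
        rw [BV.norm_toL1]
        gcongr
        exact translationModulus_le_two_mul u.integrable _
    _ = d * (2 ^ n * (2 * ‖BV.toL1 u‖)) := by simp

lemma cellAverage_eq_zero (u : BV d) {n : ℕ} {x : E d}
    (hx : ¬ ∀ i, cellIndex n x i ∈ Finset.Ico 0 (2 ^ n)) : cellAverage n u x = 0 := by
  have ne_one : ∀ᵐ y : E d, ∀ i, y i ≠ 1 := ae_all_iff.2 fun i => ae_coord_ne i 1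
  rw [cellAverage, setIntegral_eq_zero_of_ae_eq_zero, smul_zero]
  filter_upwards [ne_one, u.ae_eq_zero] with y hy hu hyc
  refine hu fun hcube => hx fun i => ?_
  have lt_one : y i < 1 := lt_of_le_of_ne (hcube i).2 (hy i)
  have nonneg : 0 ≤ y i := (hcube i).1
  rw [← mem_cell.1 hyc, Finset.mem_Ico]
  refine ⟨Int.floor_nonneg.2 (by positivity), Int.floor_lt.2 ?_⟩
  push_cast
  exact mul_lt_of_lt_one_right (by positivity) lt_one

namespace DyadicNumbering

variable (K : DyadicNumbering d)

lemma cubeBV_mem_gridBV {n k : ℕ} (hk : k < 2 ^ (n * d)) : K.cubeBV n k ∈ gridBV d n := by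
  classical
  refine ⟨(cell n fun i => (K.corner n k i : ℤ)).indicator fun _ => 1, fun x y h => ?_, ?_⟩
  · simp only [Set.indicator_apply, mem_cell, h]
  · exact (coe_indBV (K.isBVSet_set hk)).trans
      (indicator_ae_eq_of_ae_eq_set (K.set_ae_eq_cell n k))

/-- The conditional expectation of `u` with respect to the dyadic cubes of generation `n`, as an
element of `BV`. -/
def bvAverage (n : ℕ) (u : BV d) : BV d :=
  ∑ k ∈ Finset.range (2 ^ (n * d)), (2 ^ (n * d) * K.cubeT n k u) • K.cubeBV n k

lemma coe_bvAverage (n : ℕ) (u : BV d) :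
    (K.bvAverage n u : E d → ℝ) =ᵐ[volume] cellAverage n u := by
  have coe_term : ∀ᵐ x, ∀ k, k < 2 ^ (n * d) →
      ((2 ^ (n * d) * K.cubeT n k u) • K.cubeBV n k : BV d) x
      = (cell n fun i => (K.corner n k i : ℤ)).indicator
        (fun _ => (2 : ℝ) ^ (n * d) • ∫ y in cell n fun i => (K.corner n k i : ℤ), u y) x := by
    refine ae_all_iff.2 fun k => eventually_imp_distrib_left.2 fun hk => ?_
    filter_upwards [BV.coe_smul (2 ^ (n * d) * K.cubeT n k u) (K.cubeBV n k),
      coe_indBV (K.isBVSet_set hk),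
      indicator_ae_eq_of_ae_eq_set (f := fun _ => (1 : ℝ)) (K.set_ae_eq_cell n k)]
      with x hsmul hcube hcell
    rw [hsmul, cubeBV, hcube, hcell, cubeT_apply, setIntegral_congr_set (K.set_ae_eq_cell n k)]
    by_cases hx : x ∈ cell n fun i => (K.corner n k i : ℤ) <;> simp [hx]
  filter_upwards [BV.coe_sum (Finset.range (2 ^ (n * d)))
    fun k => (2 ^ (n * d) * K.cubeT n k u) • K.cubeBV n k, coe_term] with x hsum hterm
  rw [bvAverage, hsum, Finset.sum_congr rfl fun k hk => hterm k (Finset.mem_range.1 hk),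
    K.sum_corner (fun m => (cell n fun i => (m i : ℤ)).indicator
      (fun _ => (2 : ℝ) ^ (n * d) • ∫ y in cell n fun i => (m i : ℤ), u y) x)]
  simp only [Finset.range_eq_Ico]
  rw [sum_indicator_cell n _ _ (fun m => (2 : ℝ) ^ (n * d) • ∫ y in cell n m, u y) x]
  exact Set.indicator_apply_eq_self.2 fun hx => cellAverage_eq_zero u (by simpa using hx)

lemma bvAverage_mem_gridBV (n : ℕ) (u : BV d) : K.bvAverage n u ∈ gridBV d n :=
  ⟨_, factorsThrough_cellAverage n u, K.coe_bvAverage n u⟩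

lemma norm_toL1_bvAverage_le (n : ℕ) (u : BV d) : ‖BV.toL1 (K.bvAverage n u)‖ ≤ ‖u‖ := by
  refine le_trans ?_ u.norm_toL1_le
  rw [BV.norm_toL1, BV.norm_toL1]
  calc ∫ x, |K.bvAverage n u x| = ∫ x, |cellAverage n u x| :=
        integral_congr_ae ((K.coe_bvAverage n u).fun_comp abs)
    _ ≤ ∫ x, |u x| := integral_norm_cellAverage_le n u.integrable

lemma variation_bvAverage_le (n : ℕ) (u : BV d) :
    (variation (K.bvAverage n u : E d → ℝ)).toReal ≤ d * ‖u‖ := by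
  have translationModulus_le (i : Fin d) :
      translationModulus (K.bvAverage n u) (((2 : ℝ) ^ n)⁻¹ • unitVec i) ≤ (2 ^ n)⁻¹ * ‖u‖ := by
    have latVec_eq : ((2 : ℝ) ^ n)⁻¹ • (unitVec i : E d) = latVec n (Pi.single i 1) := by
      simp [latVec_single]
    calc translationModulus (K.bvAverage n u) (((2 : ℝ) ^ n)⁻¹ • unitVec i)
        = translationModulus (cellAverage n u) (((2 : ℝ) ^ n)⁻¹ • unitVec i) :=
          translationModulus_congr (K.coe_bvAverage n u) _
      _ ≤ translationModulus u (((2 : ℝ) ^ n)⁻¹ • unitVec i) := by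
          rw [latVec_eq]
          exact translationModulus_cellAverage_le n u.integrable _
      _ ≤ |((2 : ℝ) ^ n)⁻¹| * (variation (u : E d → ℝ)).toReal :=
          u.translationModulus_smul_unitVec_le i _
      _ ≤ (2 ^ n)⁻¹ * ‖u‖ := by
          rw [abs_of_pos (by positivity)]
          gcongr
          exact u.variation_le_norm
  calc (variation (K.bvAverage n u : E d → ℝ)).toReal
      ≤ ∑ i : Fin d, 2 ^ n * translationModulus (K.bvAverage n u) (((2 : ℝ) ^ n)⁻¹ • unitVec i) :=
        variation_le_of_mem_gridBV (K.bvAverage_mem_gridBV n u)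
    _ ≤ ∑ _i : Fin d, 2 ^ n * ((2 ^ n)⁻¹ * ‖u‖) := by
        gcongr with i
        exact translationModulus_le i
    _ = d * ‖u‖ := by simp

lemma norm_bvAverage_le (n : ℕ) (u : BV d) : ‖K.bvAverage n u‖ ≤ (1 + d) * ‖u‖ := by
  rw [BV.norm_def, one_add_mul]
  exact add_le_add (K.norm_toL1_bvAverage_le n u) (K.variation_bvAverage_le n u)

end DyadicNumbering

/-! ### Partial sums of Haar series -/

/-- The total variation of `u` between each cell of generation `n` and its neighbours: the integral
of `neighbourDiff n u` over a cell bounds the difference of the integrals of `u` over this cell and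
over any adjacent one. -/
def neighbourDiff (n : ℕ) (u : E d → ℝ) (x : E d) : ℝ :=
  ∑ v ∈ Fintype.piFinset fun _ : Fin d => Finset.Icc (-1 : ℤ) 1, |u (x + latVec n v) - u x|

lemma neighbourDiff_nonneg (n : ℕ) (u : E d → ℝ) (x : E d) : 0 ≤ neighbourDiff n u x :=
  Finset.sum_nonneg fun _ _ => abs_nonneg _

lemma integrable_neighbourDiff (n : ℕ) {u : E d → ℝ} (hu : Integrable u) :
    Integrable (neighbourDiff n u) :=
  integrable_finsetSum _ fun v _ => (integrable_comp_add_right_sub hu (latVec n v)).abs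

lemma integral_neighbourDiff_le (n : ℕ) (u : BV d) :
    ∫ x, neighbourDiff n u x ≤ 3 ^ d * (d * ((2 ^ n)⁻¹ * ‖u‖)) := by
  calc ∫ x, neighbourDiff n u x
      = ∑ v ∈ Fintype.piFinset fun _ : Fin d => Finset.Icc (-1 : ℤ) 1,
          translationModulus u (latVec n v) := by
        simp only [neighbourDiff, translationModulus, Real.norm_eq_abs]
        exact integral_finsetSum _ fun v _ =>
          (integrable_comp_add_right_sub u.integrable (latVec n v)).abs
    _ ≤ ∑ _v ∈ Fintype.piFinset fun _ : Fin d => Finset.Icc (-1 : ℤ) 1,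
          d * ((2 ^ n)⁻¹ * ‖u‖) := by
        gcongr with v hv
        have abs_le_one (i : Fin d) : |v i| ≤ 1 :=
          abs_le.2 (Finset.mem_Icc.1 (Fintype.mem_piFinset.1 hv i))
        refine (u.translationModulus_latVec_le n abs_le_one).trans ?_
        gcongr
        exact u.variation_le_norm
    _ = 3 ^ d * (d * ((2 ^ n)⁻¹ * ‖u‖)) := by simp [Fintype.card_piFinset]

lemma abs_setIntegral_cell_add_sub_le (n : ℕ) {u : E d → ℝ} (hu : Integrable u) (m : Fin d → ℤ)
    {v : Fin d → ℤ} (hv : ∀ i, |v i| ≤ 1) :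
    |(∫ x in cell n (m + v), u x) - ∫ x in cell n m, u x|
      ≤ ∫ x in cell n m, neighbourDiff n u x := by
  rw [setIntegral_cell_add,
    ← integral_sub (hu.comp_add_right _).integrableOn hu.integrableOn]
  refine abs_integral_le_integral_abs.trans ?_
  refine setIntegral_mono (integrable_comp_add_right_sub hu _).abs.integrableOn
    (integrable_neighbourDiff n hu).integrableOn fun x => ?_
  refine Finset.single_le_sum (f := fun v => |u (x + latVec n v) - u x|)
    (fun v _ => abs_nonneg _) ?_
  simpa only [Fintype.mem_piFinset, Finset.mem_Icc] using fun i => abs_le.1 (hv i)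

namespace DyadicNumbering

variable (K : DyadicNumbering d)

/-- The partial sum of order `N` of the Haar series of `u`. -/
def haarSum (N : ℕ) (u : BV d) : BV d :=
  ∑ j ∈ Finset.range N, haarCoefSeq d (fun n k => K.cubeT n k u) j • haarCoefSeq d K.cubeBV j

lemma haarSum_two_pow (n : ℕ) (u : BV d) : K.haarSum (2 ^ (n * d)) u = K.bvAverage n u :=
  sum_haarCoefSeq_smul_haarCoefSeq (K.dyadicAdditive_cubeT_apply u) K.dyadicAdditive_cubeBV n

lemma haarSum_sub_bvAverage {n N : ℕ} (hN : 2 ^ (n * d) ≤ N) (u : BV d) :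
    K.haarSum N u - K.bvAverage n u = ∑ j ∈ Finset.Ico (2 ^ (n * d)) N,
      haarCoefSeq d (fun n k => K.cubeT n k u) j • haarCoefSeq d K.cubeBV j := by
  rw [← K.haarSum_two_pow, haarSum, haarSum, Finset.sum_Ico_eq_sub _ hN]

lemma abs_cubeT_child_sub_le {n k l : ℕ} (hk : k < 2 ^ (n * d)) (hl : l < 2 ^ d) (u : BV d) :
    |K.cubeT (n + 1) (2 ^ d * k + l) u - K.cubeT (n + 1) (2 ^ d * k) u|
      ≤ ∫ x in K.set (n + 1) (2 ^ d * k), neighbourDiff (n + 1) u x := by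
  let m (l : ℕ) (i : Fin d) : ℤ := K.corner (n + 1) (2 ^ d * k + l) i
  have abs_sub_le_one (i : Fin d) : |(m l - m 0) i| ≤ 1 := by
    have hchild := K.subcube n k l hk hl i
    have hchild_zero := K.subcube n k 0 hk (by positivity) i
    simp only [Pi.sub_apply, m]
    rw [abs_le]
    omega
  have cubeT_eq (l : ℕ) :
      K.cubeT (n + 1) (2 ^ d * k + l) u = ∫ x in cell (n + 1) (m l), u x := by
    rw [cubeT_apply, setIntegral_congr_set (K.set_ae_eq_cell _ _)]
  have := abs_setIntegral_cell_add_sub_le (n + 1) u.integrable (m 0) abs_sub_le_one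
  rwa [add_sub_cancel, ← cubeT_eq l, ← cubeT_eq 0,
    ← setIntegral_congr_set (K.set_ae_eq_cell (n + 1) (2 ^ d * k + 0))] at this

lemma norm_toL1_haarCoef_cubeBV_le {n k : ℕ} (hk : k < 2 ^ (n * d)) (r : ℕ) :
    ‖BV.toL1 (haarCoef d K.cubeBV n k r)‖
      ≤ (2 : ℝ) ^ ((n * d : ℝ) / 2) * (2 ^ d * (2 ^ ((n + 1) * d))⁻¹) := by
  have toL1_haarCoef : BV.toL1 (haarCoef d K.cubeBV n k r)
      = haarCoef d (fun n k => BV.toL1 (K.cubeBV n k)) n k r := by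
    simp [haarCoef, map_sum]
  rw [toL1_haarCoef]
  refine norm_haarCoef_le (fun l hl => ?_) r
  rw [cubeBV, norm_toL1_indBV (K.isBVSet_set (child_lt hk hl)), volume_real_set]

lemma norm_toL1_haarCoef_smul_haarCoef_le {n k r : ℕ} (hk : k < 2 ^ (n * d)) (hr : r < 2 ^ d)
    (hr0 : r ≠ 0) (u : BV d) :
    ‖BV.toL1 (haarCoef d (fun n k => K.cubeT n k u) n k r • haarCoef d K.cubeBV n k r)‖
      ≤ 2 ^ d * ∫ x in K.set (n + 1) (2 ^ d * k), neighbourDiff (n + 1) u x := by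
  set δ := ∫ x in K.set (n + 1) (2 ^ d * k), neighbourDiff (n + 1) u x
  have δ_nonneg : 0 ≤ δ := integral_nonneg (neighbourDiff_nonneg _ _)
  rw [map_smul, norm_smul]
  calc ‖haarCoef d (fun n k => K.cubeT n k u) n k r‖ * ‖BV.toL1 (haarCoef d K.cubeBV n k r)‖
      ≤ ((2 : ℝ) ^ ((n * d : ℝ) / 2) * (2 ^ d * δ))
        * ((2 : ℝ) ^ ((n * d : ℝ) / 2) * (2 ^ d * (2 ^ ((n + 1) * d))⁻¹)) := by
        gcongr
        · exact norm_haarCoef_le_of_norm_sub_le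
            (fun l hl => K.abs_cubeT_child_sub_le hk hl u) hr hr0
        · exact K.norm_toL1_haarCoef_cubeBV_le hk r
    _ = 2 ^ d * δ := by
        rw [mul_mul_mul_comm, two_rpow_half_mul_self, add_one_mul, pow_add]
        field_simp

lemma sum_setIntegral_child_le {φ : E d → ℝ} (hφ : Integrable φ) (h0 : ∀ x, 0 ≤ φ x) (n : ℕ) :
    ∑ k ∈ Finset.range (2 ^ (n * d)), ∫ x in K.set (n + 1) (2 ^ d * k), φ x ≤ ∫ x, φ x := by
  have additive := K.dyadicAdditive_setIntegral hφ
  calc ∑ k ∈ Finset.range (2 ^ (n * d)), ∫ x in K.set (n + 1) (2 ^ d * k), φ x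
      ≤ ∑ k ∈ Finset.range (2 ^ (n * d)), ∫ x in K.set n k, φ x := by
        refine Finset.sum_le_sum fun k hk => ?_
        refine le_of_le_of_eq ?_ (additive n k (Finset.mem_range.1 hk))
        exact Finset.single_le_sum (f := fun l => ∫ x in K.set (n + 1) (2 ^ d * k + l), φ x)
          (fun l _ => integral_nonneg h0) (Finset.mem_range.2 (by positivity : 0 < 2 ^ d))
    _ = ∫ x in K.set 0 0, φ x := additive.sum_eq n
    _ ≤ ∫ x, φ x := setIntegral_le_integral hφ (ae_of_all _ h0)

lemma norm_toL1_haarSum_sub_le {n N : ℕ} (hnN : 2 ^ (n * d) ≤ N)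
    (hNn : N ≤ 2 ^ ((n + 1) * d)) (u : BV d) :
    ‖BV.toL1 (K.haarSum N u - K.bvAverage n u)‖ ≤ 12 ^ d * d * ((2 ^ (n + 1))⁻¹ * ‖u‖) := by
  let term (j : ℕ) : BV d :=
    haarCoefSeq d (fun n k => K.cubeT n k u) j • haarCoefSeq d K.cubeBV j
  let δ (k : ℕ) : ℝ := ∫ x in K.set (n + 1) (2 ^ d * k), neighbourDiff (n + 1) u x
  have δ_nonneg (k : ℕ) : 0 ≤ δ k := integral_nonneg (neighbourDiff_nonneg _ _)
  have norm_term_le {k r : ℕ} (hk : k < 2 ^ (n * d)) (hr : r < 2 ^ d - 1) :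
      ‖BV.toL1 (term (2 ^ (n * d) + (2 ^ d - 1) * k + r))‖ ≤ 2 ^ d * δ k := by
    simp only [term, haarCoefSeq_eq_haarCoef _ hk hr]
    exact K.norm_toL1_haarCoef_smul_haarCoef_le hk (by omega) r.succ_ne_zero u
  calc ‖BV.toL1 (K.haarSum N u - K.bvAverage n u)‖
      ≤ ∑ j ∈ Finset.Ico (2 ^ (n * d)) N, ‖BV.toL1 (term j)‖ := by
        rw [K.haarSum_sub_bvAverage hnN, map_sum]
        exact norm_sum_le _ _
    _ ≤ ∑ j ∈ Finset.Ico (2 ^ (n * d)) (2 ^ ((n + 1) * d)), ‖BV.toL1 (term j)‖ :=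
        Finset.sum_le_sum_of_subset_of_nonneg (Finset.Ico_subset_Ico_right hNn)
          fun _ _ _ => norm_nonneg _
    _ = ∑ k ∈ Finset.range (2 ^ (n * d)), ∑ r ∈ Finset.range (2 ^ d - 1),
          ‖BV.toL1 (term (2 ^ (n * d) + (2 ^ d - 1) * k + r))‖ := by
        rw [Finset.sum_Ico_eq_sub _ (hnN.trans hNn), two_pow_succ_mul, sum_range_add_mul,
          add_sub_cancel_left]
    _ ≤ ∑ k ∈ Finset.range (2 ^ (n * d)), ∑ _r ∈ Finset.range (2 ^ d), 2 ^ d * δ k := by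
        refine Finset.sum_le_sum fun k hk => ?_
        refine (Finset.sum_le_sum fun r hr =>
          norm_term_le (Finset.mem_range.1 hk) (Finset.mem_range.1 hr)).trans ?_
        exact Finset.sum_le_sum_of_subset_of_nonneg (Finset.range_mono (Nat.sub_le _ _))
          fun _ _ _ => mul_nonneg (by positivity) (δ_nonneg k)
    _ = 4 ^ d * ∑ k ∈ Finset.range (2 ^ (n * d)), δ k := by
        simp only [Finset.sum_const, Finset.card_range, nsmul_eq_mul, ← mul_assoc,
          Finset.mul_sum, Nat.cast_pow, Nat.cast_ofNat, ← mul_pow]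
        norm_num
    _ ≤ 4 ^ d * (3 ^ d * (d * ((2 ^ (n + 1))⁻¹ * ‖u‖))) := by
        gcongr
        exact (K.sum_setIntegral_child_le (integrable_neighbourDiff _ u.integrable)
          (neighbourDiff_nonneg _ _) n).trans (integral_neighbourDiff_le _ u)
    _ = 12 ^ d * d * ((2 ^ (n + 1))⁻¹ * ‖u‖) := by
        rw [show (12 : ℝ) = 4 * 3 by norm_num, mul_pow]
        ring

lemma haarSum_sub_mem_gridBV (hd : 1 ≤ d) {n N : ℕ} (hnN : 2 ^ (n * d) ≤ N)
    (hNn : N ≤ 2 ^ ((n + 1) * d)) (u : BV d) :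
    K.haarSum N u - K.bvAverage n u ∈ gridBV d (n + 1) := by
  rw [K.haarSum_sub_bvAverage hnN]
  refine Submodule.sum_mem _ fun j hj => Submodule.smul_mem _ _ ?_
  obtain ⟨hnj, hjN⟩ := Finset.mem_Ico.1 hj
  obtain ⟨i, rfl⟩ : ∃ i, j = i + 1 :=
    Nat.exists_eq_succ_of_ne_zero ((by positivity : 0 < 2 ^ (n * d)).trans_le hnj).ne'
  have hk := cubeNo_lt hd i.succ_ne_zero
  rw [haarCoefSeq, genNo_eq hnj (hjN.trans_le hNn)] at *
  exact haarCoef_mem hk (fun k hk => K.cubeBV_mem_gridBV hk) _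

lemma norm_haarSum_sub_bvAverage_le (hd : 1 ≤ d) {n N : ℕ} (hnN : 2 ^ (n * d) ≤ N)
    (hNn : N ≤ 2 ^ ((n + 1) * d)) (u : BV d) :
    ‖K.haarSum N u - K.bvAverage n u‖ ≤ 12 ^ d * d * (1 + 2 * d) * ‖u‖ := by
  set w := K.haarSum N u - K.bvAverage n u
  have norm_toL1_le : ‖BV.toL1 w‖ ≤ 12 ^ d * d * ((2 ^ (n + 1))⁻¹ * ‖u‖) :=
    K.norm_toL1_haarSum_sub_le hnN hNn u
  have variation_le : (variation (w : E d → ℝ)).toReal ≤ 12 ^ d * d * (2 * d) * ‖u‖ := by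
    calc (variation (w : E d → ℝ)).toReal ≤ d * (2 ^ (n + 1) * (2 * ‖BV.toL1 w‖)) :=
          variation_le_norm_toL1 (K.haarSum_sub_mem_gridBV hd hnN hNn u)
      _ ≤ d * (2 ^ (n + 1) * (2 * (12 ^ d * d * ((2 ^ (n + 1))⁻¹ * ‖u‖)))) := by gcongr
      _ = 12 ^ d * d * (2 * d) * ‖u‖ := by field_simp
  calc ‖w‖ = ‖BV.toL1 w‖ + (variation (w : E d → ℝ)).toReal := BV.norm_def w
    _ ≤ 12 ^ d * d * ‖u‖ + 12 ^ d * d * (2 * d) * ‖u‖ := by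
        refine add_le_add (norm_toL1_le.trans ?_) variation_le
        gcongr
        exact mul_le_of_le_one_left (norm_nonneg _)
          (inv_le_one_of_one_le₀ (one_le_pow₀ one_le_two))
    _ = 12 ^ d * d * (1 + 2 * d) * ‖u‖ := by ring

theorem exists_norm_haarSum_le (hd : 1 ≤ d) :
    ∃ C : ℝ, 0 ≤ C ∧ ∀ N (u : BV d), ‖K.haarSum N u‖ ≤ C * ‖u‖ := by
  refine ⟨(1 + d) + 12 ^ d * d * (1 + 2 * d), by positivity, fun N u => ?_⟩
  rcases eq_or_ne N 0 with rfl | hN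
  · simp only [haarSum, Finset.range_zero, Finset.sum_empty, norm_zero]
    positivity
  let n := genNo d N
  calc ‖K.haarSum N u‖ = ‖K.bvAverage n u + (K.haarSum N u - K.bvAverage n u)‖ := by
        rw [add_sub_cancel]
    _ ≤ ‖K.bvAverage n u‖ + ‖K.haarSum N u - K.bvAverage n u‖ := norm_add_le _ _
    _ ≤ (1 + d) * ‖u‖ + 12 ^ d * d * (1 + 2 * d) * ‖u‖ :=
        add_le_add (K.norm_bvAverage_le n u) (K.norm_haarSum_sub_bvAverage_le hd
          (two_pow_genNo_mul_le hN) (lt_two_pow_genNo_succ_mul hd N).le u)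
    _ = ((1 + d) + 12 ^ d * d * (1 + 2 * d)) * ‖u‖ := by ring

end DyadicNumbering

/-! ### Approximation of strong charge functionals -/

/-- The functional `T_h` for a compactly supported continuous function `h`. These functionals are
dense in `SCH`. -/
def contT (h : C_c(E d, ℝ)) : BV d →L[ℝ] ℝ :=
  T h h.continuous.measurable (h.continuous.bounded_above_of_compact_support h.hasCompactSupport)

lemma integrable_cont_mul (h : C_c(E d, ℝ)) (u : BV d) : Integrable fun x => h x * u x :=
  let ⟨_, hB⟩ := h.continuous.bounded_above_of_compact_support h.hasCompactSupport
  u.integrable.bdd_mul h.continuous.aestronglyMeasurable (ae_of_all _ hB)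

lemma exists_abs_contT_le (h : C_c(E d, ℝ)) :
    ∃ B : ℝ, 0 ≤ B ∧ ∀ u : BV d, |contT h u| ≤ B * ‖BV.toL1 u‖ :=
  let ⟨B, hB⟩ := h.continuous.bounded_above_of_compact_support h.hasCompactSupport
  ⟨B, (norm_nonneg _).trans (hB 0), abs_T_le h.continuous.measurable hB⟩

lemma BV.exists_eLpNorm_le (hd : 1 ≤ d) :
    ∃ (p : ℝ≥0∞) (C : NNReal), ENNReal.HolderTriple d p 1 ∧ ∀ u : BV d,
      eLpNorm (u : E d → ℝ) p volume ≤ C * ENNReal.ofReal ‖u‖ := by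
  obtain ⟨p, C, hp, hC⟩ := exists_eLpNorm_le_variation hd
  refine ⟨p, C, hp, fun u => ?_⟩
  have indicator_ae_eq := u.indicator_cube_ae_eq
  calc eLpNorm (u : E d → ℝ) p volume
      = eLpNorm ((cube d).indicator (u : E d → ℝ)) p volume :=
        (eLpNorm_congr_ae indicator_ae_eq).symm
    _ ≤ C * variation ((cube d).indicator (u : E d → ℝ)) :=
        hC _ (u.integrable.congr indicator_ae_eq.symm) u.hasCompactSupport_indicator_cube
    _ = C * variation (u : E d → ℝ) := by rw [variation_congr indicator_ae_eq]
    _ ≤ C * ENNReal.ofReal ‖u‖ := by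
        gcongr
        rw [← ENNReal.ofReal_toReal u.variation_lt_top.ne]
        exact ENNReal.ofReal_le_ofReal u.variation_le_norm

lemma exists_abs_setIntegral_mul_le (hd : 1 ≤ d) :
    ∃ C : ℝ, 0 ≤ C ∧ ∀ (g : E d → ℝ) (δ : ℝ), 0 ≤ δ →
      AEStronglyMeasurable g (volume.restrict (cube d)) →
      eLpNorm g d (volume.restrict (cube d)) ≤ ENNReal.ofReal δ →
      ∀ u : BV d, |∫ x in cube d, g x * u x| ≤ C * δ * ‖u‖ := by
  obtain ⟨p, C, hp, hC⟩ := BV.exists_eLpNorm_le hd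
  refine ⟨C, NNReal.coe_nonneg C, fun g δ hδ hg hgδ u => ?_⟩
  rw [← Real.norm_eq_abs, ← toReal_enorm]
  refine ENNReal.toReal_le_of_le_ofReal (by positivity) ?_
  calc ‖∫ x in cube d, g x * u x‖ₑ
      ≤ eLpNorm (g • (u : E d → ℝ)) 1 (volume.restrict (cube d)) := by
        rw [eLpNorm_one_eq_lintegral_enorm]
        exact enorm_integral_le_lintegral_enorm _
    _ ≤ eLpNorm g d (volume.restrict (cube d))
          * eLpNorm (u : E d → ℝ) p (volume.restrict (cube d)) :=
        eLpNorm_smul_le_mul_eLpNorm u.integrable.aestronglyMeasurable.restrict hg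
    _ ≤ ENNReal.ofReal δ * (C * ENNReal.ofReal ‖u‖) := by
        gcongr
        exact (eLpNorm_mono_measure _ Measure.restrict_le_self).trans (hC u)
    _ = ENNReal.ofReal (C * δ * ‖u‖) := by
        rw [ENNReal.ofReal_mul (by positivity), ENNReal.ofReal_mul (NNReal.coe_nonneg C),
          ENNReal.ofReal_coe_nnreal]
        ring

lemma rangeT_subset_closure_range_contT (hd : 1 ≤ d) :
    (rangeT d : Set (BV d →L[ℝ] ℝ)) ⊆ closure (Set.range contT) := by
  rintro α ⟨g, hg, hgα⟩
  obtain ⟨C, hC0, hC⟩ := exists_abs_setIntegral_mul_le hd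
  refine Metric.mem_closure_range_iff.2 fun ε hε => ?_
  have hδ : 0 < ε / (C + 1) := by positivity
  obtain ⟨h, hs, hle, hc, -⟩ := hg.exists_hasCompactSupport_eLpNorm_sub_le (by simp)
    (ENNReal.ofReal_pos.2 hδ).ne'
  refine ⟨⟨⟨h, hc⟩, hs⟩, ?_⟩
  set h' : C_c(E d, ℝ) := ⟨⟨h, hc⟩, hs⟩
  calc dist α (contT h') = ‖α - contT h'‖ := dist_eq_norm _ _
    _ ≤ C * (ε / (C + 1)) :=
        ContinuousLinearMap.opNorm_le_bound _ (by positivity) fun u => ?_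
    _ < ε := by
        rw [← mul_div_assoc, div_lt_iff₀ (by positivity)]
        linarith
  have apply_sub : (α - contT h') u = ∫ x in cube d, (g - h') x * u x := by
    simp only [Pi.sub_apply, sub_mul]
    rw [integral_sub (hgα u).1 (integrable_cont_mul h' u).restrict, ← (hgα u).2]
    rfl
  rw [apply_sub, Real.norm_eq_abs]
  exact hC _ _ hδ.le (hg.1.sub hc.aestronglyMeasurable) hle u

theorem SCH_subset_closure_range_contT (hd : 1 ≤ d) :
    (SCH d : Set (BV d →L[ℝ] ℝ)) ⊆ closure (Set.range contT) :=
  closure_minimal (rangeT_subset_closure_range_contT hd) isClosed_closure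

theorem tendsto_of_mem_SCH (hd : 1 ≤ d) {α : BV d →L[ℝ] ℝ} (hα : α ∈ SCH d) {u : ℕ → BV d}
    {v : BV d} {M : ℝ} (hM : ∀ n, ‖u n‖ ≤ M)
    (hu : Tendsto (fun n => ‖BV.toL1 (u n - v)‖) atTop (𝓝 0)) :
    Tendsto (fun n => α (u n)) atTop (𝓝 (α v)) := by
  have equicontinuous_apply : Equicontinuous fun n (β : BV d →L[ℝ] ℝ) => β (u n) := by
    refine (LipschitzWith.uniformEquicontinuous _ M.toNNReal fun n => ?_).equicontinuous
    refine LipschitzWith.of_dist_le' fun β γ => ?_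
    rw [dist_eq_norm, dist_eq_norm, ← sub_apply, mul_comm]
    exact (β - γ).le_opNorm_of_le (hM n)
  have continuous_apply : Continuous fun β : BV d →L[ℝ] ℝ => β v :=
    continuous_id.clm_apply continuous_const
  refine (equicontinuous_apply α).tendsto_of_mem_closure continuous_apply.continuousWithinAt ?_
    (SCH_subset_closure_range_contT hd hα)
  rintro _ ⟨h, rfl⟩
  obtain ⟨B, -, hB⟩ := exists_abs_contT_le h
  refine tendsto_iff_norm_sub_tendsto_zero.2 (squeeze_zero (fun _ => norm_nonneg _)
    (fun n => ?_) (by simpa using hu.const_mul B))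
  rw [← map_sub]
  exact hB _

/-! ### Convergence of Haar series -/

lemma norm_le_sum_abs (x : E d) : ‖x‖ ≤ ∑ i, |x i| := by
  have sum_smul_unitVec : ∑ i, x i • unitVec i = x := by
    ext j
    simp [Finset.sum_apply, Pi.single_apply]
  calc ‖x‖ = ‖∑ i, x i • unitVec i‖ := by rw [sum_smul_unitVec]
    _ ≤ ∑ i, ‖x i • unitVec i‖ := norm_sum_le _ _
    _ = ∑ i, |x i| := by simp [norm_smul]

lemma tendsto_genNo_atTop (hd : 1 ≤ d) : Tendsto (genNo d) atTop atTop :=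
  tendsto_atTop.2 fun n => (eventually_ge_atTop ((2 ^ d) ^ n)).mono fun _ =>
    Nat.le_log_of_pow_le (Nat.one_lt_two_pow (by omega))

namespace DyadicNumbering

variable (K : DyadicNumbering d)

lemma dist_le_of_mem_set {n k : ℕ} {x y : E d} (hx : x ∈ K.set n k) (hy : y ∈ K.set n k) :
    dist x y ≤ d * (2 ^ n)⁻¹ := by
  rw [dist_eq_norm]
  refine (norm_le_sum_abs _).trans ?_
  calc ∑ i, |(x - y) i| ≤ ∑ _i : Fin d, ((2 : ℝ) ^ n)⁻¹ := by
        refine Finset.sum_le_sum fun i _ => ?_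
        have hxi := hx i
        have hyi := hy i
        have side_length :
            dyadicHi n (K.corner n k) i - dyadicLo n (K.corner n k) i = (2 ^ n)⁻¹ := by
          simp only [dyadicHi, dyadicLo]
          ring
        rw [PiLp.sub_apply, abs_le]
        constructor <;> linarith
    _ = d * (2 ^ n)⁻¹ := by simp

lemma contT_cubeBV (h : C_c(E d, ℝ)) {n k : ℕ} (hk : k < 2 ^ (n * d)) :
    contT h (K.cubeBV n k) = ∫ x in K.set n k, h x := by
  rw [contT, T_apply, ← integral_indicator (K.measurableSet_set n k)]
  refine integral_congr_ae ?_
  filter_upwards [coe_indBV (K.isBVSet_set hk)] with x hx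
  rw [cubeBV, hx]
  by_cases hxk : x ∈ K.set n k <;> simp [hxk]

lemma abs_two_pow_mul_setIntegral_sub_le {h : E d → ℝ} {n k : ℕ} (hh : IntegrableOn h (K.set n k))
    {c ε : ℝ} (hε : ∀ y ∈ K.set n k, |h y - c| ≤ ε) :
    |2 ^ (n * d) * (∫ y in K.set n k, h y) - c| ≤ ε := by
  have average_eq : ⨍ y in K.set n k, h y = 2 ^ (n * d) * ∫ y in K.set n k, h y := by
    rw [setAverage_eq, K.volume_real_set, inv_inv, smul_eq_mul]
  rw [← average_eq, ← Real.dist_eq, ← Metric.mem_closedBall]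
  refine (convex_closedBall c ε).set_average_mem Metric.isClosed_closedBall ?_ ?_ ?_ hh
  · rw [K.volume_set]
    exact (ENNReal.ofReal_pos.2 (by positivity)).ne'
  · exact (isBounded_rect _ _).measure_lt_top.ne
  · exact (ae_restrict_iff' (K.measurableSet_set n k)).2 (ae_of_all _ hε)

lemma abs_mean_mul_sub_le (h : C_c(E d, ℝ)) {n k : ℕ} {ε : ℝ}
    (hε : ∀ x ∈ K.set n k, ∀ y ∈ K.set n k, |h x - h y| ≤ ε) (u : BV d) :
    |2 ^ (n * d) * K.cubeT n k u * (∫ x in K.set n k, h x) - ∫ x in K.set n k, h x * u x|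
      ≤ ε * ∫ x in K.set n k, |u x| := by
  set mean : ℝ := 2 ^ (n * d) * ∫ x in K.set n k, h x
  have mean_mul_sub : 2 ^ (n * d) * K.cubeT n k u * (∫ x in K.set n k, h x)
      - ∫ x in K.set n k, h x * u x = ∫ x in K.set n k, (mean - h x) * u x := by
    simp only [sub_mul]
    rw [integral_sub (u.integrable.integrableOn.const_mul mean)
      (integrable_cont_mul h u).integrableOn, integral_const_mul, cubeT_apply]
    ring
  rw [mean_mul_sub, ← integral_const_mul, ← Real.norm_eq_abs]
  refine norm_integral_le_of_norm_le (u.integrable.integrableOn.abs.const_mul ε)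
    ((ae_restrict_iff' (K.measurableSet_set n k)).2 (ae_of_all _ fun x hx => ?_))
  rw [norm_mul]
  refine mul_le_mul_of_nonneg_right ?_ (norm_nonneg _)
  exact K.abs_two_pow_mul_setIntegral_sub_le
    (h.continuous.integrable_of_hasCompactSupport h.hasCompactSupport).integrableOn
    fun y hy => hε y hy x hx

lemma abs_contT_bvAverage_sub_le (h : C_c(E d, ℝ)) {n : ℕ} {ε : ℝ} (hε0 : 0 ≤ ε)
    (hε : ∀ x y, dist x y ≤ d * (2 ^ n)⁻¹ → |h x - h y| ≤ ε) (u : BV d) :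
    |contT h (K.bvAverage n u) - contT h u| ≤ ε * ‖u‖ := by
  have contT_bvAverage : contT h (K.bvAverage n u) = ∑ k ∈ Finset.range (2 ^ (n * d)),
      2 ^ (n * d) * K.cubeT n k u * (∫ x in K.set n k, h x) := by
    rw [bvAverage, map_sum]
    refine Finset.sum_congr rfl fun k hk => ?_
    rw [map_smul, K.contT_cubeBV _ (Finset.mem_range.1 hk), smul_eq_mul]
  have contT_eq_sum :
      contT h u = ∑ k ∈ Finset.range (2 ^ (n * d)), ∫ x in K.set n k, h x * u x := by
    rw [(K.dyadicAdditive_setIntegral (integrable_cont_mul h u)).sum_eq n, K.set_zero]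
    rfl
  rw [contT_bvAverage, contT_eq_sum, ← Finset.sum_sub_distrib]
  calc |∑ k ∈ Finset.range (2 ^ (n * d)), (2 ^ (n * d) * K.cubeT n k u *
          (∫ x in K.set n k, h x) - ∫ x in K.set n k, h x * u x)|
      ≤ ∑ k ∈ Finset.range (2 ^ (n * d)), ε * ∫ x in K.set n k, |u x| :=
        (Finset.abs_sum_le_sum_abs _ _).trans <| Finset.sum_le_sum fun k _ =>
          K.abs_mean_mul_sub_le h (fun x hx y hy => hε x y (K.dist_le_of_mem_set hx hy)) u
    _ = ε * ∫ x in K.set 0 0, |u x| := by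
        rw [← Finset.mul_sum, (K.dyadicAdditive_setIntegral u.integrable.abs).sum_eq n]
    _ ≤ ε * ∫ x, |u x| := mul_le_mul_of_nonneg_left
        (setIntegral_le_integral u.integrable.abs (ae_of_all _ fun _ => abs_nonneg _)) hε0
    _ ≤ ε * ‖u‖ := by
        rw [← BV.norm_toL1]
        exact mul_le_mul_of_nonneg_left u.norm_toL1_le hε0

lemma eventually_abs_contT_bvAverage_sub_le (h : C_c(E d, ℝ)) {ε : ℝ} (hε : 0 < ε) :
    ∀ᶠ n in atTop, ∀ u : BV d, |contT h (K.bvAverage n u) - contT h u| ≤ ε * ‖u‖ := by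
  obtain ⟨δ, hδ, dist_lt⟩ := Metric.uniformContinuous_iff.1
    (h.hasCompactSupport.uniformContinuous_of_continuous h.continuous) ε hε
  have tendsto_diam : Tendsto (fun n : ℕ => d * ((2 : ℝ) ^ n)⁻¹) atTop (𝓝 0) := by
    simpa using (tendsto_inv_atTop_zero.comp
      (tendsto_pow_atTop_atTop_of_one_lt (one_lt_two (α := ℝ)))).const_mul (d : ℝ)
  filter_upwards [tendsto_diam.eventually (gt_mem_nhds hδ)] with n hn u
  exact K.abs_contT_bvAverage_sub_le h hε.le (fun x y hxy => (dist_lt (hxy.trans_lt hn)).le) u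

lemma eventually_abs_contT_haarSum_sub_bvAverage_le (h : C_c(E d, ℝ)) {ε : ℝ} (hε : 0 < ε) :
    ∀ᶠ n in atTop, ∀ N, 2 ^ (n * d) ≤ N → N ≤ 2 ^ ((n + 1) * d) → ∀ u : BV d,
      |contT h (K.haarSum N u - K.bvAverage n u)| ≤ ε * ‖u‖ := by
  obtain ⟨B, hB0, hB⟩ := exists_abs_contT_le h
  have tendsto_zero :
      Tendsto (fun n : ℕ => B * (12 ^ d * d) * ((2 : ℝ) ^ (n + 1))⁻¹) atTop (𝓝 0) := by
    simpa using ((tendsto_inv_atTop_zero.comp (tendsto_pow_atTop_atTop_of_one_lt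
      (one_lt_two (α := ℝ)))).comp (tendsto_add_atTop_nat 1)).const_mul (B * (12 ^ d * d))
  filter_upwards [tendsto_zero.eventually (gt_mem_nhds hε)] with n hn N hnN hNn u
  calc |contT h (K.haarSum N u - K.bvAverage n u)|
      ≤ B * ‖BV.toL1 (K.haarSum N u - K.bvAverage n u)‖ := hB _
    _ ≤ B * (12 ^ d * d * ((2 ^ (n + 1))⁻¹ * ‖u‖)) :=
        mul_le_mul_of_nonneg_left (K.norm_toL1_haarSum_sub_le hnN hNn u) hB0
    _ = (B * (12 ^ d * d) * (2 ^ (n + 1))⁻¹) * ‖u‖ := by ring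
    _ ≤ ε * ‖u‖ := mul_le_mul_of_nonneg_right hn.le (norm_nonneg _)

lemma eventually_abs_contT_haarSum_sub_le (hd : 1 ≤ d) (h : C_c(E d, ℝ)) {ε : ℝ} (hε : 0 < ε) :
    ∀ᶠ N in atTop, ∀ u : BV d, |contT h (K.haarSum N u) - contT h u| ≤ ε * ‖u‖ := by
  filter_upwards [eventually_ne_atTop 0, (tendsto_genNo_atTop hd).eventually
      (K.eventually_abs_contT_bvAverage_sub_le h (half_pos hε)),
    (tendsto_genNo_atTop hd).eventually
      (K.eventually_abs_contT_haarSum_sub_bvAverage_le h (half_pos hε))]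
    with N hN average_le haarSum_sub_le u
  have haarSum_sub_le := haarSum_sub_le N (two_pow_genNo_mul_le hN)
    (lt_two_pow_genNo_succ_mul hd N).le u
  rw [map_sub] at haarSum_sub_le
  linarith [abs_sub_le (contT h (K.haarSum N u)) (contT h (K.bvAverage (genNo d N) u)) (contT h u),
    average_le u]

/-- The partial sum of order `N` of the Faber–Schauder series attached to the functional `α`: the
coefficients are the values of `α` on the Haar functions. -/
def faberSchauderSum (N : ℕ) (α : BV d →L[ℝ] ℝ) : BV d →L[ℝ] ℝ :=
  ∑ j ∈ Finset.range N, α (haarCoefSeq d K.cubeBV j) • (faberSchauder K j : BV d →L[ℝ] ℝ)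

lemma faberSchauderSum_apply (N : ℕ) (α : BV d →L[ℝ] ℝ) (u : BV d) :
    K.faberSchauderSum N α u = α (K.haarSum N u) := by
  simp only [faberSchauderSum, haarSum, sum_apply, smul_apply, K.faberSchauder_apply, map_sum,
    map_smul, smul_eq_mul]
  exact Finset.sum_congr rfl fun j _ => mul_comm _ _

lemma equicontinuous_faberSchauderSum (hd : 1 ≤ d) : Equicontinuous K.faberSchauderSum := by
  obtain ⟨C, hC0, hC⟩ := K.exists_norm_haarSum_le hd
  refine (LipschitzWith.uniformEquicontinuous _ C.toNNReal fun N => ?_).equicontinuous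
  refine LipschitzWith.of_dist_le' fun α β => ?_
  rw [dist_eq_norm, dist_eq_norm]
  refine ContinuousLinearMap.opNorm_le_bound _ (by positivity) fun u => ?_
  rw [sub_apply, faberSchauderSum_apply, faberSchauderSum_apply, ← sub_apply]
  calc ‖(α - β) (K.haarSum N u)‖ ≤ ‖α - β‖ * (C * ‖u‖) := (α - β).le_opNorm_of_le (hC N u)
    _ = C * ‖α - β‖ * ‖u‖ := by ring

lemma tendsto_faberSchauderSum_contT (hd : 1 ≤ d) (h : C_c(E d, ℝ)) :
    Tendsto (fun N => K.faberSchauderSum N (contT h)) atTop (𝓝 (contT h)) := by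
  refine Metric.tendsto_nhds.2 fun ε hε => ?_
  filter_upwards [K.eventually_abs_contT_haarSum_sub_le hd h (half_pos hε)] with N hN
  refine lt_of_le_of_lt ?_ (half_lt_self hε)
  rw [dist_eq_norm]
  refine ContinuousLinearMap.opNorm_le_bound _ (half_pos hε).le fun u => ?_
  rw [sub_apply, faberSchauderSum_apply]
  exact hN u

theorem tendsto_faberSchauderSum (hd : 1 ≤ d) {α : BV d →L[ℝ] ℝ} (hα : α ∈ SCH d) :
    Tendsto (fun N => K.faberSchauderSum N α) atTop (𝓝 α) := by
  refine (K.equicontinuous_faberSchauderSum hd α).tendsto_of_mem_closure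
    continuousWithinAt_id ?_ (SCH_subset_closure_range_contT hd hα)
  rintro _ ⟨h, rfl⟩
  exact K.tendsto_faberSchauderSum_contT hd h

/-! ### Strongly chargeable functions have convergent series -/

lemma isRectBounds {n k : ℕ} (hk : k < 2 ^ (n * d)) :
    IsRectBounds (dyadicLo n (K.corner n k)) (dyadicHi n (K.corner n k)) := fun i => by
  refine ⟨dyadicLo_nonneg n _ i, ?_, dyadicHi_le_one (K.corner_lt hk) i⟩
  unfold dyadicLo dyadicHi
  gcongr
  exact lt_add_one _

lemma lamSeq_eq_apply_of_eqOn_rect (hd : 1 ≤ d) {f : E d → ℝ} {α : BV d →L[ℝ] ℝ}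
    (hα : ∀ a b, IsRectBounds a b → α (indBV (rect a b)) = rectIncrement f a b) (j : ℕ) :
    lamSeq K f j = α (haarCoefSeq d K.cubeBV j) :=
  calc lamSeq K f j = haarCoefSeq d (K.increment f) j := lamSeq_eq_haarCoefSeq K f j
    _ = haarCoefSeq d (fun n k => α (K.cubeBV n k)) j :=
        haarCoefSeq_congr hd (fun _ _ hk => (hα _ _ (K.isRectBounds hk)).symm) j
    _ = α (haarCoefSeq d K.cubeBV j) := (map_haarCoefSeq (α : BV d →ₗ[ℝ] ℝ) K.cubeBV j).symm

end DyadicNumbering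

theorem seriesConverges_of_stronglyChargeable (hd : 1 ≤ d) (K : DyadicNumbering d) {f : E d → ℝ}
    (hf : StronglyChargeable f) :
    SeriesConverges fun j => lamSeq K f j • faberSchauder K j := by
  obtain ⟨μ, ⟨-, α, hα, hμ⟩, hrect, -⟩ := hf
  have apply_rect (a b : Fin d → ℝ) (hab : IsRectBounds a b) :
      α (indBV (rect a b)) = rectIncrement f a b := by
    have hBV := isBVSet_rect (fun i => (hab i).1) fun i => (hab i).2.2
    rw [indBV_eq hBV, ← hμ, hrect a b hab]
  refine ⟨⟨α, hα⟩, tendsto_subtype_rng.2 ?_⟩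
  simpa only [DyadicNumbering.faberSchauderSum, Submodule.coe_sum, Submodule.coe_smul,
    K.lamSeq_eq_apply_of_eqOn_rect hd apply_rect] using K.tendsto_faberSchauderSum hd hα

/-! ### The strong charge of a strong charge functional -/

lemma integrable_indicator_of_subset_cube {B : Set (E d)} (hB : B ⊆ cube d)
    (hm : NullMeasurableSet B) : Integrable (B.indicator fun _ => (1 : ℝ)) :=
  have finite_volume : volume B ≠ ∞ := ((measure_mono hB).trans_lt (volume_cube_lt_top d)).ne
  (integrableOn_const finite_volume).integrable_indicator₀ hm

lemma indicator_union_ae_eq {B₁ B₂ : Set (E d)} (h : volume (B₁ ∩ B₂) = 0) :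
    (B₁ ∪ B₂).indicator (fun _ => (1 : ℝ)) =ᵐ[volume]
      fun x => B₁.indicator (fun _ => (1 : ℝ)) x + B₂.indicator (fun _ => (1 : ℝ)) x := by
  filter_upwards [measure_eq_zero_iff_ae_notMem.1 h] with x hx
  exact Set.indicator_union_of_notMem_inter hx _

lemma IsBVSet.union {B₁ B₂ : Set (E d)} (h₁ : IsBVSet B₁) (h₂ : IsBVSet B₂)
    (h : volume (B₁ ∩ B₂) = 0) : IsBVSet (B₁ ∪ B₂) := by
  refine ⟨Set.union_subset h₁.1 h₂.1, h₁.2.1.union h₂.2.1, ?_⟩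
  rw [perimeter, variation_congr (indicator_union_ae_eq h)]
  exact (variation_add_le h₁.integrable_indicator h₂.integrable_indicator).trans_lt
    (ENNReal.add_lt_top.2 ⟨h₁.2.2, h₂.2.2⟩)

lemma indBV_union {B₁ B₂ : Set (E d)} (h₁ : IsBVSet B₁) (h₂ : IsBVSet B₂)
    (h : volume (B₁ ∩ B₂) = 0) : indBV (B₁ ∪ B₂) = indBV B₁ + indBV B₂ := by
  refine BV.ext_ae ?_
  filter_upwards [coe_indBV (h₁.union h₂ h), coe_indBV h₁, coe_indBV h₂,
    BV.coe_add (indBV B₁) (indBV B₂), indicator_union_ae_eq h]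
    with x coe_union coe₁ coe₂ coe_add indicator_union
  rw [coe_union, coe_add, coe₁, coe₂, indicator_union]

lemma norm_indBV_le {B : Set (E d)} (hB : IsBVSet B) :
    ‖indBV B‖ ≤ volume.real (cube d) + (perimeter B).toReal := by
  rw [BV.norm_def, norm_toL1_indBV hB, variation_congr (coe_indBV hB)]
  exact add_le_add (measureReal_mono hB.1 (volume_cube_lt_top d).ne) le_rfl

lemma norm_toL1_indBV_sub {A B : Set (E d)} (hA : IsBVSet A) (hB : IsBVSet B) :
    ‖BV.toL1 (indBV A - indBV B)‖ = volume.real (symmDiff A B) := by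
  have null_symmDiff : NullMeasurableSet (symmDiff A B) :=
    (hA.2.1.diff hB.2.1).union (hB.2.1.diff hA.2.1)
  rw [map_sub, L1.norm_eq_integral_norm,
    integral_congr_ae (g := (symmDiff A B).indicator fun _ => (1 : ℝ))]
  · rw [integral_indicator₀ null_symmDiff]
    simp
  · filter_upwards [coe_indBV hA, coe_indBV hB,
      Lp.coeFn_sub (BV.toL1 (indBV A)) (BV.toL1 (indBV B))] with x coe_A coe_B coe_sub
    rw [coe_sub, Pi.sub_apply, coe_A, coe_B]
    by_cases hxA : x ∈ A <;> by_cases hxB : x ∈ B <;> simp [Set.mem_symmDiff, hxA, hxB]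

theorem isStrongCharge_of_mem_SCH (hd : 1 ≤ d) {α : BV d →L[ℝ] ℝ} (hα : α ∈ SCH d) :
    IsStrongCharge fun B => α (indBV B) := by
  refine ⟨⟨fun B₁ B₂ h₁ h₂ h => ?_, fun B B' hB hB' hconv => ?_⟩, α, hα, fun B hB => ?_⟩
  · simp only [indBV_union h₁ h₂ h, map_add]
  · refine tendsto_of_mem_SCH hd hα
      (M := volume.real (cube d) + (⨆ n, perimeter (B n)).toReal) (fun n => ?_) ?_
    · refine (norm_indBV_le (hB n)).trans ?_
      gcongr
      · exact hconv.1.ne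
      · exact le_iSup (fun n => perimeter (B n)) n
    · simp only [norm_toL1_indBV_sub (hB _) hB']
      exact (ENNReal.tendsto_toReal ENNReal.zero_ne_top).comp hconv.2
  · simp only [indBV_eq hB]

/-! ### Figures -/

lemma norm_indicator_biUnion_sub_le {ι α : Type*} (s : Finset ι) (A : ι → Set α) (x y : α) :
    ‖(⋃ p ∈ s, A p).indicator (fun _ => (1 : ℝ)) y - (⋃ p ∈ s, A p).indicator (fun _ => 1) x‖
      ≤ ∑ p ∈ s, ‖(A p).indicator (fun _ => (1 : ℝ)) y - (A p).indicator (fun _ => 1) x‖ := by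
  have one_le_sum {x y : α} (hy : y ∈ ⋃ p ∈ s, A p) (hx : x ∉ ⋃ p ∈ s, A p) :
      1 ≤ ∑ p ∈ s, ‖(A p).indicator (fun _ => (1 : ℝ)) y - (A p).indicator (fun _ => 1) x‖ := by
    obtain ⟨p, hp, hyp⟩ := Set.mem_iUnion₂.1 hy
    have hxp : x ∉ A p := fun h => hx (Set.mem_biUnion hp h)
    refine le_trans ?_ (Finset.single_le_sum (fun _ _ => norm_nonneg _) hp)
    simp [hyp, hxp]
  have sum_nonneg := Finset.sum_nonneg fun p (_ : p ∈ s) =>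
    norm_nonneg ((A p).indicator (fun _ => (1 : ℝ)) y - (A p).indicator (fun _ => 1) x)
  by_cases hy : y ∈ ⋃ p ∈ s, A p <;> by_cases hx : x ∈ ⋃ p ∈ s, A p
  · simpa [Set.indicator_of_mem hy, Set.indicator_of_mem hx] using sum_nonneg
  · simpa [Set.indicator_of_mem hy, Set.indicator_of_notMem hx] using one_le_sum hy hx
  · simpa [Set.indicator_of_notMem hy, Set.indicator_of_mem hx, norm_sub_rev]
      using one_le_sum hx hy
  · simpa [Set.indicator_of_notMem hy, Set.indicator_of_notMem hx] using sum_nonneg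

lemma translationModulus_indicator_biUnion_le {ι : Type*} (s : Finset ι) {A : ι → Set (E d)}
    (hA : ∀ p ∈ s, Integrable ((A p).indicator fun _ => (1 : ℝ))) (z : E d) :
    translationModulus ((⋃ p ∈ s, A p).indicator fun _ => (1 : ℝ)) z
      ≤ ∑ p ∈ s, translationModulus ((A p).indicator fun _ => (1 : ℝ)) z := by
  have integrable_sub (p : ι) (hp : p ∈ s) :=
    (integrable_comp_add_right_sub (hA p hp) z).norm
  unfold translationModulus
  rw [← integral_finsetSum _ integrable_sub]
  exact integral_mono_of_nonneg (ae_of_all _ fun _ => norm_nonneg _)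
    (integrable_finsetSum _ integrable_sub)
    (ae_of_all _ fun x => norm_indicator_biUnion_sub_le s A x (x + z))

lemma IsFigure.isBVSet {F : Set (E d)} (hF : IsFigure F) : IsBVSet F := by
  obtain ⟨R, hR, rfl⟩ := hF
  have subset_cube : (⋃ p ∈ R, rect p.1 p.2) ⊆ cube d := Set.iUnion₂_subset fun p hp =>
    rect_subset_cube (fun i => (hR p hp i).1) fun i => (hR p hp i).2.2
  have nullMeasurable : NullMeasurableSet (⋃ p ∈ R, rect p.1 p.2 : Set (E d)) :=
    (R.measurableSet_biUnion fun p _ => measurableSet_rect p.1 p.2).nullMeasurableSet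
  refine ⟨subset_cube, nullMeasurable, (variation_le_of_translationModulus_le
    (integrable_indicator_of_subset_cube subset_cube nullMeasurable)
    (C := fun _ => ∑ _p ∈ R, 2) fun i => Eventually.frequently ?_).trans_lt ENNReal.ofReal_lt_top⟩
  filter_upwards [self_mem_nhdsWithin] with t ht
  rw [Finset.sum_mul]
  refine (translationModulus_indicator_biUnion_le R (fun p _ => integrable_indicator_rect p.1 p.2)
    _).trans (Finset.sum_le_sum fun p hp => translationModulus_indicator_rect_le (fun j => ?_) i
      (Set.mem_Ioi.1 ht).le)
  linarith [(hR p hp j).1, (hR p hp j).2.2]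

/-! ### Partial sums on dyadic rectangles -/

lemma dyadicLo_le_one {n : ℕ} {q : Fin d → ℕ} (hq : ∀ i, q i ≤ 2 ^ n) (i : Fin d) :
    dyadicLo n q i ≤ 1 := by
  rw [dyadicLo, div_le_one (by positivity)]
  exact_mod_cast hq i

lemma mem_rect_dyadicLo_iff {n : ℕ} {p q : Fin d → ℕ} {x : E d}
    (hx : ∀ i, x i ≠ dyadicLo n q i) : x ∈ rect (dyadicLo n p) (dyadicLo n q) ↔
      ∀ i, (p i : ℤ) ≤ cellIndex n x i ∧ cellIndex n x i < q i := by
  have two_pow_pos : (0 : ℝ) < 2 ^ n := by positivity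
  refine forall_congr' fun i => and_congr ?_ ?_
  · rw [cellIndex, Int.le_floor, dyadicLo, div_le_iff₀ two_pow_pos, mul_comm]
    simp
  · rw [(hx i).le_iff_lt, cellIndex, Int.floor_lt, dyadicLo, lt_div_iff₀ two_pow_pos, mul_comm]
    simp

namespace DyadicNumbering

variable (K : DyadicNumbering d)

lemma cubeT_indBV_rect (n k : ℕ) {p q : Fin d → ℕ} (hq : ∀ i, q i ≤ 2 ^ n) :
    K.cubeT n k (indBV (rect (dyadicLo n p) (dyadicLo n q)))
      = if K.corner n k ∈ Fintype.piFinset (fun i => Finset.Ico (p i) (q i))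
        then (2 ^ (n * d))⁻¹ else 0 := by
  have hBV : IsBVSet (rect (dyadicLo n p) (dyadicLo n q)) :=
    isBVSet_rect (dyadicLo_nonneg n p) (dyadicLo_le_one hq)
  rw [cubeT_apply, setIntegral_congr_set (K.set_ae_eq_cell n k),
    setIntegral_congr_ae (g := fun _ =>
      if K.corner n k ∈ Fintype.piFinset (fun i => Finset.Ico (p i) (q i)) then (1 : ℝ) else 0)
      (measurableSet_cell _ _)]
  · rw [setIntegral_const, Measure.real, volume_cell, ENNReal.toReal_ofReal (by positivity)]
    simp
  · filter_upwards [ae_all_iff.2 fun i => ae_coord_ne i (dyadicLo n q i), coe_indBV hBV]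
      with x hx coe_rect hxk
    have mem_rect_iff : x ∈ rect (dyadicLo n p) (dyadicLo n q) ↔
        K.corner n k ∈ Fintype.piFinset (fun i => Finset.Ico (p i) (q i)) := by
      rw [mem_rect_dyadicLo_iff hx, mem_cell.1 hxk]
      simp
    rw [coe_rect]
    split_ifs with h
    · exact Set.indicator_of_mem (mem_rect_iff.2 h) _
    · exact Set.indicator_of_notMem (mt mem_rect_iff.1 h) _

lemma sum_lamSeq_smul_faberSchauder_apply_rect (f : E d → ℝ) (n : ℕ) {p q : Fin d → ℕ}
    (hpq : ∀ i, p i ≤ q i) (hq : ∀ i, q i ≤ 2 ^ n) :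
    ((∑ j ∈ Finset.range (2 ^ (n * d)), lamSeq K f j • faberSchauder K j : SCH d) :
      BV d →L[ℝ] ℝ) (indBV (rect (dyadicLo n p) (dyadicLo n q)))
      = rectIncrement f (dyadicLo n p) (dyadicLo n q) := by
  set u : BV d := indBV (rect (dyadicLo n p) (dyadicLo n q))
  set cells : Finset (Fin d → ℕ) := Fintype.piFinset fun i => Finset.Ico (p i) (q i)
  have cells_subset : cells ⊆ Fintype.piFinset fun _ => Finset.range (2 ^ n) :=
    Fintype.piFinset_subset _ _ fun i _ hm =>
      Finset.mem_range.2 ((Finset.mem_Ico.1 hm).2.trans_le (hq i))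
  calc ((∑ j ∈ Finset.range (2 ^ (n * d)), lamSeq K f j • faberSchauder K j : SCH d) :
        BV d →L[ℝ] ℝ) u
      = ∑ j ∈ Finset.range (2 ^ (n * d)),
          haarCoefSeq d (K.increment f) j • haarCoefSeq d (fun n k => K.cubeT n k u) j := by
        simp only [Submodule.coe_sum, Submodule.coe_smul, sum_apply, smul_apply,
          faberSchauder_apply, lamSeq_eq_haarCoefSeq]
    _ = ∑ k ∈ Finset.range (2 ^ (n * d)), (2 ^ (n * d) * K.increment f n k) • K.cubeT n k u :=
        sum_haarCoefSeq_smul_haarCoefSeq (K.dyadicAdditive_increment f)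
          (K.dyadicAdditive_cubeT_apply u) n
    _ = ∑ k ∈ Finset.range (2 ^ (n * d)),
          if K.corner n k ∈ cells then K.increment f n k else 0 := by
        refine Finset.sum_congr rfl fun k _ => ?_
        rw [K.cubeT_indBV_rect n k hq, smul_eq_mul, mul_ite, mul_zero]
        congr 1
        field_simp
    _ = ∑ m ∈ cells, rectIncrement f (dyadicLo n m) (dyadicHi n m) := by
        simp only [increment]
        rw [K.sum_corner fun m =>
          if m ∈ cells then rectIncrement f (dyadicLo n m) (dyadicHi n m) else 0,
          Finset.sum_ite_mem, Finset.inter_eq_right.2 cells_subset]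
    _ = rectIncrement f (dyadicLo n p) (dyadicLo n q) := sum_rectIncrement_dyadic f n hpq

end DyadicNumbering

/-! ### Dyadic approximation of rectangles -/

/-- The numerators of the largest dyadic numbers of generation `n` below the coordinates of `a`. -/
def dyadicFloor (n : ℕ) (a : Fin d → ℝ) : Fin d → ℕ := fun i => ⌊2 ^ n * a i⌋₊

lemma tendsto_dyadicLo_dyadicFloor {a : Fin d → ℝ} (ha : ∀ i, 0 ≤ a i) (i : Fin d) :
    Tendsto (fun n => dyadicLo n (dyadicFloor n a) i) atTop (𝓝 (a i)) := by
  refine ((tendsto_nat_floor_mul_div_atTop (ha i)).comp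
    (tendsto_pow_atTop_atTop_of_one_lt (one_lt_two (α := ℝ)))).congr fun n => ?_
  simp [dyadicLo, dyadicFloor, mul_comm]

lemma dyadicFloor_mono {a b : Fin d → ℝ} (h : ∀ i, a i ≤ b i) (n : ℕ) (i : Fin d) :
    dyadicFloor n a i ≤ dyadicFloor n b i :=
  Nat.floor_mono (mul_le_mul_of_nonneg_left (h i) (by positivity))

lemma dyadicFloor_le {b : Fin d → ℝ} (h : ∀ i, b i ≤ 1) (n : ℕ) (i : Fin d) :
    dyadicFloor n b i ≤ 2 ^ n := by
  refine Nat.floor_le_of_le ?_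
  push_cast
  exact mul_le_of_le_one_right (by positivity) (h i)

lemma tendsto_rectIncrement {f : E d → ℝ} (hf : ContinuousOn f (cube d)) {a b : Fin d → ℝ}
    {a' b' : ℕ → Fin d → ℝ} (ha : ∀ i, a i ∈ Set.Icc (0 : ℝ) 1) (hb : ∀ i, b i ∈ Set.Icc (0 : ℝ) 1)
    (ha' : ∀ n i, a' n i ∈ Set.Icc (0 : ℝ) 1) (hb' : ∀ n i, b' n i ∈ Set.Icc (0 : ℝ) 1)
    (hta : ∀ i, Tendsto (fun n => a' n i) atTop (𝓝 (a i)))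
    (htb : ∀ i, Tendsto (fun n => b' n i) atTop (𝓝 (b i))) :
    Tendsto (fun n => rectIncrement f (a' n) (b' n)) atTop (𝓝 (rectIncrement f a b)) := by
  refine tendsto_finsetSum _ fun S _ => Tendsto.const_mul _ ?_
  have vertex_mem {a b : Fin d → ℝ} (ha : ∀ i, a i ∈ Set.Icc (0 : ℝ) 1)
      (hb : ∀ i, b i ∈ Set.Icc (0 : ℝ) 1) :
      (WithLp.toLp 2 fun i => if i ∈ S then a i else b i : E d) ∈ cube d := fun i => by
    change (if i ∈ S then a i else b i) ∈ Set.Icc (0 : ℝ) 1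
    split_ifs
    exacts [ha i, hb i]
  refine (hf _ (vertex_mem ha hb)).tendsto.comp
    (tendsto_nhdsWithin_iff.2 ⟨?_, .of_forall fun n => vertex_mem (ha' n) (hb' n)⟩)
  refine ((PiLp.continuous_toLp 2 _).tendsto _).comp (tendsto_pi_nhds.2 fun i => ?_)
  split_ifs
  exacts [hta i, htb i]

lemma eventually_mem_rect_iff {a b : Fin d → ℝ} {a' b' : ℕ → Fin d → ℝ}
    (hta : ∀ i, Tendsto (fun n => a' n i) atTop (𝓝 (a i)))
    (htb : ∀ i, Tendsto (fun n => b' n i) atTop (𝓝 (b i))) {x : E d}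
    (hxa : ∀ i, x i ≠ a i) (hxb : ∀ i, x i ≠ b i) :
    ∀ᶠ n in atTop, (x ∈ rect (a' n) (b' n) ↔ x ∈ rect a b) := by
  have lower_iff (i : Fin d) : ∀ᶠ n in atTop, (a' n i ≤ x i ↔ a i ≤ x i) := by
    rcases (hxa i).lt_or_gt with h | h
    · filter_upwards [(hta i).eventually (lt_mem_nhds h)] with n hn
      exact iff_of_false hn.not_ge h.not_ge
    · filter_upwards [(hta i).eventually (gt_mem_nhds h)] with n hn
      exact iff_of_true hn.le h.le
  have upper_iff (i : Fin d) : ∀ᶠ n in atTop, (x i ≤ b' n i ↔ x i ≤ b i) := by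
    rcases (hxb i).lt_or_gt with h | h
    · filter_upwards [(htb i).eventually (lt_mem_nhds h)] with n hn
      exact iff_of_true hn.le h.le
    · filter_upwards [(htb i).eventually (gt_mem_nhds h)] with n hn
      exact iff_of_false hn.not_ge h.not_ge
  filter_upwards [eventually_all.2 lower_iff, eventually_all.2 upper_iff] with n hlower hupper
  exact forall_congr' fun i => and_congr (hlower i) (hupper i)

lemma bvConverges_rect {a b : Fin d → ℝ} {a' b' : ℕ → Fin d → ℝ}
    (ha' : ∀ n i, 0 ≤ a' n i) (hb' : ∀ n i, b' n i ≤ 1)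
    (hta : ∀ i, Tendsto (fun n => a' n i) atTop (𝓝 (a i)))
    (htb : ∀ i, Tendsto (fun n => b' n i) atTop (𝓝 (b i))) :
    BVConverges (fun n => rect (a' n) (b' n)) (rect a b) := by
  have ha (i : Fin d) : 0 ≤ a i := ge_of_tendsto' (hta i) fun n => ha' n i
  have hb (i : Fin d) : b i ≤ 1 := le_of_tendsto' (htb i) fun n => hb' n i
  refine ⟨(iSup_le fun n => perimeter_rect_le fun i => ?_).trans_lt ENNReal.ofReal_lt_top, ?_⟩
  · linarith [ha' n i, hb' n i]
  rw [← measure_empty (μ := (volume : Measure (E d)))]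
  refine tendsto_measure_of_ae_tendsto_indicator atTop MeasurableSet.empty
    (fun n => (measurableSet_rect _ _).symmDiff (measurableSet_rect _ _))
    (measurableSet_rect _ _) (volume_cube_lt_top d).ne (.of_forall fun n => ?_) ?_
  · exact Set.symmDiff_subset_union.trans
      (Set.union_subset (rect_subset_cube (ha' n) (hb' n)) (rect_subset_cube ha hb))
  · filter_upwards [ae_all_iff.2 fun i => ae_coord_ne i (a i),
      ae_all_iff.2 fun i => ae_coord_ne i (b i)] with x hxa hxb
    filter_upwards [eventually_mem_rect_iff hta htb hxa hxb] with n hn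
    simp [Set.mem_symmDiff, hn]

/-! ### Convergent series come from strongly chargeable functions -/

lemma tendsto_apply_sub_apply_of_norm_le {F : Type*} [SeminormedAddCommGroup F] [NormedSpace ℝ F]
    {P : ℕ → F →L[ℝ] ℝ} {α : F →L[ℝ] ℝ} (hP : Tendsto P atTop (𝓝 α)) {u : ℕ → F} {M : ℝ}
    (hu : ∀ n, ‖u n‖ ≤ M) : Tendsto (fun n => P n (u n) - α (u n)) atTop (𝓝 0) := by
  refine squeeze_zero_norm (fun n => ?_)
    (by simpa using (tendsto_iff_norm_sub_tendsto_zero.1 hP).mul_const M)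
  rw [← sub_apply]
  exact (P n - α).le_opNorm_of_le (hu n)

theorem apply_indBV_rect_of_tendsto (hd : 1 ≤ d) (K : DyadicNumbering d) {f : E d → ℝ}
    (hf : ContinuousOn f (cube d)) {α : SCH d}
    (hα : Tendsto (fun N => ∑ j ∈ Finset.range N, lamSeq K f j • faberSchauder K j) atTop (𝓝 α))
    {a b : Fin d → ℝ} (hab : IsRectBounds a b) :
    (α : BV d →L[ℝ] ℝ) (indBV (rect a b)) = rectIncrement f a b := by
  have hle (i : Fin d) : a i ≤ b i := (hab i).2.1.le
  have ha (i : Fin d) : a i ∈ Set.Icc (0 : ℝ) 1 := ⟨(hab i).1, (hle i).trans (hab i).2.2⟩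
  have hb (i : Fin d) : b i ∈ Set.Icc (0 : ℝ) 1 := ⟨(hab i).1.trans (hle i), (hab i).2.2⟩
  have floor_mem {c : Fin d → ℝ} (hc : ∀ i, c i ∈ Set.Icc (0 : ℝ) 1) (n : ℕ) (i : Fin d) :
      dyadicLo n (dyadicFloor n c) i ∈ Set.Icc (0 : ℝ) 1 :=
    ⟨dyadicLo_nonneg _ _ _, dyadicLo_le_one (dyadicFloor_le (fun i => (hc i).2) n) i⟩
  have tendsto_a := tendsto_dyadicLo_dyadicFloor fun i => (ha i).1
  have tendsto_b := tendsto_dyadicLo_dyadicFloor fun i => (hb i).1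
  set R : ℕ → Set (E d) := fun n =>
    rect (dyadicLo n (dyadicFloor n a)) (dyadicLo n (dyadicFloor n b))
  have isBVSet_R (n : ℕ) : IsBVSet (R n) :=
    isBVSet_rect (fun i => (floor_mem ha n i).1) fun i => (floor_mem hb n i).2
  have tendsto_R : BVConverges R (rect a b) := bvConverges_rect
    (fun n i => (floor_mem ha n i).1) (fun n i => (floor_mem hb n i).2) tendsto_a tendsto_b
  have norm_le (n : ℕ) :
      ‖indBV (R n)‖ ≤ volume.real (cube d) + (⨆ n, perimeter (R n)).toReal :=
    (norm_indBV_le (isBVSet_R n)).trans (add_le_add le_rfl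
      (ENNReal.toReal_mono tendsto_R.1.ne (le_iSup (fun n => perimeter (R n)) n)))
  have tendsto_two_pow : Tendsto (fun n : ℕ => 2 ^ (n * d)) atTop atTop :=
    tendsto_atTop_mono (fun n => (Nat.le_mul_of_pos_right n hd).trans Nat.lt_two_pow_self.le)
      tendsto_id
  have tendsto_sub := tendsto_apply_sub_apply_of_norm_le
    ((continuous_subtype_val.tendsto α).comp (hα.comp tendsto_two_pow)) norm_le
  have tendsto_apply := (isStrongCharge_of_mem_SCH hd α.2).1.2 R (rect a b) isBVSet_R
    (isBVSet_rect (fun i => (ha i).1) fun i => (hb i).2) tendsto_R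
  refine tendsto_nhds_unique ?_
    (tendsto_rectIncrement hf ha hb (floor_mem ha) (floor_mem hb) tendsto_a tendsto_b)
  rw [← zero_add ((α : BV d →L[ℝ] ℝ) (indBV (rect a b)))]
  refine (tendsto_sub.add tendsto_apply).congr fun n => ?_
  rw [sub_add_cancel]
  exact K.sum_lamSeq_smul_faberSchauder_apply_rect f n (dyadicFloor_mono hle n)
    (dyadicFloor_le (fun i => (hb i).2) n)

theorem stronglyChargeable_of_seriesConverges (hd : 1 ≤ d) (K : DyadicNumbering d) {f : E d → ℝ}
    (hf : ContinuousOn f (cube d))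
    (h : SeriesConverges fun j => lamSeq K f j • faberSchauder K j) : StronglyChargeable f := by
  obtain ⟨α, hα⟩ := h
  have strongCharge := isStrongCharge_of_mem_SCH hd α.2
  exact ⟨_, strongCharge, fun _ _ => apply_indBV_rect_of_tendsto hd K hf hα,
    fun F₁ F₂ h₁ h₂ => strongCharge.1.1 F₁ F₂ h₁.isBVSet h₂.isBVSet⟩

end

end StrongCharge

theorem mainTheorem7_general (d : ℕ) (hd : 1 ≤ d) (K : StrongCharge.DyadicNumbering d)
    (f : StrongCharge.E d → ℝ) (hf : ContinuousOn f (StrongCharge.cube d)) :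
    StrongCharge.StronglyChargeable f ↔
      StrongCharge.SeriesConverges fun j =>
        StrongCharge.lamSeq K f j • StrongCharge.faberSchauder K j :=
  ⟨StrongCharge.seriesConverges_of_stronglyChargeable hd K,
    StrongCharge.stronglyChargeable_of_seriesConverges hd K hf⟩

theorem mainTheorem7 (d : ℕ) (hd : 1 ≤ d) (K : StrongCharge.DyadicNumbering d)
    (f : StrongCharge.E d → ℝ) (hf : StrongCharge.MemC0 f) :
    StrongCharge.StronglyChargeable f ↔
      StrongCharge.SeriesConverges fun j =>
        StrongCharge.lamSeq K f j • StrongCharge.faberSchauder K j :=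
  mainTheorem7_general d hd K f hf.1
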